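/- Let $k$ be an algebraically closed field of characteristic $0$, let $X$ be a non-empty smooth quasi-projective surface over $k$, and let $n\ge 1$ be an integer. For a zero-dimensional closed subscheme $\xi\subset X$ of length $n$ (that is, $\dim_k\Gamma(\xi,\mathcal O_\xi)=n$) and a point $p\in\xi$, let $$b_2(\mathcal O_{\xi,p})=\dim_{k(p)}\operatorname{Hom}_{\mathcal O_{X,p}}\bigl(k(p),\mathcal O_{\xi,p}\bigr)$$ be the dimension of the socle of $\mathcal O_{\xi,p}$. Then: (1) for all such $\xi$ and $p$, $$b_2(\mathcal O_{\xi,p})\le\left\lfloor\frac{\sqrt{1+8n}-1}{2}\right\rfloor;$$ (2) this bound is optimal: there are a zero-dimensional closed subscheme $\xi\subset X$ of length $n$ and a point $p\in\xi$ for which equality holds; (3) let $X^{[n]}$ be the Hilbert scheme of $n$ points on $X$, which represents, on the category of $k$-schemes locally of finite type, the functor sending $T$ to the set of closed subschemes $W\subset X\times_k T$ that are finite and locally free of rank $n$ over $T$, and let $Z^n\subset X\times_k X^{[n]}$ be its universal family. For every closed point $\zeta\in Z^n$, the Samuel multiplicity $\mu$ of the Noetherian local ring $(\mathcal O_{Z^n,\zeta},\mathfrak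 m)$, namely $$\mu=\lim_{t\to\infty}\frac{d!\,\operatorname{length}(\mathcal O_{Z^n,\zeta}/\mathfrak m^{t})}{t^{d}},\qquad d=\dim\mathcal O_{Z^n,\zeta},$$ satisfies $\mu\le n$. -/

import Mathlib

open CategoryTheory CategoryTheory.Limits AlgebraicGeometry

universe u

noncomputable section

/-- For a local ring `R` and a ring homomorphism `φ : R → A`, the dimension of the socle
`Hom_R(κ(R), A)` over the residue field `κ(R)`. The scalars act on this `R`-module through the
surjection `R → κ(R)`, so its dimension over `κ(R)` is its length over `R` (an element of
`ℕ∞`, with no junk value). -/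
def socleDim {R A : Type u} [CommRing R] [IsLocalRing R] [CommRing A] (φ : R →+* A) : ℕ∞ :=
  letI : Algebra R A := φ.toAlgebra
  Module.length R (IsLocalRing.ResidueField R →ₗ[R] A)

/-- The real number `μ` is the Samuel multiplicity of the Noetherian local ring `(R, 𝔪)`:
if `d = dim R`, then `d! * length (R / 𝔪 ^ t) / t ^ d` tends to `μ` as `t → ∞`.
(All the lengths are finite since `R` is Noetherian.) -/
def HasSamuelMultiplicity (R : Type u) [CommRing R] [IsLocalRing R] (μ : ℝ) : Prop :=
  IsNoetherianRing R ∧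
  ∃ d : ℕ, ringKrullDim R = d ∧
    Filter.Tendsto
      (fun t : ℕ => (d.factorial : ℝ) *
        ((Module.length R (R ⧸ IsLocalRing.maximalIdeal R ^ t)).toNat : ℝ) / (t : ℝ) ^ d)
      Filter.atTop (nhds μ)

section

attribute [local instance] MvPolynomial.gradedAlgebra

variable {k : Type u} [Field k]

/-- Projective space `ℙ^N` over the field `k`, as the `Proj` of `k[x_0, …, x_N]`. -/
abbrev projSpace (k : Type u) [Field k] (N : ℕ) : Scheme.{u} :=
  Proj (MvPolynomial.homogeneousSubmodule (Fin (N + 1)) k)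

/-- The structure morphism `ℙ^N → Spec k`. -/
def projSpaceHom (k : Type u) [Field k] (N : ℕ) : projSpace k N ⟶ Spec (.of k) :=
  Proj.toSpecZero (MvPolynomial.homogeneousSubmodule (Fin (N + 1)) k) ≫
    Spec.map (CommRingCat.ofHom
      (algebraMap k (MvPolynomial.homogeneousSubmodule (Fin (N + 1)) k 0)))

/-- A `k`-scheme is quasi-projective if it is a locally closed subscheme of some `ℙ^N`. -/
def IsQuasiProjective {X : Scheme.{u}} (f : X ⟶ Spec (.of k)) : Prop :=
  ∃ (N : ℕ) (j : X ⟶ projSpace k N), IsImmersion j ∧ j ≫ projSpaceHom k N = f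

/-- `i : ξ → X` is a zero-dimensional closed subscheme of length `n` of the `k`-scheme `X`:
`ξ` is finite over `k` and `dim_k Γ(ξ, 𝒪_ξ) = n`. -/
def IsClosedSubschemeOfLength {X : Scheme.{u}} (f : X ⟶ Spec (.of k)) (n : ℕ)
    {ξ : Scheme.{u}} (i : ξ ⟶ X) : Prop :=
  IsClosedImmersion i ∧ IsFinite (i ≫ f) ∧
    letI : Algebra k Γ(ξ, ⊤) :=
      ((Scheme.ΓSpecIso (.of k)).inv ≫ (i ≫ f).appTop).hom.toAlgebra
    Module.finrank k Γ(ξ, ⊤) = n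

/-- `b_2(𝒪_{ξ,p})`: the dimension of the socle `Hom_{𝒪_{X,p}}(k(p), 𝒪_{ξ,p})` of the closed
subscheme `i : ξ → X` at the point `p` of `ξ`. -/
def socleDimAt {X ξ : Scheme.{u}} (i : ξ ⟶ X) (p : ξ) : ℕ∞ :=
  socleDim (i.stalkMap p).hom

/-- A flat family over the `k`-scheme `T` of length-`n` closed subschemes of the `k`-scheme `X`:
morphisms `q : W → X` and `π : W → T` over `k` that make `W` a closed subscheme of `X ×_k T`,
with `π` finite and locally free of rank `n`. -/
structure IsFamily {X : Scheme.{u}} (f : X ⟶ Spec (.of k)) (n : ℕ)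
    {T W : Scheme.{u}} (t : T ⟶ Spec (.of k)) (q : W ⟶ X) (π : W ⟶ T) : Prop where
  comm : q ≫ f = π ≫ t
  isClosedImmersion : IsClosedImmersion (pullback.lift q π comm)
  isFinite : IsFinite π
  flat : Flat π
  locallyOfFinitePresentation : LocallyOfFinitePresentation π
  rank : ∀ s : T, π.finrank s = n

/-- `h : H → Spec k` is the Hilbert scheme of `n` points on the `k`-scheme `X`, with universal
family `Z ⊆ X ×_k H` given by the projections `q : Z → X` and `π : Z → H`: in the category of
`k`-schemes locally of finite type, `(H, Z)` represents the functor that sends `T` to the set of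
flat families over `T` of length-`n` closed subschemes of `X`. That is, each family `W ⊆ X ×_k T`
is the pullback, as a subscheme of `X ×_k T`, of `Z` along a unique `k`-morphism `T → H`. -/
structure IsHilbertScheme {X : Scheme.{u}} (f : X ⟶ Spec (.of k)) (n : ℕ)
    {H Z : Scheme.{u}} (h : H ⟶ Spec (.of k)) (q : Z ⟶ X) (π : Z ⟶ H) : Prop where
  locallyOfFiniteType : LocallyOfFiniteType h
  isFamily : IsFamily f n h q π
  existsUnique : ∀ {T W : Scheme.{u}} (t : T ⟶ Spec (.of k)) (q' : W ⟶ X) (π' : W ⟶ T),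
    LocallyOfFiniteType t → IsFamily f n t q' π' →
      ∃! φ : T ⟶ H, φ ≫ h = t ∧ ∃ g : W ⟶ Z, g ≫ q = q' ∧ IsPullback g π' π φ

end

end

/-! Socle bound. Write the local ring A of `ξ` at `p` as a quotient D → A of a smooth
two-dimensional algebra, let 𝔭 be the ideal of the point in D, and let r be the largest integer with
kernel inside 𝔭^r. Then A surjects onto the polynomials in two variables truncated at degree r, so
r(r+1)/2 ≤ n. Some f in the kernel has a nonzero leading form P of degree r; if P(c) ≠ 0 and l is a
linear form vanishing in the direction c, then A/(l) is generated by one element z with z^r = 0, so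
its dimension is at most r. Since l kills the socle, the socle lies in the kernel of multiplication
by l, whose dimension is that of A/(l). Hence the socle has dimension at most r
(`exists_finrank_augSocle_le`). Equality comes from a monomial staircase with b corners whose first
column is lengthened to reach length n exactly (`exists_le_socleDimAt`).

Multiplicity. The essential input is that the Hilbert scheme is unobstructed. A family over an
Artinian base is a finite free algebra generated by two elements, that is, a pair of commuting
matrices with a cyclic vector. Over a small extension, lifts X, Y of the matrices have commutator
e·c, and the obstruction to correcting them is the class of c modulo the matrices [ξ,Y] + [X,η]. By
trace duality and cyclicity it vanishes once c is trace-orthogonal to all X^a Y^b, and in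
characteristic zero this follows from tr(X^a [X, Y^(b+1)]) = 0
(`Matrix.exists_commute_of_commute_mod`). The embedding into X lifts because X is smooth.

Consequently an affine chart A of H surjects, at a rational point with N-dimensional cotangent
space, onto every truncated polynomial ring in N variables; comparing growth rates, the height of
the point is at least N (`finrank_cotangent_le_height`). For C finite flat of rank n over A and P a
maximal ideal over p, the quotient C/(pC)^t is spanned by n times the number of monomials of degree
< t in N variables, and it maps onto C/P^t. By flatness the local dimension d is at least N, so the
leading coefficient gives μ ≤ n. The limit exists because the Hilbert–Samuel function counts
standard monomials and is therefore eventually polynomial. -/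

noncomputable section

/-! ### Quotients of polynomial rings by monomial ideals of finite colength. -/

namespace TruncAlg

open MvPolynomial

/-- The ideal of polynomials spanned by the monomials with exponents outside `S`. -/
def ideal (k : Type*) [Field k] {σ : Type*} (S : Finset (σ →₀ ℕ)) : Ideal (MvPolynomial σ k) :=
  Ideal.span ((fun s => monomial s (1 : k)) '' {s | s ∉ S})

variable {k : Type*} [Field k] {σ : Type*} {S S' : Finset (σ →₀ ℕ)}

/-- For a lower set the complement is closed under multiplication by monomials, so the ideal
generated by the outside monomials contains no monomial with exponent in `S`. -/
theorem mem_ideal (hS : IsLowerSet (S : Set (σ →₀ ℕ))) {p : MvPolynomial σ k} :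
    p ∈ ideal k S ↔ ∀ s ∈ S, coeff s p = 0 := by
  rw [ideal, mem_ideal_span_monomial_image]
  constructor
  · intro h s hs
    by_contra hc
    obtain ⟨t, ht, hts⟩ := h s (mem_support_iff.2 hc)
    exact ht (hS hts hs)
  · intro h s hs
    exact ⟨s, fun hs' => mem_support_iff.1 hs (h s hs'), le_rfl⟩

theorem ideal_anti (h : S ⊆ S') : ideal k S' ≤ ideal k S :=
  Ideal.span_mono (Set.image_mono fun _ hs hs' => hs (h hs'))

end TruncAlg

/-- The quotient of a polynomial ring by the monomials with exponents outside a finite set `S`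
(in practice a lower set). -/
def TruncAlg (k : Type*) [Field k] {σ : Type*} (S : Finset (σ →₀ ℕ)) : Type _ :=
  MvPolynomial σ k ⧸ TruncAlg.ideal k S

instance (k : Type*) [Field k] {σ : Type*} (S : Finset (σ →₀ ℕ)) : CommRing (TruncAlg k S) :=
  inferInstanceAs (CommRing (MvPolynomial σ k ⧸ TruncAlg.ideal k S))

instance (k : Type*) [Field k] {σ : Type*} (S : Finset (σ →₀ ℕ)) : Algebra k (TruncAlg k S) :=
  inferInstanceAs (Algebra k (MvPolynomial σ k ⧸ TruncAlg.ideal k S))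

namespace TruncAlg

open MvPolynomial

variable {k : Type*} [Field k] {σ : Type*} {S S' : Finset (σ →₀ ℕ)}

/-- The quotient map. -/
def mk (k : Type*) [Field k] {σ : Type*} (S : Finset (σ →₀ ℕ)) :
    MvPolynomial σ k →ₐ[k] TruncAlg k S :=
  Ideal.Quotient.mkₐ k (ideal k S)

theorem mk_surjective : Function.Surjective (mk k S) :=
  Ideal.Quotient.mk_surjective

theorem mk_eq_zero_iff {p : MvPolynomial σ k} : mk k S p = 0 ↔ p ∈ ideal k S :=
  Ideal.Quotient.eq_zero_iff_mem

/-- The class of a monomial. -/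
def mono (k : Type*) [Field k] {σ : Type*} (S : Finset (σ →₀ ℕ)) (s : σ →₀ ℕ) :
    TruncAlg k S :=
  mk k S (monomial s 1)

theorem mono_eq_zero {s : σ →₀ ℕ} (hs : s ∉ S) : mono k S s = 0 :=
  mk_eq_zero_iff.2 (Ideal.subset_span ⟨s, hs, rfl⟩)

theorem mono_add (s t : σ →₀ ℕ) : mono k S (s + t) = mono k S s * mono k S t := by
  rw [mono, mono, mono, ← map_mul, monomial_mul, one_mul]

theorem mono_zero : mono k S 0 = 1 := map_one (mk k S)

/-- The coefficients of an element of `TruncAlg k S` along the exponents in `S`. -/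
def coeffEquiv (hS : IsLowerSet (S : Set (σ →₀ ℕ))) : TruncAlg k S ≃ₗ[k] (S → k) := by
  let f : MvPolynomial σ k →ₗ[k] (S → k) := LinearMap.pi fun s => lcoeff k s.1
  have hker : LinearMap.ker f = (ideal k S).restrictScalars k := by
    ext p
    simp only [LinearMap.mem_ker, Submodule.restrictScalars_mem, mem_ideal hS, funext_iff,
      Subtype.forall]
    rfl
  have hsurj : Function.Surjective f := by
    classical
    intro g
    refine ⟨∑ s : S, monomial s.1 (g s), ?_⟩
    ext t
    simp only [map_sum, f, LinearMap.pi_apply, lcoeff_apply, coeff_monomial]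
    rw [Finset.sum_eq_single t]
    · simp
    · intro b _ hb
      rw [if_neg fun h => hb (Subtype.ext h)]
    · simp
  exact ((Submodule.Quotient.restrictScalarsEquiv k (ideal k S)).symm ≪≫ₗ
    Submodule.quotEquivOfEq _ _ hker.symm ≪≫ₗ f.quotKerEquivOfSurjective hsurj :
      (MvPolynomial σ k ⧸ ideal k S) ≃ₗ[k] (S → k))

theorem coeffEquiv_mk (hS : IsLowerSet (S : Set (σ →₀ ℕ))) (p : MvPolynomial σ k) (s : S) :
    coeffEquiv hS (mk k S p) s = coeff s.1 p := rfl

theorem finite (hS : IsLowerSet (S : Set (σ →₀ ℕ))) : Module.Finite k (TruncAlg k S) :=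
  Module.Finite.equiv (coeffEquiv hS).symm

theorem finrank (hS : IsLowerSet (S : Set (σ →₀ ℕ))) :
    Module.finrank k (TruncAlg k S) = S.card := by
  rw [(coeffEquiv hS).finrank_eq]; simp

theorem coeffEquiv_mono [DecidableEq σ] (hS : IsLowerSet (S : Set (σ →₀ ℕ))) (s : S) :
    coeffEquiv hS (mono k S s.1) = Pi.single s 1 := by
  ext t
  rw [mono, coeffEquiv_mk, coeff_monomial, Pi.single_apply]
  by_cases h : t = s
  · rw [if_pos h, if_pos (by rw [h])]
  · rw [if_neg h, if_neg fun h' => h (Subtype.ext h'.symm)]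

theorem mono_linearIndependent (hS : IsLowerSet (S : Set (σ →₀ ℕ))) :
    LinearIndependent k fun s : S => mono k S s.1 := by
  classical
  have := (Pi.basisFun k S).linearIndependent
  refine LinearIndependent.of_comp (coeffEquiv hS).toLinearMap ?_
  convert! this using 1
  ext1 s
  simp [coeffEquiv_mono hS]

/-- The projection for an inclusion of exponent sets. -/
def proj (h : S ⊆ S') : TruncAlg k S' →ₐ[k] TruncAlg k S :=
  (Ideal.Quotient.factorₐ k (ideal_anti (k := k) h) :
    (MvPolynomial σ k ⧸ ideal k S') →ₐ[k] MvPolynomial σ k ⧸ ideal k S)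

theorem proj_mk (h : S ⊆ S') (p : MvPolynomial σ k) :
    proj h (mk k S' p) = mk k S p := rfl

theorem proj_mono (h : S ⊆ S') (s : σ →₀ ℕ) : proj h (mono k S' s) = mono k S s := rfl

theorem proj_surjective (h : S ⊆ S') : Function.Surjective (proj (k := k) h) :=
  Ideal.Quotient.factor_surjective (ideal_anti h)

theorem exists_smul_mono_of_proj_eq_zero [DecidableEq σ] {s : σ →₀ ℕ}
    (hS : IsLowerSet (S : Set (σ →₀ ℕ)))
    (hS' : IsLowerSet ((insert s S : Finset (σ →₀ ℕ)) : Set (σ →₀ ℕ)))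
    {a : TruncAlg k (insert s S)} (ha : proj (Finset.subset_insert s S) a = 0) :
    ∃ c : k, a = c • mono k (insert s S) s := by
  obtain ⟨p, rfl⟩ := mk_surjective a
  rw [proj_mk, mk_eq_zero_iff, mem_ideal hS] at ha
  refine ⟨coeff s p, ?_⟩
  rw [mono, ← map_smul, ← sub_eq_zero, ← map_sub, mk_eq_zero_iff, mem_ideal hS']
  intro t ht
  rw [coeff_sub, coeff_smul, coeff_monomial]
  split_ifs with h
  · simp [h]
  · have := ha t ((Finset.mem_insert.1 ht).resolve_left (Ne.symm h))
    simp [this]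

theorem aeval_zero_of_mem_ideal (h0 : (0 : σ →₀ ℕ) ∈ S) {p : MvPolynomial σ k}
    (hp : p ∈ ideal k S) : MvPolynomial.aeval (fun _ => (0 : k)) p = 0 := by
  suffices h : ideal k S ≤ RingHom.ker (MvPolynomial.aeval (R := k) fun _ : σ => (0 : k)) from h hp
  rw [ideal, Ideal.span_le]
  rintro _ ⟨s, hs, rfl⟩
  have : s ≠ 0 := fun h => hs (h ▸ h0)
  obtain ⟨i, hi⟩ := Finsupp.ne_iff.1 this
  simp only [Finsupp.coe_zero, Pi.zero_apply] at hi
  simp only [SetLike.mem_coe, RingHom.mem_ker]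
  rw [aeval_monomial, Finsupp.prod, Finset.prod_eq_zero (Finsupp.mem_support_iff.2 hi)
    (zero_pow hi), mul_zero]

/-- The augmentation of `TruncAlg k S`, sending all variables to `0`. -/
def aug (h0 : (0 : σ →₀ ℕ) ∈ S) : TruncAlg k S →ₐ[k] k :=
  (Ideal.Quotient.liftₐ _ (MvPolynomial.aeval fun _ => (0 : k)) fun _ hp =>
    aeval_zero_of_mem_ideal h0 hp : (MvPolynomial σ k ⧸ ideal k S) →ₐ[k] k)

theorem aug_mk (h0 : (0 : σ →₀ ℕ) ∈ S) (p : MvPolynomial σ k) :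
    aug h0 (mk k S p) = MvPolynomial.aeval (fun _ => (0 : k)) p := rfl

theorem aug_mono (h0 : (0 : σ →₀ ℕ) ∈ S) {s : σ →₀ ℕ} (hs : s ≠ 0) : aug h0 (mono k S s) = 0 := by
  obtain ⟨i, hi⟩ := Finsupp.ne_iff.1 hs
  simp only [Finsupp.coe_zero, Pi.zero_apply] at hi
  rw [mono, aug_mk, aeval_monomial, Finsupp.prod, Finset.prod_eq_zero (Finsupp.mem_support_iff.2 hi)
      (zero_pow hi), mul_zero]

theorem aug_proj (h0 : (0 : σ →₀ ℕ) ∈ S) (h : S ⊆ S') (a : TruncAlg k S') :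
    aug h0 (proj h a) = aug (h h0) a := by
  obtain ⟨p, rfl⟩ := mk_surjective a
  rw [proj_mk, aug_mk, aug_mk]

theorem aug_surjective (h0 : (0 : σ →₀ ℕ) ∈ S) : Function.Surjective (aug (k := k) h0) :=
  fun c => ⟨algebraMap _ _ c, (aug h0).commutes c⟩

theorem ker_aug (h0 : (0 : σ →₀ ℕ) ∈ S) :
    RingHom.ker (aug (k := k) h0) = Ideal.span (Set.range fun i => mono k S (.single i 1)) := by
  refine le_antisymm ?_ (Ideal.span_le.2 ?_)
  · intro a ha
    obtain ⟨p, rfl⟩ := mk_surjective a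
    have key : ∀ p : MvPolynomial σ k, mk k S p -
        algebraMap k _ (MvPolynomial.aeval (fun _ => (0 : k)) p) ∈
          Ideal.span (Set.range fun i => mono k S (.single i 1)) := by
      intro p
      induction p using MvPolynomial.induction_on with
      | C a =>
        rw [← MvPolynomial.algebraMap_eq, AlgHom.commutes, AlgHom.commutes, Algebra.algebraMap_self_apply,
          sub_self]
        exact zero_mem _
      | add p q hp hq =>
        rw [map_add, map_add, map_add, add_sub_add_comm]
        exact add_mem hp hq
      | mul_X p i hp =>
        simp only [map_mul, aeval_X, mul_zero, map_zero, sub_zero]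
        exact Ideal.mul_mem_left _ _ (Ideal.subset_span ⟨i, rfl⟩)
    have := key p
    have h2 : (MvPolynomial.aeval (fun _ => (0 : k)) p) = 0 := by rwa [RingHom.mem_ker, aug_mk] at ha
    rwa [h2, map_zero, sub_zero] at this
  · rintro _ ⟨i, rfl⟩
    exact aug_mono h0 (by simp)

/-- Since `S` is a lower set without `s`, no `s + single i 1` lies in `insert s S`: the new monomial
is a socle element. This makes `proj` a small extension. -/
theorem mono_mul_of_aug_eq_zero [DecidableEq σ] {s : σ →₀ ℕ} (h0 : (0 : σ →₀ ℕ) ∈ insert s S)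
    (hS : IsLowerSet (S : Set (σ →₀ ℕ)))
    (hs : s ∉ S) {a : TruncAlg k (insert s S)} (ha : aug h0 a = 0) :
    a * mono k (insert s S) s = 0 := by
  have : a ∈ Ideal.span (Set.range fun i => mono k (insert s S) (.single i 1)) := by
    rw [← ker_aug h0]; exact ha
  refine Submodule.span_induction (p := fun a _ => a * mono k (insert s S) s = 0)
    ?_ (by simp) (fun _ _ _ _ h h' => by simp [add_mul, h, h'])
    (fun _ _ _ h => by simp [mul_assoc, h]) this
  rintro _ ⟨i, rfl⟩
  rw [← mono_add, mono_eq_zero]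
  rw [Finset.mem_insert, not_or]
  refine ⟨fun h => ?_, fun h => hs (hS (by simp) h)⟩
  have := DFunLike.congr_fun h i
  simp at this

/-- Finiteness of `S` enters here: it cannot contain all the multiples of `single i 1`. -/
theorem isNilpotent_mono {i : σ} : IsNilpotent (mono k S (.single i 1)) := by
  have key : ∀ n : ℕ, mono k S (.single i 1) ^ n = mono k S (.single i n) := by
    intro n
    induction n with
    | zero => simp [mono_zero]
    | succ n ih => rw [pow_succ, ih, ← mono_add, ← Finsupp.single_add]
  by_contra h
  have h' : ∀ n : ℕ, Finsupp.single i n ∈ S := by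
    intro n
    by_contra hn
    exact h ⟨n, by rw [key, mono_eq_zero hn]⟩
  exact (Set.infinite_of_injective_forall_mem (Finsupp.single_injective i) h') S.finite_toSet

theorem isNilpotent_ker_aug [Finite σ] (h0 : (0 : σ →₀ ℕ) ∈ S) :
    IsNilpotent (RingHom.ker (aug (k := k) h0)) := by
  refine (Ideal.FG.isNilpotent_iff_le_nilradical ?_).2 ?_
  · rw [ker_aug]
    exact Submodule.fg_span (Set.finite_range _)
  · rw [ker_aug, Ideal.span_le]
    rintro _ ⟨i, rfl⟩
    exact isNilpotent_mono

theorem isLocalRing [Finite σ] (h0 : (0 : σ →₀ ℕ) ∈ S) : IsLocalRing (TruncAlg k S) := by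
  have hsurj := aug_surjective (k := k) h0
  have : Nontrivial (TruncAlg k S) := hsurj.nontrivial
  refine IsLocalRing.of_isUnit_or_isUnit_one_sub_self fun a => ?_
  have key : ∀ a : TruncAlg k S, aug h0 a ≠ 0 → IsUnit a := by
    intro a ha
    have hn : IsNilpotent (a - algebraMap k _ (aug h0 a)) := by
      obtain ⟨n, hn⟩ := isNilpotent_ker_aug (k := k) h0
      refine ⟨n, ?_⟩
      have := Ideal.pow_mem_pow (show a - algebraMap k _ (aug h0 a) ∈ RingHom.ker (aug h0) by
        rw [RingHom.mem_ker, map_sub, AlgHom.commutes]; simp) n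
      rwa [hn] at this
    have hu : IsUnit (algebraMap k (TruncAlg k S) (aug h0 a)) := (IsUnit.mk0 _ ha).map _
    have := hn.isUnit_add_left_of_commute hu (Commute.all _ _)
    simpa using this
  by_cases h : aug h0 a = 0
  · exact .inr (key _ (by simp [h]))
  · exact .inl (key _ h)

end TruncAlg

end

/-! ### Generation modulo nilpotent ideals, and surjections onto truncated polynomial rings. -/

noncomputable section

/-- A form of Nakayama's lemma: substituting the inclusion into itself pushes the error term into
ever higher powers of `I`. Neither `J ≤ I` nor finite generation is needed. -/
theorem Ideal.le_of_le_sup_sq_of_isNilpotent {B : Type*} [CommRing B] {I J : Ideal B}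
    (hI : IsNilpotent I) (h : I ≤ J ⊔ I ^ 2) : I ≤ J := by
  have key : ∀ m : ℕ, I ≤ J ⊔ I ^ (m + 1) := by
    intro m
    induction m with
    | zero => simp
    | succ m ih =>
      refine ih.trans (sup_le le_sup_left ?_)
      calc I ^ (m + 1) = I ^ m * I := pow_succ _ _
        _ ≤ I ^ m * (J ⊔ I ^ 2) := Ideal.mul_mono_right h
        _ = I ^ m * J ⊔ I ^ m * I ^ 2 := Ideal.mul_sup _ _ _
        _ ≤ J ⊔ I ^ (m + 1 + 1) :=
          sup_le_sup Ideal.mul_le_right (by rw [← pow_add])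
  obtain ⟨n, hn⟩ := hI
  refine (key n).trans ?_
  rw [pow_succ, hn, zero_mul]
  simp

/-- A subalgebra `S` is everything if it surjects modulo a nilpotent ideal `I` and `S ∩ I`
generates `I` modulo `I ^ 2`. -/
theorem Subalgebra.eq_top_of_isNilpotent {k B : Type*} [CommRing k] [CommRing B] [Algebra k B]
    (S : Subalgebra k B) {I : Ideal B} (hI : IsNilpotent I) (h1 : ∀ b, ∃ s ∈ S, b - s ∈ I)
    (h2 : I ≤ Ideal.span ((S : Set B) ∩ I) ⊔ I ^ 2) : S = ⊤ := by
  have h3 := Ideal.le_of_le_sup_sq_of_isNilpotent hI h2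
  have key : ∀ m : ℕ, ∀ b, ∃ s ∈ S, b - s ∈ I ^ m := by
    intro m
    induction m with
    | zero => exact fun b => ⟨0, zero_mem _, by simp⟩
    | succ m ih =>
      -- The coefficient `c` is known modulo `I ^ m` by induction, and the generator `x` lies in
      -- `I`, so the product is known modulo `I ^ (m + 1)`.
      have aux : ∀ x ∈ Ideal.span ((S : Set B) ∩ I), ∀ c, ∃ s ∈ S, c * x - s ∈ I ^ (m + 1) := by
        intro x hx
        induction hx using Submodule.span_induction with
        | mem x hx =>
          intro c
          obtain ⟨t, ht, hct⟩ := ih c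
          refine ⟨t * x, mul_mem ht hx.1, ?_⟩
          rw [← sub_mul, pow_succ]
          exact Ideal.mul_mem_mul hct hx.2
        | zero => exact fun c => ⟨0, zero_mem _, by simp⟩
        | add x y _ _ hx hy =>
          intro c
          obtain ⟨s, hs, hs'⟩ := hx c
          obtain ⟨t, ht, ht'⟩ := hy c
          refine ⟨s + t, add_mem hs ht, ?_⟩
          rw [mul_add, add_sub_add_comm]
          exact add_mem hs' ht'
        | smul a x _ hx =>
          intro c
          obtain ⟨s, hs, hs'⟩ := hx (c * a)
          exact ⟨s, hs, by rwa [smul_eq_mul, ← mul_assoc]⟩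
      intro b
      obtain ⟨s, hs, hbs⟩ := h1 b
      obtain ⟨t, ht, hst⟩ := aux _ (h3 hbs) 1
      refine ⟨s + t, add_mem hs ht, ?_⟩
      rwa [one_mul, sub_sub] at hst
  obtain ⟨n, hn⟩ := hI
  refine eq_top_iff.2 fun b _ => ?_
  obtain ⟨s, hs, hbs⟩ := key n b
  rw [hn] at hbs
  rwa [sub_eq_zero.1 (show b - s = 0 from hbs)]

namespace TruncAlg

open MvPolynomial

variable {k : Type*} [Field k] {σ : Type*} {S S' : Finset (σ →₀ ℕ)}

/-- The exponents of degree less than `t`. -/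
def degLT (N t : ℕ) : Finset (Fin N →₀ ℕ) :=
  (Finset.range t).biUnion fun d => Finset.univ.finsuppAntidiag d

theorem mem_degLT {N t : ℕ} {s : Fin N →₀ ℕ} : s ∈ degLT N t ↔ s.degree < t := by
  simp only [degLT, Finset.mem_biUnion, Finset.mem_range, Finset.mem_finsuppAntidiag,
    Finset.subset_univ, and_true, Finsupp.degree_eq_sum]
  exact ⟨fun ⟨a, ha, h⟩ => h ▸ ha, fun h => ⟨_, h, rfl⟩⟩

theorem degree_mono {s t : σ →₀ ℕ} (h : s ≤ t) : s.degree ≤ t.degree := by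
  obtain ⟨u, rfl⟩ := exists_add_of_le h
  rw [map_add]
  exact Nat.le_add_right _ _

theorem isLowerSet_degLT (N t : ℕ) : IsLowerSet (degLT N t : Set (Fin N →₀ ℕ)) := by
  intro a b hba ha
  rw [Finset.mem_coe, mem_degLT] at ha ⊢
  exact (degree_mono hba).trans_lt ha

theorem ker_aug_pow_le (h0 : (0 : σ →₀ ℕ) ∈ S) (t : ℕ) :
    RingHom.ker (aug (k := k) h0) ^ t ≤ Ideal.span (mono k S '' {s | t ≤ s.degree}) := by
  induction t with
  | zero =>
    rw [pow_zero, Ideal.one_eq_top]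
    refine ((Ideal.eq_top_iff_one _).2 (Ideal.subset_span ?_)).ge
    exact ⟨0, Nat.zero_le _, mono_zero⟩
  | succ t ih =>
    rw [pow_succ]
    refine (Ideal.mul_mono_left ih).trans ?_
    rw [ker_aug, Ideal.span_mul_span']
    refine Ideal.span_mono ?_
    intro x hx
    obtain ⟨_, ⟨s, hs, rfl⟩, _, ⟨i, rfl⟩, rfl⟩ := Set.mem_mul.1 hx
    refine ⟨s + Finsupp.single i 1, ?_, mono_add s (Finsupp.single i 1)⟩
    change t + 1 ≤ (s + Finsupp.single i 1).degree
    rw [map_add, Finsupp.degree_single]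
    exact Nat.add_le_add_right hs 1

theorem zero_mem_degLT {N t : ℕ} (ht : 0 < t) : (0 : Fin N →₀ ℕ) ∈ degLT N t := by
  rw [mem_degLT]; simpa

theorem ker_aug_pow_degLT {N t : ℕ} (ht : 0 < t) :
    RingHom.ker (aug (k := k) (zero_mem_degLT (N := N) ht)) ^ t = ⊥ := by
  rw [eq_bot_iff]
  refine (ker_aug_pow_le _ t).trans (Ideal.span_le.2 ?_)
  rintro _ ⟨s, hs, rfl⟩
  exact mono_eq_zero fun h => hs.not_gt (mem_degLT.1 h)

theorem mono_mem_ker_aug_pow (h0 : (0 : σ →₀ ℕ) ∈ S) (s : σ →₀ ℕ) :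
    mono k S s ∈ RingHom.ker (aug (k := k) h0) ^ s.degree := by
  classical
  induction s using Finsupp.induction_linear with
  | zero => simp
  | add f g hf hg => rw [mono_add, map_add, pow_add]; exact Ideal.mul_mem_mul hf hg
  | single i n =>
    induction n with
    | zero => simp
    | succ n ih =>
      rw [Finsupp.single_add, mono_add, map_add, pow_add]
      refine Ideal.mul_mem_mul ih ?_
      rw [Finsupp.degree_single, pow_one, ker_aug]
      exact Ideal.subset_span ⟨i, rfl⟩

theorem mk_eq_sum (p : MvPolynomial σ k) :
    mk k S p = ∑ s ∈ p.support, coeff s p • mono k S s := by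
  conv_lhs => rw [p.as_sum]
  rw [map_sum]
  refine Finset.sum_congr rfl fun s _ => ?_
  rw [mono, ← map_smul, smul_monomial, smul_eq_mul, mul_one]

/-- A monomial of degree at least two is a product of at least two elements of the augmentation
ideal. This allows surjectivity to be checked on first-order terms. -/
theorem mem_sq_of_proj_degLT_eq_zero {N : ℕ} {S : Finset (Fin N →₀ ℕ)} (h : degLT N 2 ⊆ S)
    {a : TruncAlg k S} (ha : proj h a = 0) :
    a ∈ RingHom.ker (aug (k := k) (h (zero_mem_degLT two_pos))) ^ 2 := by
  obtain ⟨p, rfl⟩ := mk_surjective a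
  rw [proj_mk, mk_eq_zero_iff, mem_ideal (isLowerSet_degLT N 2)] at ha
  rw [mk_eq_sum]
  refine sum_mem fun s hs => Submodule.smul_of_tower_mem _ _ ?_
  refine Ideal.pow_le_pow_right ?_ (mono_mem_ker_aug_pow _ s)
  by_contra hlt
  exact mem_support_iff.1 hs (ha s (mem_degLT.2 (not_le.1 hlt)))

end TruncAlg

/-- A `k`-algebra `A` lifts truncations if all its homomorphisms to truncated polynomial rings
lift along the projections that forget one monomial. -/
def LiftsTrunc (k : Type*) [Field k] (A : Type*) [CommRing A] [Algebra k A] (N : ℕ) : Prop :=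
  ∀ (S : Finset (Fin N →₀ ℕ)) (s : Fin N →₀ ℕ), 0 ∈ S → IsLowerSet (S : Set (Fin N →₀ ℕ)) →
    IsLowerSet ((insert s S : Finset (Fin N →₀ ℕ)) : Set (Fin N →₀ ℕ)) → s ∉ S →
    ∀ φ : A →ₐ[k] TruncAlg k S, ∃ φ' : A →ₐ[k] TruncAlg k (insert s S),
      (TruncAlg.proj (Finset.subset_insert s S)).comp φ' = φ

section PointDerivation

open TruncAlg

variable {k : Type*} [Field k] {A : Type*} [CommRing A] [Algebra k A] {N : ℕ}

/-- The homomorphism to first order attached to point derivations at a `k`-point. -/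
def firstOrderHom (ε : A →ₐ[k] k) (δ : A →ₗ[k] (Fin N → k))
    (hδ : ∀ a b, δ (a * b) = ε a • δ b + ε b • δ a) : A →ₐ[k] TruncAlg k (degLT N 2) :=
  AlgHom.ofLinearMap
    ((Algebra.linearMap k (TruncAlg k (degLT N 2))).comp ε.toLinearMap +
      (Fintype.linearCombination k fun i => mono k (degLT N 2) (.single i 1)).comp δ)
    (by
      have : δ 1 = 0 := by simpa using hδ 1 1
      simp [this])
    (by
      intro a b
      have hz : ∀ x y : Fin N → k,
          (Fintype.linearCombination k fun i => mono k (degLT N 2) (.single i 1)) x *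
          (Fintype.linearCombination k fun i => mono k (degLT N 2) (.single i 1)) y = 0 := by
        intro x y
        rw [Fintype.linearCombination_apply, Fintype.linearCombination_apply,
          Finset.sum_mul_sum]
        refine Finset.sum_eq_zero fun i _ => Finset.sum_eq_zero fun j _ => ?_
        rw [smul_mul_smul_comm, ← mono_add, mono_eq_zero, smul_zero]
        rw [mem_degLT, map_add, Finsupp.degree_single, Finsupp.degree_single]
        omega
      simp only [LinearMap.add_apply, LinearMap.comp_apply, AlgHom.toLinearMap_apply, map_mul, hδ,
        map_add, map_smul, Algebra.linearMap_apply]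
      rw [add_mul, mul_add, mul_add, hz, Algebra.smul_def, Algebra.smul_def]
      ring)

theorem firstOrderHom_apply (ε : A →ₐ[k] k) (δ : A →ₗ[k] (Fin N → k))
    (hδ : ∀ a b, δ (a * b) = ε a • δ b + ε b • δ a) (a : A) :
    firstOrderHom ε δ hδ a = algebraMap k _ (ε a) +
      ∑ i, δ a i • mono k (degLT N 2) (.single i 1) := rfl

/-- The monomials of `S` outside the first-order part are adjoined one at a time, each time by
`LiftsTrunc`; the induction is on the size of `S`. -/
theorem exists_lift_degLT (hA : LiftsTrunc k A N) (φ₁ : A →ₐ[k] TruncAlg k (degLT N 2)) :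
    ∀ (n : ℕ) (S : Finset (Fin N →₀ ℕ)) (_ : S.card = n)
      (_ : IsLowerSet (S : Set (Fin N →₀ ℕ))) (h : degLT N 2 ⊆ S),
      ∃ φ : A →ₐ[k] TruncAlg k S, (proj h).comp φ = φ₁ := by
  classical
  intro n
  induction n with
  | zero =>
    intro S hS _ h
    have := h (zero_mem_degLT two_pos)
    simp [Finset.card_eq_zero.1 hS] at this
  | succ n ih =>
    intro S hcard hS h
    by_cases hne : degLT N 2 = S
    · subst hne
      refine ⟨φ₁, ?_⟩
      ext a
      obtain ⟨p, hp⟩ := mk_surjective (φ₁ a)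
      simp only [AlgHom.comp_apply, ← hp, proj_mk]
    have hd : (S \ degLT N 2).Nonempty := by
      rw [Finset.sdiff_nonempty]
      exact fun h' => hne (h.antisymm h')
    -- Removing a maximal exponent keeps the rest a lower set.
    obtain ⟨s, hs, hmax⟩ := (S \ degLT N 2).exists_maximal hd
    rw [Finset.mem_sdiff] at hs
    have hmax' : ∀ t ∈ S, s ≤ t → t = s := by
      intro t ht hst
      have : t ∈ S \ degLT N 2 := Finset.mem_sdiff.2 ⟨ht, fun ht' =>
        hs.2 (isLowerSet_degLT N 2 hst ht')⟩
      exact le_antisymm (hmax this hst) hst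
    have hlow : IsLowerSet ((S.erase s : Finset _) : Set (Fin N →₀ ℕ)) := by
      intro a b hba ha
      rw [Finset.mem_coe, Finset.mem_erase] at ha ⊢
      refine ⟨fun hb => ha.1 (hmax' a ha.2 (hb ▸ hba)), hS hba ha.2⟩
    have hsub : degLT N 2 ⊆ S.erase s := fun t ht =>
      Finset.mem_erase.2 ⟨fun hts => hs.2 (hts ▸ ht), h ht⟩
    obtain ⟨φ, hφ⟩ := ih (S.erase s) (by rw [Finset.card_erase_of_mem hs.1, hcard]; rfl) hlow hsub
    have hins : insert s (S.erase s) = S := Finset.insert_erase hs.1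
    obtain ⟨φ', hφ'⟩ := hA (S.erase s) s (hsub (zero_mem_degLT two_pos)) hlow (by rwa [hins])
      (by simp) φ
    have hins' : S ⊆ insert s (S.erase s) := hins.ge
    refine ⟨(proj hins').comp φ', ?_⟩
    rw [← hφ, ← hφ']
    ext a
    obtain ⟨p, hp⟩ := mk_surjective (φ' a)
    simp only [AlgHom.comp_apply, ← hp, proj_mk]

/-- If `A` lifts truncations and has `N` independent point derivations at `ε`, then it surjects
onto all truncated polynomial rings in `N` variables. -/
theorem exists_surjective_truncAlg (hA : LiftsTrunc k A N) (ε : A →ₐ[k] k)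
    (δ : A →ₗ[k] (Fin N → k)) (hδ : ∀ a b, δ (a * b) = ε a • δ b + ε b • δ a)
    (hsurj : Function.Surjective δ) (S : Finset (Fin N →₀ ℕ))
    (hS : IsLowerSet (S : Set (Fin N →₀ ℕ))) (h0 : 0 ∈ S) :
    ∃ φ : A →ₐ[k] TruncAlg k S, Function.Surjective φ ∧ ∀ a, aug h0 (φ a) = ε a := by
  classical
  -- The given `S` need not contain all exponents of degree < 2, where the lifting starts. The
  -- result for `U` is projected to `S` at the end.
  let U := S ∪ degLT N 2
  have hU : IsLowerSet (U : Set (Fin N →₀ ℕ)) := by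
    rw [Finset.coe_union]; exact hS.union (isLowerSet_degLT N 2)
  have hdU : degLT N 2 ⊆ U := Finset.subset_union_right
  have h0U : 0 ∈ U := hdU (zero_mem_degLT two_pos)
  obtain ⟨φ, hφ⟩ := exists_lift_degLT hA (firstOrderHom ε δ hδ) _ U rfl hU hdU
  have hφ' : ∀ a, proj hdU (φ a) = firstOrderHom ε δ hδ a := fun a => DFunLike.congr_fun hφ a
  have haug : ∀ a, aug h0U (φ a) = ε a := by
    intro a
    rw [← aug_proj (zero_mem_degLT two_pos) hdU, hφ', firstOrderHom_apply, map_add,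
      AlgHom.commutes, map_sum, Finset.sum_eq_zero, add_zero]
    · rfl
    · intro i _
      rw [map_smul, aug_mono _ (by simp), smul_zero]
  -- The images hit every variable modulo the square of the nilpotent augmentation ideal, which
  -- suffices.
  have htop : φ.range = ⊤ := by
    refine Subalgebra.eq_top_of_isNilpotent _ (isNilpotent_ker_aug h0U) (fun b => ?_) ?_
    · refine ⟨algebraMap k _ (aug h0U b), Subalgebra.algebraMap_mem _ _, ?_⟩
      rw [RingHom.mem_ker, map_sub, AlgHom.commutes]
      simp
    · refine (ker_aug h0U).le.trans (Ideal.span_le.2 ?_)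
      rintro _ ⟨i, rfl⟩
      obtain ⟨a, ha⟩ := hsurj (Pi.single i 1)
      let a' := a - algebraMap k A (ε a)
      have hεa : ε a' = 0 := by simp [a']
      have hδa : δ a' = Pi.single i 1 := by
        have h1 : δ 1 = 0 := by simpa using hδ 1 1
        simp [a', Algebra.algebraMap_eq_smul_one, h1, ha]
      have hmem : φ a' - mono k U (.single i 1) ∈
          RingHom.ker (aug (k := k) (hdU (zero_mem_degLT two_pos))) ^ 2 := by
        refine mem_sq_of_proj_degLT_eq_zero hdU ?_
        rw [map_sub, hφ', firstOrderHom_apply, hεa, hδa, proj_mono, map_zero, zero_add,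
          Finset.sum_eq_single i (fun j _ hj => by simp [hj]) (by simp)]
        simp
      change mono k U (.single i 1) ∈ _
      rw [← sub_sub_self (φ a') (mono k U (.single i 1))]
      refine sub_mem (Ideal.mem_sup_left (Ideal.subset_span ⟨⟨a', rfl⟩, ?_⟩))
        (Ideal.mem_sup_right hmem)
      rw [SetLike.mem_coe, RingHom.mem_ker, haug, hεa]
  have hSU : S ⊆ U := Finset.subset_union_left
  refine ⟨(proj hSU).comp φ, (proj_surjective hSU).comp (AlgHom.range_eq_top φ |>.1 htop), ?_⟩
  intro a
  rw [AlgHom.comp_apply, aug_proj, haug]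

end PointDerivation

end

/-! ### Coordinates on the cotangent space at a rational point. -/

noncomputable section

/-- A `k`-point `ε` of a `k`-algebra `A` together with coordinates `δ` on its cotangent space. -/
structure PointFrame (k : Type*) [Field k] (A : Type*) [CommRing A] [Algebra k A] (N : ℕ) where
  ε : A →ₐ[k] k
  δ : A →ₗ[k] (Fin N → k)
  leibniz : ∀ a b, δ (a * b) = ε a • δ b + ε b • δ a
  surjective : Function.Surjective δ
  mem_sq : ∀ a, ε a = 0 → δ a = 0 → a ∈ RingHom.ker ε ^ 2

namespace PointFrame

variable {k : Type*} [Field k] {A : Type*} [CommRing A] [Algebra k A]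

theorem δ_one {N : ℕ} (F : PointFrame k A N) : F.δ 1 = 0 := by simpa using F.leibniz 1 1

/-- The `y i` are elements of the augmentation ideal dual to the coordinates of `δ`; subtracting
from `a` its linear part in them leaves an element killed by `ε` and `δ`. -/
theorem exists_generators {N : ℕ} (F : PointFrame k A N) :
    ∃ y : Fin N → A, (∀ i, F.ε (y i) = 0) ∧
      RingHom.ker F.ε ≤ Ideal.span (Set.range y) ⊔ RingHom.ker F.ε ^ 2 := by
  choose z hz using fun i => F.surjective (Pi.single i 1)
  let y : Fin N → A := fun i => z i - algebraMap k A (F.ε (z i))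
  have hεy : ∀ i, F.ε (y i) = 0 := fun i => by simp [y]
  have hδy : ∀ i, F.δ (y i) = Pi.single i 1 := fun i => by
    simp [y, Algebra.algebraMap_eq_smul_one, F.δ_one, hz]
  refine ⟨y, hεy, fun a ha => ?_⟩
  have h2 : a - ∑ i, F.δ a i • y i ∈ RingHom.ker F.ε ^ 2 := by
    refine F.mem_sq _ ?_ ?_
    · simp [hεy, RingHom.mem_ker.1 ha]
    · ext j
      simp [hδy, Pi.single_apply]
  rw [← add_sub_cancel (∑ i, F.δ a i • y i) a]
  exact add_mem (Ideal.mem_sup_left (sum_mem fun i _ => Submodule.smul_of_tower_mem _ _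
    (Ideal.subset_span ⟨i, rfl⟩))) (Ideal.mem_sup_right h2)

/-- The map `a ↦ a - ε a` to the augmentation ideal. -/
def toKer (ε : A →ₐ[k] k) : A →ₗ[k] RingHom.ker ε :=
  LinearMap.codRestrict ((RingHom.ker ε).restrictScalars k)
    (LinearMap.id - (Algebra.linearMap k A).comp ε.toLinearMap) fun a => by
      simp [RingHom.mem_ker]

theorem coe_toKer (ε : A →ₐ[k] k) (a : A) : (toKer ε a : A) = a - algebraMap k A (ε a) := rfl

/-- The `k`-linear map `A → 𝔭 / 𝔭 ^ 2` at a `k`-point. -/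
def toCotangent (ε : A →ₐ[k] k) : A →ₗ[k] (RingHom.ker ε).Cotangent :=
  ((RingHom.ker ε).toCotangent.restrictScalars k).comp (toKer ε)

theorem toCotangent_apply (ε : A →ₐ[k] k) (a : A) :
    toCotangent ε a = (RingHom.ker ε).toCotangent (toKer ε a) := rfl

theorem smul_cotangent (ε : A →ₐ[k] k) (a : A) (x : (RingHom.ker ε).Cotangent) :
    a • x = ε a • x := by
  obtain ⟨x, rfl⟩ := (RingHom.ker ε).toCotangent_surjective x
  rw [← algebraMap_smul A (ε a), ← map_smul, ← map_smul, Ideal.toCotangent_eq]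
  simp only [SetLike.val_smul, smul_eq_mul, ← sub_mul]
  rw [pow_two]
  exact Ideal.mul_mem_mul (by simp [RingHom.mem_ker]) x.2

theorem toCotangent_mul (ε : A →ₐ[k] k) (a b : A) :
    toCotangent ε (a * b) = a • toCotangent ε b + b • toCotangent ε a := by
  simp only [smul_cotangent, toCotangent_apply]
  rw [← algebraMap_smul A (ε a), ← algebraMap_smul A (ε b),
    ← (RingHom.ker ε).toCotangent.map_smul, ← (RingHom.ker ε).toCotangent.map_smul, ← map_add,
    Ideal.toCotangent_eq]
  simp only [coe_toKer, Submodule.coe_add, SetLike.val_smul, smul_eq_mul, map_mul]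
  have : a * b - algebraMap k A (ε a) * algebraMap k A (ε b) -
      (algebraMap k A (ε a) * (b - algebraMap k A (ε b)) +
        algebraMap k A (ε b) * (a - algebraMap k A (ε a))) =
      (a - algebraMap k A (ε a)) * (b - algebraMap k A (ε b)) := by ring
  rw [this, pow_two]
  exact Ideal.mul_mem_mul (by simp [RingHom.mem_ker]) (by simp [RingHom.mem_ker])

theorem toCotangent_surjective (ε : A →ₐ[k] k) : Function.Surjective (toCotangent ε) := by
  intro x
  obtain ⟨x, rfl⟩ := (RingHom.ker ε).toCotangent_surjective x
  refine ⟨x, ?_⟩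
  rw [toCotangent_apply]
  congr 1
  ext
  rw [coe_toKer, RingHom.mem_ker.1 x.2]
  simp

/-- The frame given by a basis of the cotangent space at a `k`-point. -/
def ofCotangent (ε : A →ₐ[k] k) [Module.Finite k (RingHom.ker ε).Cotangent] :
    PointFrame k A (Module.finrank k (RingHom.ker ε).Cotangent) where
  ε := ε
  δ := (Module.finBasis k (RingHom.ker ε).Cotangent).equivFun.toLinearMap.comp (toCotangent ε)
  leibniz a b := by
    simp [toCotangent_mul, smul_cotangent]
  surjective := by
    rw [LinearMap.coe_comp]
    exact (LinearEquiv.surjective _).comp (toCotangent_surjective ε)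
  mem_sq a ha hδ := by
    simp only [LinearMap.comp_apply, LinearEquiv.coe_coe, LinearEquiv.map_eq_zero_iff,
      toCotangent_apply] at hδ
    rw [Ideal.toCotangent_eq_zero, coe_toKer, ha] at hδ
    simpa using hδ

/-- The frame at a `k`-point given by a basis of the module of Kähler differentials. -/
def ofKaehler {N : ℕ} (b : Module.Basis (Fin N) A (Ω[A⁄k])) (ε : A →ₐ[k] k) :
    PointFrame k A N where
  ε := ε
  δ := LinearMap.pi fun i => ε.toLinearMap.comp
    (((b.coord i).restrictScalars k).comp (KaehlerDifferential.D k A).toLinearMap)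
  leibniz a c := by
    ext i
    simp
  surjective := by
    let δ : A →ₗ[k] (Fin N → k) := LinearMap.pi fun i => ε.toLinearMap.comp
      (((b.coord i).restrictScalars k).comp (KaehlerDifferential.D k A).toLinearMap)
    -- After applying `ε` to coefficients, an `A`-combination of differentials becomes a
    -- `k`-combination, so spanning over `A` is enough.
    have key : ∀ w : Ω[A⁄k], (fun i => ε (b.coord i w)) ∈ LinearMap.range δ := by
      intro w
      have hw : w ∈ Submodule.span A (Set.range (KaehlerDifferential.D k A)) := by
        rw [KaehlerDifferential.span_range_derivation]; trivial
      induction hw using Submodule.span_induction with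
      | mem x hx => obtain ⟨a, rfl⟩ := hx; exact ⟨a, rfl⟩
      | zero => simp only [map_zero]; exact zero_mem _
      | add x y _ _ hx hy => simp only [map_add]; exact add_mem hx hy
      | smul a x _ hx =>
        simp only [map_smul, smul_eq_mul, map_mul]
        exact Submodule.smul_mem _ (ε a) hx
    intro c
    obtain ⟨a, ha⟩ := key (∑ i, algebraMap k A (c i) • b i)
    refine ⟨a, ha.trans ?_⟩
    ext i
    simp [Finsupp.single_apply]
  mem_sq a ha hδ := by
    -- The universal derivation into 𝔭/𝔭² factors through the differentials. The coordinates of `D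
    -- a` lie in 𝔭 by `hδ`, and 𝔭 kills 𝔭/𝔭², so the class of `a` vanishes.
    let D' : Derivation k A (RingHom.ker ε).Cotangent :=
      Derivation.mk' (toCotangent ε) (toCotangent_mul ε)
    have h1 : D'.liftKaehlerDifferential (KaehlerDifferential.D k A a) = toCotangent ε a :=
      Derivation.liftKaehlerDifferential_comp_D _ _
    rw [← b.sum_repr (KaehlerDifferential.D k A a), map_sum, Finset.sum_eq_zero] at h1
    · have h2 := h1.symm
      rw [toCotangent_apply, Ideal.toCotangent_eq_zero, coe_toKer, ha] at h2
      simpa using h2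
    · intro i _
      rw [map_smul, smul_cotangent]
      have := congrFun hδ i
      simp only [LinearMap.pi_apply, LinearMap.comp_apply, Pi.zero_apply] at this
      change ε (b.repr (KaehlerDifferential.D k A a) i) = 0 at this
      rw [this, zero_smul]

end PointFrame

/-! ### Correcting almost commuting matrices over a small extension. -/

section SmallExtension

open Matrix

variable {k : Type*} [Field k] {R : Type*} [CommRing R] [Algebra k R] {m : Type*} [Fintype m]
  [DecidableEq m]

theorem Matrix.commute_of_mem_adjoin_pair {K : Type*} [CommRing K] {X Y B M : Matrix m m K}
    (hX : Commute B X) (hY : Commute B Y) (hM : M ∈ Algebra.adjoin K {X, Y}) : Commute B M := by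
  have : Algebra.adjoin K {X, Y} ≤ Subalgebra.centralizer K {B} := by
    refine Algebra.adjoin_le ?_
    rintro _ (rfl | rfl)
    · exact fun _ h => (Set.mem_singleton_iff.1 h) ▸ hX
    · exact fun _ h => (Set.mem_singleton_iff.1 h) ▸ hY
  exact this hM B rfl

theorem Matrix.eq_zero_of_trace_mul_eq_zero {K : Type*} [CommRing K] {A : Matrix m m K}
    (h : ∀ B : Matrix m m K, (A * B).trace = 0) : A = 0 := by
  ext i j
  simpa [Matrix.trace_mul_single] using h (Matrix.single j i 1)

/-- In the algebra generated by commuting matrices with a cyclic vector over a field, the image of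
`(ξ, η) ↦ [ξ, Y] + [X, η]` is orthogonal to the algebra for the trace form. -/
theorem Matrix.exists_commutator_eq {X Y c : Matrix m m k} (hXY : Commute X Y) (v : m → k)
    (hv : ∀ w, ∃ M ∈ Algebra.adjoin k {X, Y}, M *ᵥ v = w)
    (hc : ∀ M ∈ Algebra.adjoin k {X, Y}, (M * c).trace = 0) :
    ∃ ξ η : Matrix m m k, (ξ * Y - Y * ξ) + (X * η - η * X) = c := by
  let L : Matrix m m k × Matrix m m k →ₗ[k] Matrix m m k :=
    (LinearMap.mulRight k Y - LinearMap.mulLeft k Y).coprod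
      (LinearMap.mulLeft k X - LinearMap.mulRight k X)
  suffices h : c ∈ LinearMap.range L by
    obtain ⟨⟨ξ, η⟩, h⟩ := h
    exact ⟨ξ, η, h⟩
  by_contra hcL
  -- A functional separating `c` from the image is a trace against some matrix `Z`. Vanishing on the
  -- image forces `Z` to commute with `X` and `Y`; by cyclicity `Z` then lies in the algebra they
  -- generate, where `hc` gives the contradiction.
  obtain ⟨f, hfc, hf⟩ := Submodule.exists_le_ker_of_notMem hcL
  let Z : Matrix m m k := Matrix.of fun i j => f (Matrix.single j i 1)
  have hZ : ∀ M, f M = (Z * M).trace := by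
    intro M
    conv_lhs => rw [Matrix.matrix_eq_sum_single M]
    simp only [map_sum, Matrix.trace, Matrix.diag_apply, Matrix.mul_apply, Z, Matrix.of_apply]
    rw [Finset.sum_comm]
    refine Finset.sum_congr rfl fun i _ => Finset.sum_congr rfl fun j _ => ?_
    rw [← mul_one (M j i), ← smul_eq_mul, ← Matrix.smul_single, map_smul]
    simp [mul_comm]
  have hL : ∀ ξ η : Matrix m m k, (Z * ((ξ * Y - Y * ξ) + (X * η - η * X))).trace = 0 := by
    intro ξ η
    rw [← hZ]
    exact hf ⟨(ξ, η), rfl⟩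
  have hZY : Commute Z Y := by
    refine (sub_eq_zero.1 (Matrix.eq_zero_of_trace_mul_eq_zero fun ξ => ?_)).symm
    have := hL ξ 0
    simp only [mul_zero, zero_mul, sub_zero, add_zero, mul_sub, Matrix.trace_sub] at this
    rw [sub_mul, Matrix.trace_sub, ← this, ← mul_assoc Z Y ξ, mul_assoc Y Z ξ,
      Matrix.trace_mul_comm Y, mul_assoc Z ξ Y]
  have hZX : Commute Z X := by
    refine (sub_eq_zero.1 (Matrix.eq_zero_of_trace_mul_eq_zero fun η => ?_))
    have := hL 0 η
    simp only [mul_zero, zero_mul, sub_zero, zero_add, mul_sub, Matrix.trace_sub] at this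
    rw [sub_mul, Matrix.trace_sub, ← this, ← mul_assoc Z X η, mul_assoc X Z η,
      Matrix.trace_mul_comm X, mul_assoc Z η X]
  obtain ⟨M, hM, hMv⟩ := hv (Z *ᵥ v)
  have hMX : Commute M X := (commute_of_mem_adjoin_pair rfl hXY hM).symm
  have hMY : Commute M Y := (commute_of_mem_adjoin_pair hXY.symm rfl hM).symm
  -- Both matrices commute with the algebra and agree on the cyclic vector.
  have hZM : Z = M := by
    refine Matrix.mulVec_injective (funext fun w => ?_)
    obtain ⟨B, hB, rfl⟩ := hv w
    rw [Matrix.mulVec_mulVec, Matrix.mulVec_mulVec,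
      (commute_of_mem_adjoin_pair hZX hZY hB).eq, (commute_of_mem_adjoin_pair hMX hMY hB).eq,
      ← Matrix.mulVec_mulVec, ← Matrix.mulVec_mulVec, hMv]
  exact hfc (by rw [hZ, hZM, hc M hM])

/-- As `e` is killed by the augmentation ideal, multiples of `e` depend only on residues in `k`. -/
theorem Matrix.smul_eq_smul_map {m : Type*} (ε : R →ₐ[k] k) {e : R}
    (he : ∀ a, ε a = 0 → a * e = 0) (M : Matrix m m R) :
    e • M = e • (M.map ε).map (algebraMap k R) := by
  ext i j
  simp only [Matrix.smul_apply, Matrix.map_apply, smul_eq_mul]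
  have := he (M i j - algebraMap k R (ε (M i j))) (by simp)
  rw [sub_mul, sub_eq_zero] at this
  rw [mul_comm, this, mul_comm]

theorem Matrix.map_algHom_map {m : Type*} (ε : R →ₐ[k] k) (M : Matrix m m k) :
    (M.map (algebraMap k R)).map ε = M := by
  ext; simp

/-- Expand [X, Y^(b+1)] by the Leibniz rule: each of the b + 1 terms contains one factor [X, Y] =
e·c, and all have the same trace because `M` commutes with `Y` after reduction. The factor b + 1 is
why characteristic zero is needed. -/
theorem Matrix.trace_mul_commutator_pow (ε : R →ₐ[k] k) {e : R}
    (he : ∀ a, ε a = 0 → a * e = 0) {X Y : Matrix m m R} {c : Matrix m m k}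
    (hc : X * Y - Y * X = e • c.map (algebraMap k R)) (b : ℕ) :
    ∀ M : Matrix m m R, Commute (M.map ε) (Y.map ε) →
    (M * (X * Y ^ (b + 1) - Y ^ (b + 1) * X)).trace =
      e * algebraMap k R ((b + 1) * (M.map ε * Y.map ε ^ b * c).trace) := by
  have htr : ∀ M : Matrix m m R, e * M.trace = e * algebraMap k R (M.map ε).trace := by
    intro M
    rw [← smul_eq_mul, ← smul_eq_mul, ← Matrix.trace_smul, Matrix.smul_eq_smul_map ε he,
      Matrix.trace_smul, ← AddMonoidHom.map_trace]
  have hmap : ∀ M N : Matrix m m R, (M * N).map ε = M.map ε * N.map ε :=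
    fun M N => Matrix.map_mul (f := ε.toRingHom)
  have hpow : ∀ (M : Matrix m m R) (n : ℕ), (M ^ n).map ε = M.map ε ^ n := by
    intro M n
    exact map_pow ε.toRingHom.mapMatrix M n
  induction b with
  | zero =>
    intro M _
    simp only [zero_add, pow_one, pow_zero, mul_one, Nat.cast_zero, one_mul]
    rw [hc, Matrix.mul_smul, Matrix.trace_smul, smul_eq_mul, htr, hmap, Matrix.map_algHom_map]
  | succ b ih =>
    intro M hM
    have h1 : M * (X * Y ^ (b + 1 + 1) - Y ^ (b + 1 + 1) * X) =
        M * (X * Y - Y * X) * Y ^ (b + 1) + (M * Y) * (X * Y ^ (b + 1) - Y ^ (b + 1) * X) := by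
      rw [pow_succ' Y (b + 1)]
      noncomm_ring
    rw [h1, Matrix.trace_add, ih (M * Y) (by rw [hmap]; exact hM.mul_left rfl), hc,
      Matrix.mul_smul, Matrix.smul_mul, Matrix.trace_smul, smul_eq_mul, htr, hmap, hmap,
      Matrix.map_algHom_map, hmap, hpow, ← mul_add, ← map_add]
    congr 2
    have h2 : (M.map ε * c * Y.map ε ^ (b + 1)).trace =
        (M.map ε * Y.map ε ^ (b + 1) * c).trace := by
      rw [Matrix.trace_mul_comm, ← mul_assoc, (hM.pow_right (b + 1)).eq]
    rw [h2, mul_assoc (M.map ε) (Y.map ε), ← pow_succ' (Y.map ε) b]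
    push_cast
    ring

/-- Matrices that commute modulo a small extension and have a cyclic vector can be corrected
so that they commute. -/
theorem Matrix.exists_commute_of_commute_mod [CharZero k] (ε : R →ₐ[k] k) {e : R}
    (he : ∀ a, ε a = 0 → a * e = 0) (hεe : ε e = 0) {X Y : Matrix m m R} {c : Matrix m m k}
    (hc : X * Y - Y * X = e • c.map (algebraMap k R)) (v : m → k)
    (hv : ∀ w, ∃ M ∈ Algebra.adjoin k {X.map ε, Y.map ε}, M *ᵥ v = w) :
    ∃ ξ η : Matrix m m R, Commute (X + e • ξ) (Y + e • η) := by
  by_cases he0 : e = 0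
  · exact ⟨0, 0, by simpa [he0, sub_eq_zero, commute_iff_eq] using hc⟩
  have hinj : ∀ a : k, e * algebraMap k R a = 0 → a = 0 := by
    intro a ha
    by_contra hne
    refine he0 ?_
    have hu : IsUnit (algebraMap k R a) := (IsUnit.mk0 a hne).map _
    exact hu.mul_left_eq_zero.1 ha
  have hmap : ∀ M N : Matrix m m R, (M * N).map ε = M.map ε * N.map ε :=
    fun M N => Matrix.map_mul (f := ε.toRingHom)
  have hpow : ∀ (M : Matrix m m R) (n : ℕ), (M ^ n).map ε = M.map ε ^ n := by
    intro M n
    exact map_pow ε.toRingHom.mapMatrix M n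
  have hXY : Commute (X.map ε) (Y.map ε) := by
    have h1 : (X * Y - Y * X).map ε = 0 := by
      rw [hc]; ext i j; simp [hεe]
    rw [Commute, SemiconjBy, ← hmap, ← hmap, ← sub_eq_zero, ← h1]
    exact (Matrix.map_sub ε (map_sub ε) _ _).symm
  -- With M = X^a the trace of M[X, Y^(b+1)] vanishes by cyclicity of the trace; what remains is b +
  -- 1 times the wanted trace, and b + 1 is invertible.
  have htr : ∀ a b : ℕ, ((X.map ε ^ a * Y.map ε ^ b) * c).trace = 0 := by
    intro a b
    have h1 := Matrix.trace_mul_commutator_pow ε he hc b (X ^ a)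
      (by rw [hpow]; exact hXY.pow_left a)
    have h2 : (X ^ a * (X * Y ^ (b + 1) - Y ^ (b + 1) * X)).trace = 0 := by
      rw [mul_sub, Matrix.trace_sub, ← mul_assoc, ← pow_succ, ← mul_assoc, Matrix.trace_mul_comm _ X,
        ← mul_assoc, ← pow_succ', sub_self]
    rw [h2, hpow] at h1
    have h3 := hinj _ h1.symm
    rcases mul_eq_zero.1 h3 with h | h
    · exact absurd h (Nat.cast_add_one_ne_zero b)
    · exact h
  have hcl : ∀ M ∈ Submonoid.closure {X.map ε, Y.map ε}, ∃ a b : ℕ,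
      M = X.map ε ^ a * Y.map ε ^ b := by
    intro M hM
    induction hM using Submonoid.closure_induction with
    | mem x hx =>
      rcases hx with rfl | rfl
      · exact ⟨1, 0, by simp⟩
      · exact ⟨0, 1, by simp⟩
    | one => exact ⟨0, 0, by simp⟩
    | mul x y _ _ hx hy =>
      obtain ⟨a, b, rfl⟩ := hx
      obtain ⟨a', b', rfl⟩ := hy
      refine ⟨a + a', b + b', ?_⟩
      rw [pow_add, pow_add, mul_assoc, mul_assoc, ← mul_assoc (Y.map ε ^ b),
        ← (hXY.pow_pow a' b).eq, mul_assoc]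
  -- The sign is that of the correction: the first-order change of the commutator must cancel `c`.
  have hadj : ∀ M ∈ Algebra.adjoin k {X.map ε, Y.map ε}, (M * -c).trace = 0 := by
    intro M hM
    rw [← Subalgebra.mem_toSubmodule, Algebra.adjoin_eq_span] at hM
    induction hM using Submodule.span_induction with
    | mem x hx => obtain ⟨a, b, rfl⟩ := hcl x hx; rw [mul_neg, Matrix.trace_neg, htr, neg_zero]
    | zero => simp
    | add x y _ _ hx hy => rw [add_mul, Matrix.trace_add, hx, hy, add_zero]
    | smul a x _ hx => rw [Matrix.smul_mul, Matrix.trace_smul, hx, smul_zero]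
  obtain ⟨ξ, η, h⟩ := Matrix.exists_commutator_eq hXY v hv hadj
  let ι : Matrix m m k → Matrix m m R := fun M => M.map (algebraMap k R)
  have hι : ∀ M N, ι (M * N) = ι M * ι N := fun M N => Matrix.map_mul
  refine ⟨ι ξ, ι η, ?_⟩
  have hee : e * e = 0 := he e hεe
  have h1 : (X + e • ι ξ) * (Y + e • ι η) - (Y + e • ι η) * (X + e • ι ξ) =
      (X * Y - Y * X) + e • ((ι ξ * Y - Y * ι ξ) + (X * ι η - ι η * X)) := by
    have hz : ∀ M N : Matrix m m R, (e • M) * (e • N) = 0 := by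
      intro M N
      rw [Matrix.smul_mul, Matrix.mul_smul, smul_smul, hee, zero_smul]
    rw [add_mul, mul_add, mul_add, add_mul, mul_add, mul_add, hz, hz]
    simp only [Matrix.smul_mul, Matrix.mul_smul, smul_add, smul_sub]
    abel
  rw [Commute, SemiconjBy, ← sub_eq_zero, h1, hc, ← smul_add, Matrix.smul_eq_smul_map ε he]
  have h2 : (c.map (algebraMap k R) + ((ι ξ * Y - Y * ι ξ) + (X * ι η - ι η * X))).map ε = 0 := by
    have ha : ∀ M N : Matrix m m R, (M + N).map ε = M.map ε + N.map ε :=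
      fun M N => Matrix.map_add ε (map_add ε) M N
    have hs : ∀ M N : Matrix m m R, (M - N).map ε = M.map ε - N.map ε :=
      fun M N => Matrix.map_sub ε (map_sub ε) M N
    have hi : ∀ M : Matrix m m k, (ι M).map ε = M := Matrix.map_algHom_map ε
    rw [ha, ha, hs, hs, hmap, hmap, hmap, hmap, hi, hi, Matrix.map_algHom_map, h, add_neg_cancel]
  rw [h2]
  ext; simp

end SmallExtension

end

/-! ### Lifting finite free algebras on two generators. -/

noncomputable section

/-- A small extension `R' → R` of augmented `k`-algebras: the kernel is spanned over `k` by an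
element `e` that is killed by the augmentation ideal. -/
structure SmallExtension (k : Type*) [Field k] (R' R : Type*) [CommRing R'] [CommRing R]
    [Algebra k R'] [Algebra k R] where
  π : R' →ₐ[k] R
  surjective : Function.Surjective π
  ε : R →ₐ[k] k
  e : R'
  π_e : π e = 0
  exists_smul : ∀ a, π a = 0 → ∃ c : k, a = c • e
  mul_e : ∀ a, ε (π a) = 0 → a * e = 0

namespace SmallExtension

open Matrix

section Adjoin

variable {m : Type*} [Fintype m] [DecidableEq m]

theorem map_mem_adjoin {R S : Type*} [CommRing R] [CommRing S] (f : R →+* S) {X Y M : Matrix m m R}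
    (hM : M ∈ Algebra.adjoin R {X, Y}) : M.map f ∈ Algebra.adjoin S {X.map f, Y.map f} := by
  change f.mapMatrix M ∈ _
  induction hM using Algebra.adjoin_induction with
  | mem x hx =>
    rcases hx with rfl | rfl
    · exact Algebra.subset_adjoin (Or.inl rfl)
    · exact Algebra.subset_adjoin (Or.inr rfl)
  | algebraMap r =>
    convert Subalgebra.algebraMap_mem (Algebra.adjoin S {X.map f, Y.map f}) (f r)
    ext i j
    simp [Matrix.algebraMap_matrix_apply, apply_ite f]
  | add x y _ _ hx hy => rw [map_add]; exact add_mem hx hy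
  | mul x y _ _ hx hy => rw [map_mul]; exact mul_mem hx hy

theorem exists_mem_adjoin_map_eq {R S : Type*} [CommRing R] [CommRing S] {f : R →+* S}
    (hf : Function.Surjective f) {X Y : Matrix m m R} {M : Matrix m m S}
    (hM : M ∈ Algebra.adjoin S {X.map f, Y.map f}) :
    ∃ N ∈ Algebra.adjoin R {X, Y}, N.map f = M := by
  change ∃ N ∈ Algebra.adjoin R {X, Y}, f.mapMatrix N = M
  induction hM using Algebra.adjoin_induction with
  | mem x hx =>
    rcases hx with rfl | rfl
    · exact ⟨X, Algebra.subset_adjoin (Or.inl rfl), rfl⟩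
    · exact ⟨Y, Algebra.subset_adjoin (Or.inr rfl), rfl⟩
  | algebraMap r =>
    obtain ⟨s, rfl⟩ := hf r
    refine ⟨algebraMap _ _ s, Subalgebra.algebraMap_mem _ _, ?_⟩
    ext i j
    simp [Matrix.algebraMap_matrix_apply, apply_ite f]
  | add x y _ _ hx hy =>
    obtain ⟨a, ha, rfl⟩ := hx
    obtain ⟨b, hb, rfl⟩ := hy
    exact ⟨a + b, add_mem ha hb, map_add _ _ _⟩
  | mul x y _ _ hx hy =>
    obtain ⟨a, ha, rfl⟩ := hx
    obtain ⟨b, hb, rfl⟩ := hy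
    exact ⟨a * b, mul_mem ha hb, map_mul _ _ _⟩

theorem leftMulMatrix_mem_adjoin {R C : Type*} [CommRing R] [CommRing C] [Algebra R C]
    (b : Module.Basis m R C) {x y : C} (h : Algebra.adjoin R {x, y} = ⊤) (c : C) :
    Algebra.leftMulMatrix b c ∈
      Algebra.adjoin R {Algebra.leftMulMatrix b x, Algebra.leftMulMatrix b y} := by
  have : c ∈ Algebra.adjoin R {x, y} := h ▸ trivial
  have h2 : Algebra.leftMulMatrix b c ∈
      (Algebra.adjoin R {x, y}).map (Algebra.leftMulMatrix b) := ⟨c, this, rfl⟩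
  rwa [AlgHom.map_adjoin, Set.image_pair] at h2

theorem exists_leftMulMatrix_eq {R C : Type*} [CommRing R] [CommRing C] [Algebra R C]
    (b : Module.Basis m R C) {x y : C} {M : Matrix m m R} (hM : M ∈
      Algebra.adjoin R {Algebra.leftMulMatrix b x, Algebra.leftMulMatrix b y}) :
    ∃ c, Algebra.leftMulMatrix b c = M := by
  rw [← Set.image_pair, ← AlgHom.map_adjoin] at hM
  obtain ⟨c, _, h⟩ := hM
  exact ⟨c, h⟩

theorem leftMulMatrix_mulVec_one {R C : Type*} [CommRing R] [CommRing C] [Algebra R C]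
    (b : Module.Basis m R C) (c : C) :
    Algebra.leftMulMatrix b c *ᵥ b.equivFun 1 = b.equivFun c := by
  have := Algebra.leftMulMatrix_mulVec_repr b c 1
  rw [mul_one] at this
  exact this

theorem map_mulVec {m : Type*} [Fintype m] {R S : Type*} [CommRing R] [CommRing S] (f : R →+* S) (M : Matrix m m R)
    (v : m → R) : (M.map f) *ᵥ (f ∘ v) = f ∘ (M *ᵥ v) := by
  ext i
  exact (RingHom.map_mulVec f M v i).symm

end Adjoin

variable {k : Type*} [Field k] [CharZero k] {R' R : Type u} [CommRing R'] [CommRing R]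
  [Algebra k R'] [Algebra k R]

open scoped IsMulCommutative in
/-- Finite free algebras generated by two elements lift along small extensions. -/
theorem exists_lift_algebra (E : SmallExtension k R' R) {C : Type u} [CommRing C] [Algebra R C]
    [Module.Free R C] [Module.Finite R C] {x y : C} (hxy : Algebra.adjoin R {x, y} = ⊤) :
    ∃ (C' : Type u) (_ : CommRing C') (_ : Algebra R' C') (p : C' →+* C),
      Module.Free R' C' ∧ Module.Finite R' C' ∧ Function.Surjective p ∧
      (∀ r, p (algebraMap R' C' r) = algebraMap R C (E.π r)) ∧
      ∀ z, p z = 0 → ∃ w, z = algebraMap R' C' E.e * w := by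
  classical
  let m := Module.Free.ChooseBasisIndex R C
  let b : Module.Basis m R C := Module.Free.chooseBasis R C
  let ε' : R' →ₐ[k] k := E.ε.comp E.π
  have he : ∀ a, ε' a = 0 → a * E.e = 0 := E.mul_e
  have hεe : ε' E.e = 0 := by simp [ε', E.π_e]
  have hee : E.e * E.e = 0 := he _ hεe
  let X₀ := Algebra.leftMulMatrix b x
  let Y₀ := Algebra.leftMulMatrix b y
  choose s hs using E.surjective
  have hsec : ∀ M : Matrix m m R, (M.map s).map E.π = M := fun M => by ext; simp [hs]
  let v : m → R' := s ∘ b.equivFun 1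
  have hv : E.π ∘ v = b.equivFun 1 := by ext; simp [v, hs]
  have hmap : ∀ M N : Matrix m m R', (M * N).map E.π = M.map E.π * N.map E.π :=
    fun M N => Matrix.map_mul (f := E.π.toRingHom)
  have hX₀Y₀ : X₀ * Y₀ - Y₀ * X₀ = 0 := by
    simp only [X₀, Y₀]
    rw [← map_mul, ← map_mul, mul_comm, sub_self]
  have hker : ∀ M : Matrix m m R', M.map E.π = 0 →
      ∃ c : Matrix m m k, M = E.e • c.map (algebraMap k R') := by
    intro M hM
    choose c hc using fun i j => E.exists_smul (M i j) (congrFun (congrFun hM i) j)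
    refine ⟨Matrix.of c, ?_⟩
    ext i j
    rw [hc, Algebra.smul_def, mul_comm]
    rfl
  obtain ⟨c, hc⟩ := hker (X₀.map s * Y₀.map s - Y₀.map s * X₀.map s) (by
    rw [← hX₀Y₀]
    conv_rhs => rw [← hsec X₀, ← hsec Y₀]
    rw [← hmap, ← hmap]
    exact Matrix.map_sub _ (map_sub E.π) _ _)
  have hε : ∀ M : Matrix m m R', M.map ε' = (M.map E.π).map E.ε := fun M => by ext; simp [ε']
  -- The class of 1 is a cyclic vector for the multiplication matrices, since `x` and `y` generate
  -- `C`; this persists after reduction to `k`.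
  obtain ⟨ξ, η, hcomm⟩ := Matrix.exists_commute_of_commute_mod ε' he hεe hc
    (E.ε ∘ b.equivFun 1) (by
      intro w
      let z : C := b.equivFun.symm (algebraMap k R ∘ w)
      have h1 := leftMulMatrix_mem_adjoin b hxy z
      have h2 := map_mem_adjoin (E.ε : R →+* k) h1
      refine ⟨(Algebra.leftMulMatrix b z).map E.ε, ?_, ?_⟩
      · rw [hε, hε, hsec, hsec]
        exact h2
      · have := map_mulVec (E.ε : R →+* k) (Algebra.leftMulMatrix b z) (b.equivFun 1)
        refine this.trans ?_
        rw [leftMulMatrix_mulVec_one]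
        ext i
        change E.ε (b.equivFun z i) = w i
        rw [LinearEquiv.apply_symm_apply]
        exact E.ε.commutes _)
  let X := X₀.map s + E.e • ξ
  let Y := Y₀.map s + E.e • η
  have hshift : ∀ M N : Matrix m m R', (M + E.e • N).map E.π = M.map E.π := fun M N => by
    ext; simp [E.π_e]
  have hX : X.map (E.π : R' →+* R) = X₀ := (hshift _ _).trans (hsec X₀)
  have hY : Y.map (E.π : R' →+* R) = Y₀ := (hshift _ _).trans (hsec Y₀)
  -- The lift is the algebra generated by the corrected matrices. Evaluation at a lift `v` of the
  -- vector of 1 identifies it with the free module `m → R'`.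
  let C' := Algebra.adjoin R' {X, Y}
  have hmemC : ∀ a ∈ ({X, Y} : Set (Matrix m m R')), ∀ b ∈ ({X, Y} : Set (Matrix m m R')),
      a * b = b * a := by
    rintro _ (rfl | rfl) _ (rfl | rfl)
    · rfl
    · exact hcomm.eq
    · exact hcomm.eq.symm
    · rfl
  have : IsMulCommutative C' := Algebra.isMulCommutative_adjoin R' hmemC
  have hcoe : ∀ M N : C', ((M * N : C') : Matrix m m R') = M * N := fun _ _ => rfl
  have hlift : ∀ z : C, ∃ N : C', (N : Matrix m m R').map E.π = Algebra.leftMulMatrix b z := by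
    intro z
    have h1 := leftMulMatrix_mem_adjoin b hxy z
    obtain ⟨N, hN, h⟩ := exists_mem_adjoin_map_eq (f := (E.π : R' →+* R)) (X := X) (Y := Y)
      E.surjective (by rw [hX, hY]; exact h1)
    exact ⟨⟨N, hN⟩, h⟩
  let ev : C' →ₗ[R'] (m → R') :=
    { toFun := fun M => (M : Matrix m m R') *ᵥ v
      map_add' := fun M N => Matrix.add_mulVec _ _ _
      map_smul' := fun r M => Matrix.smul_mulVec _ _ _ }
  -- Evaluation is surjective modulo `e`; applying this twice suffices because `e * e = 0`.
  have hevs : Function.Surjective ev := by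
    have h1 : ∀ w : m → R', ∃ (N : C') (u : m → R'), w = ev N + E.e • u := by
      intro w
      obtain ⟨N, hN⟩ := hlift (b.equivFun.symm (E.π ∘ w))
      have h2 : ∀ i, E.π (w i - ev N i) = 0 := by
        intro i
        have h3 := congrFun (map_mulVec (E.π : R' →+* R) (N : Matrix m m R') v) i
        have h4 : E.π (ev N i) = (E.π ∘ w) i := by
          refine h3.symm.trans ?_
          change (((N : Matrix m m R').map E.π) *ᵥ (E.π ∘ v)) i = _
          rw [hN, hv, leftMulMatrix_mulVec_one, LinearEquiv.apply_symm_apply]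
        rw [map_sub, h4, Function.comp_apply, sub_self]
      choose u hu using fun i => E.exists_smul _ (h2 i)
      refine ⟨N, fun i => algebraMap k R' (u i), ?_⟩
      ext i
      rw [Pi.add_apply, Pi.smul_apply, smul_eq_mul, mul_comm, ← Algebra.smul_def, ← hu i]
      ring
    intro w
    obtain ⟨N, u, rfl⟩ := h1 w
    obtain ⟨N', u', rfl⟩ := h1 u
    refine ⟨N + E.e • N', ?_⟩
    rw [map_add, map_smul, smul_add, smul_smul, hee, zero_smul, add_zero]
  -- In a commutative matrix algebra, an element killing the cyclic vector kills everything.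
  have hevi : Function.Injective ev := by
    rw [← LinearMap.ker_eq_bot, LinearMap.ker_eq_bot']
    intro M hM
    refine Subtype.ext (Matrix.mulVec_injective (funext fun w => ?_))
    obtain ⟨N, rfl⟩ := hevs w
    change (M : Matrix m m R') *ᵥ ((N : Matrix m m R') *ᵥ v) = (0 : Matrix m m R') *ᵥ _
    rw [Matrix.mulVec_mulVec, ← hcoe, mul_comm, hcoe, ← Matrix.mulVec_mulVec, Matrix.zero_mulVec]
    change (N : Matrix m m R') *ᵥ (ev M) = 0
    rw [hM, Matrix.mulVec_zero]
  have hinj := Algebra.leftMulMatrix_injective b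
  have hp : ∀ M : C', ∃ z : C, Algebra.leftMulMatrix b z = (M : Matrix m m R').map E.π := by
    intro M
    have := map_mem_adjoin (E.π : R' →+* R) M.2
    rw [hX, hY] at this
    exact exists_leftMulMatrix_eq b this
  choose p hp using hp
  let P : C' →+* C :=
    { toFun := p
      map_one' := hinj (by
        rw [hp, map_one]
        exact Matrix.map_one _ (map_zero E.π) (map_one E.π))
      map_mul' := fun M N => hinj (by rw [hp, map_mul, hp, hp, ← hmap]; rfl)
      map_zero' := hinj (by
        rw [hp, map_zero]
        exact Matrix.map_zero _ (map_zero E.π))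
      map_add' := fun M N => hinj (by
        rw [hp, map_add, hp, hp]
        exact Matrix.map_add _ (map_add E.π) _ _) }
  let evE : C' ≃ₗ[R'] (m → R') := LinearEquiv.ofBijective ev ⟨hevi, hevs⟩
  refine ⟨C', inferInstance, inferInstance, P, Module.Free.of_equiv evE.symm,
    Module.Finite.equiv evE.symm, ?_, ?_, ?_⟩
  · intro z
    obtain ⟨N, hN⟩ := hlift z
    exact ⟨N, hinj ((hp N).trans hN)⟩
  · intro r
    refine hinj ((hp _).trans ?_)
    rw [AlgHom.commutes]
    change ((algebraMap R' (Matrix m m R') r)).map E.π = _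
    ext i j
    simp [Matrix.algebraMap_matrix_apply, apply_ite E.π]
  · intro M hM
    have h1 : (M : Matrix m m R').map E.π = 0 := by
      rw [← hp]
      change Algebra.leftMulMatrix b (P M) = 0
      rw [hM, map_zero]
    obtain ⟨c, hc⟩ := hker _ h1
    obtain ⟨N, hN⟩ := hevs (c.map (algebraMap k R') *ᵥ v)
    refine ⟨N, hevi ?_⟩
    rw [← Algebra.smul_def, map_smul, hN]
    change (M : Matrix m m R') *ᵥ v = _
    rw [hc, Matrix.smul_mulVec]

end SmallExtension

end

/-! ### Truncations as small extensions, and generation by two elements. -/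

noncomputable section

theorem LiftsTrunc.of_formallySmooth (k : Type*) [Field k] (A : Type*) [CommRing A] [Algebra k A]
    [Algebra.FormallySmooth k A] (N : ℕ) : LiftsTrunc k A N := by
  intro S s h0 hS hS' hs φ
  have hn : IsNilpotent (RingHom.ker (TruncAlg.proj (k := k) (Finset.subset_insert s S))) := by
    obtain ⟨n, hn⟩ := TruncAlg.isNilpotent_ker_aug (k := k) (Finset.mem_insert_of_mem (b := s) h0)
    refine ⟨n, eq_bot_iff.2 ((Ideal.pow_right_mono ?_ n).trans hn.le)⟩
    intro a ha
    rw [RingHom.mem_ker] at ha ⊢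
    rw [← TruncAlg.aug_proj h0 (Finset.subset_insert s S), ha, map_zero]
  exact ⟨Algebra.FormallySmooth.liftOfSurjective φ _ (TruncAlg.proj_surjective _) hn,
    Algebra.FormallySmooth.comp_liftOfSurjective _ _ _ _⟩

/-- The projections of truncated polynomial rings that forget one monomial are small extensions. -/
def SmallExtension.trunc (k : Type*) [Field k] {σ : Type*} [DecidableEq σ] {S : Finset (σ →₀ ℕ)}
    {s : σ →₀ ℕ} (h0 : 0 ∈ S) (hS : IsLowerSet (S : Set (σ →₀ ℕ)))
    (hS' : IsLowerSet ((insert s S : Finset (σ →₀ ℕ)) : Set (σ →₀ ℕ))) (hs : s ∉ S) :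
    SmallExtension k (TruncAlg k (insert s S)) (TruncAlg k S) where
  π := TruncAlg.proj (Finset.subset_insert s S)
  surjective := TruncAlg.proj_surjective _
  ε := TruncAlg.aug h0
  e := TruncAlg.mono k _ s
  π_e := by rw [TruncAlg.proj_mono, TruncAlg.mono_eq_zero hs]
  exists_smul a ha := TruncAlg.exists_smul_mono_of_proj_eq_zero hS hS' ha
  mul_e a ha := by
    rw [TruncAlg.aug_proj] at ha
    exact TruncAlg.mono_mul_of_aug_eq_zero _ hS hs ha

/-- A nilpotent `R`-algebra generated by the image of an algebra with `2`-dimensional cotangent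
space is generated by two elements. -/
theorem exists_adjoin_pair_eq_top {k : Type*} [Field k] {R C D : Type*} [CommRing R] [CommRing C]
    [CommRing D] [Algebra k R] [Algebra k C] [Algebra k D] [Algebra R C] [IsScalarTower k R C]
    (F : PointFrame k D 2) (g : D →ₐ[k] C) (ε : C →ₐ[k] k) (hε : ∀ d, ε (g d) = F.ε d)
    (hn : IsNilpotent (RingHom.ker ε)) (hg : Algebra.adjoin R (Set.range g) = ⊤) :
    ∃ x y : C, Algebra.adjoin R {x, y} = ⊤ := by
  obtain ⟨y, hy, hF⟩ := F.exists_generators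
  refine ⟨g (y 0), g (y 1), ?_⟩
  set S := Algebra.adjoin R {g (y 0), g (y 1)} with hS
  have hyS : ∀ i, g (y i) ∈ S := by
    intro i
    refine Algebra.subset_adjoin ?_
    fin_cases i
    · exact Or.inl rfl
    · exact Or.inr rfl
  refine Subalgebra.eq_top_of_isNilpotent S hn (fun b => ⟨algebraMap k C (ε b), ?_, ?_⟩) ?_
  · rw [IsScalarTower.algebraMap_apply k R C]; exact Subalgebra.algebraMap_mem _ _
  · simp [RingHom.mem_ker]
  · set J := Ideal.span ((S : Set C) ∩ RingHom.ker ε) ⊔ RingHom.ker ε ^ 2 with hJ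
    -- The property of being congruent to one's own constant term modulo `J` is closed under sums
    -- and products, and it holds on `R` and on the image of `g`.
    have key : ∀ b ∈ Algebra.adjoin R (Set.range g), b - algebraMap k C (ε b) ∈ J := by
      intro b hb
      induction hb using Algebra.adjoin_induction with
      | mem x hx =>
        obtain ⟨d, rfl⟩ := hx
        have h1 : d - algebraMap k D (F.ε d) ∈ RingHom.ker F.ε := by simp [RingHom.mem_ker]
        have h2 : g d - algebraMap k C (ε (g d)) = g (d - algebraMap k D (F.ε d)) := by
          rw [map_sub, AlgHom.commutes, hε]
        rw [h2]
        have h3 := Ideal.mem_map_of_mem g (hF h1)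
        refine (?_ : Ideal.map g _ ≤ J) h3
        rw [Ideal.map_sup, Ideal.map_pow, Ideal.map_span]
        refine sup_le_sup (Ideal.span_mono ?_) (Ideal.pow_right_mono ?_ 2)
        · rintro _ ⟨_, ⟨i, rfl⟩, rfl⟩
          exact ⟨hyS i, by rw [SetLike.mem_coe, RingHom.mem_ker, hε, hy]⟩
        · rw [Ideal.map_le_iff_le_comap]
          intro d hd
          rw [Ideal.mem_comap, RingHom.mem_ker, hε]
          exact hd
      | algebraMap r =>
        refine Ideal.mem_sup_left (Ideal.subset_span ⟨?_, ?_⟩)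
        · refine sub_mem (Subalgebra.algebraMap_mem _ _) ?_
          rw [IsScalarTower.algebraMap_apply k R C]
          exact Subalgebra.algebraMap_mem _ _
        · simp [RingHom.mem_ker]
      | add x y _ _ hx hy =>
        rw [map_add, map_add, add_sub_add_comm]
        exact add_mem hx hy
      | mul x y _ _ hx hy =>
        have : x * y - algebraMap k C (ε (x * y)) = x * (y - algebraMap k C (ε y)) +
            algebraMap k C (ε y) * (x - algebraMap k C (ε x)) := by
          rw [map_mul, map_mul]; ring
        rw [this]
        exact add_mem (Ideal.mul_mem_left _ _ hy) (Ideal.mul_mem_left _ _ hx)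
    intro b hb
    have := key b (hg ▸ trivial)
    rwa [RingHom.mem_ker.1 hb, map_zero, sub_zero] at this

/-- A finite-dimensional local algebra over an algebraically closed field has residue field `k`. -/
theorem exists_augmentation (k : Type*) [Field k] [IsAlgClosed k] (C : Type*) [CommRing C]
    [Algebra k C] [Module.Finite k C] [IsLocalRing C] :
    ∃ ε : C →ₐ[k] k, RingHom.ker ε = IsLocalRing.maximalIdeal C ∧
      IsNilpotent (RingHom.ker ε) := by
  have hb : Function.Bijective (algebraMap k (IsLocalRing.ResidueField C)) :=
    IsAlgClosed.algebraMap_bijective_of_isIntegral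
  let e : k ≃ₐ[k] IsLocalRing.ResidueField C := AlgEquiv.ofBijective (Algebra.ofId _ _) hb
  let ε : C →ₐ[k] k := (e.symm : IsLocalRing.ResidueField C →ₐ[k] k).comp
    (IsScalarTower.toAlgHom k C (IsLocalRing.ResidueField C))
  have hker : RingHom.ker ε = IsLocalRing.maximalIdeal C := by
    ext c
    rw [RingHom.mem_ker, ← IsLocalRing.residue_eq_zero_iff]
    exact map_eq_zero_iff e.symm e.symm.injective
  refine ⟨ε, hker, ?_⟩
  have : IsArtinianRing C := IsArtinianRing.of_finite k C
  rw [hker, ← IsLocalRing.jacobson_eq_maximalIdeal ⊥ bot_ne_top]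
  exact IsArtinianRing.isNilpotent_jacobson_bot

end

/-! ### Smooth affine charts. -/

noncomputable section

theorem exists_smooth_chart {k : Type u} [Field k] {X : Scheme.{u}} (f : X ⟶ Spec (.of k)) (n : ℕ)
    [SmoothOfRelativeDimension n f] (x : X) :
    ∃ (D : Type u) (_ : CommRing D) (_ : Algebra k D) (i : Spec (.of D) ⟶ X),
      IsOpenImmersion i ∧ x ∈ Set.range i ∧
      i ≫ f = Spec.map (CommRingCat.ofHom (algebraMap k D)) ∧
      Algebra.IsStandardSmoothOfRelativeDimension n k D := by
  obtain ⟨U, hU, V, hV, hxV, e, h⟩ :=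
    SmoothOfRelativeDimension.exists_isStandardSmoothOfRelativeDimension (n := n) (f := f) x
  -- The spectrum of a field has one point, so a nonempty open subset is everything.
  obtain rfl : U = ⊤ := by
    ext y
    simp only [TopologicalSpace.Opens.coe_top, Set.mem_univ, iff_true]
    have : y = f x := Subsingleton.elim (α := PrimeSpectrum k) _ _
    rw [this]
    exact e hxV
  let φ := (Scheme.ΓSpecIso (.of k)).inv ≫ f.appLE ⊤ V e
  let : Algebra k Γ(X, V) := φ.hom.toAlgebra
  refine ⟨Γ(X, V), inferInstance, inferInstance, hV.fromSpec, inferInstance, ?_, ?_, ?_⟩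
  · rw [hV.range_fromSpec]; exact hxV
  · change _ = Spec.map φ
    rw [Spec.map_comp, ← Scheme.isoSpec_Spec_inv, ← IsAffineOpen.fromSpec_top,
      IsAffineOpen.SpecMap_appLE_fromSpec]
  · have := (RingHom.isStandardSmoothOfRelativeDimension_respectsIso (n := n)).2 _
      (Scheme.ΓSpecIso (.of k)).symm.commRingCatIsoToRingEquiv h
    exact this

theorem isClosedImmersion_SpecMap_iff {R S : CommRingCat.{u}} {φ : R ⟶ S} :
    IsClosedImmersion (Spec.map φ) ↔ Function.Surjective φ := by
  refine ⟨fun h => ?_, IsClosedImmersion.spec_of_surjective φ⟩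
  have h1 := (IsClosedImmersion.isAffine_surjective_of_isAffine (Spec.map φ)).2
  have h2 : φ = (Scheme.ΓSpecIso R).inv ≫ (Spec.map φ).appTop ≫ (Scheme.ΓSpecIso S).hom := by simp
  rw [h2]
  exact ((ConcreteCategory.bijective_of_isIso (Scheme.ΓSpecIso S).hom).2.comp h1).comp
    (ConcreteCategory.bijective_of_isIso (Scheme.ΓSpecIso R).inv).2

section Chart

variable {k : Type u} [Field k] {R C D : Type u} [CommRing R]
    [CommRing C] [CommRing D] [Algebra k R] [Algebra k C] [Algebra k D] [Algebra R C]
    [IsScalarTower k R C] (g : D →ₐ[k] C)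

theorem chart_comm : Spec.map (CommRingCat.ofHom g.toRingHom) ≫
      Spec.map (CommRingCat.ofHom (algebraMap k D)) =
    Spec.map (CommRingCat.ofHom (algebraMap R C)) ≫
      Spec.map (CommRingCat.ofHom (algebraMap k R)) := by
  rw [← Spec.map_comp, ← Spec.map_comp, ← CommRingCat.ofHom_comp, ← CommRingCat.ofHom_comp]
  congr 2
  rw [← IsScalarTower.algebraMap_eq k R C]
  exact g.comp_algebraMap

/-- The map to the product corresponds to D ⊗ R → C, whose image is the `R`-subalgebra generated by
the image of `g`. -/
theorem isClosedImmersion_chart_iff :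
    IsClosedImmersion (pullback.lift _ _ (chart_comm (R := R) g)) ↔
      Algebra.adjoin R (Set.range g) = ⊤ := by
  let T : TensorProduct k D R →ₐ[k] C := Algebra.TensorProduct.lift g
    (IsScalarTower.toAlgHom k R C) (fun _ _ => Commute.all _ _)
  have hT : Function.Surjective T ↔ Algebra.adjoin R (Set.range g) = ⊤ := by
    constructor
    · intro h
      rw [eq_top_iff]
      rintro c -
      obtain ⟨t, rfl⟩ := h c
      induction t using TensorProduct.induction_on with
      | zero => rw [map_zero]; exact zero_mem _
      | tmul d r =>
        rw [Algebra.TensorProduct.lift_tmul]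
        exact mul_mem (Algebra.subset_adjoin ⟨d, rfl⟩) (Subalgebra.algebraMap_mem _ r)
      | add x y hx hy => rw [map_add]; exact add_mem hx hy
    · intro h c
      have hc : c ∈ Algebra.adjoin R (Set.range g) := h ▸ trivial
      change c ∈ T.range
      induction hc using Algebra.adjoin_induction with
      | mem x hx =>
        obtain ⟨d, rfl⟩ := hx
        exact ⟨d ⊗ₜ 1, by simp [T]⟩
      | algebraMap r => exact ⟨1 ⊗ₜ r, by simp [T]⟩
      | add x y _ _ hx hy => exact add_mem hx hy
      | mul x y _ _ hx hy => exact mul_mem hx hy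
  rw [← hT, ← MorphismProperty.cancel_right_of_respectsIso @IsClosedImmersion _
    (pullbackSpecIso k D R).hom]
  have : pullback.lift _ _ (chart_comm (R := R) g) ≫ (pullbackSpecIso k D R).hom =
      Spec.map (CommRingCat.ofHom T.toRingHom) := by
    rw [← Iso.eq_comp_inv]
    apply pullback.hom_ext
    · rw [pullback.lift_fst, Category.assoc, pullbackSpecIso_inv_fst, ← Spec.map_comp,
        ← CommRingCat.ofHom_comp]
      congr 2
      ext d
      simp [T]
    · rw [pullback.lift_snd, Category.assoc, pullbackSpecIso_inv_snd, ← Spec.map_comp,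
        ← CommRingCat.ofHom_comp]
      congr 2
      ext d
      simp [T]
  rw [this, isClosedImmersion_SpecMap_iff]
  rfl

end Chart

/-- Every point of a local spectrum specializes to the closed point, and open sets are stable under
generization. -/
theorem range_subset_of_closedPoint_mem {C : Type u} [CommRing C] [IsLocalRing C] {X U : Scheme.{u}}
    (q : Spec (.of C) ⟶ X) (i : U ⟶ X) [IsOpenImmersion i]
    (h : q (IsLocalRing.closedPoint C) ∈ Set.range i) : Set.range q ⊆ Set.range i := by
  rintro _ ⟨y, rfl⟩
  have h1 : y ⤳ IsLocalRing.closedPoint C := IsLocalRing.specializes_closedPoint y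
  exact (h1.map q.continuous).mem_open i.isOpenEmbedding.isOpen_range h

/-- Morphisms from the spectrum of a local `k`-algebra to a smooth `k`-scheme factor through
smooth affine charts. -/
theorem exists_chart_factorization {k : Type u} [Field k] {X : Scheme.{u}}
    (f : X ⟶ Spec (.of k)) (n : ℕ) [SmoothOfRelativeDimension n f] {C : Type u} [CommRing C]
    [IsLocalRing C] [Algebra k C] (q : Spec (.of C) ⟶ X)
    (hq : q ≫ f = Spec.map (CommRingCat.ofHom (algebraMap k C))) :
    ∃ (D : Type u) (_ : CommRing D) (_ : Algebra k D) (i : Spec (.of D) ⟶ X) (g : D →ₐ[k] C),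
      IsOpenImmersion i ∧ i ≫ f = Spec.map (CommRingCat.ofHom (algebraMap k D)) ∧
      Algebra.IsStandardSmoothOfRelativeDimension n k D ∧
      Spec.map (CommRingCat.ofHom g.toRingHom) ≫ i = q := by
  obtain ⟨D, _, _, i, hi, hx, hif, hD⟩ := exists_smooth_chart f n (q (IsLocalRing.closedPoint C))
  let j := IsOpenImmersion.lift i q (range_subset_of_closedPoint_mem q i hx)
  have hj : j ≫ i = q := IsOpenImmersion.lift_fac _ _ _
  obtain ⟨φ, hφ⟩ := Spec.map_surjective j
  have hc : CommRingCat.ofHom (algebraMap k D) ≫ φ = CommRingCat.ofHom (algebraMap k C) := by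
    apply Spec.map_injective
    rw [Spec.map_comp, hφ, ← hif, ← hq, ← hj, Category.assoc]
  let g : D →ₐ[k] C := { φ.hom with
    commutes' := fun a => congr($hc a) }
  refine ⟨D, inferInstance, inferInstance, i, g, hi, hif, hD, ?_⟩
  rw [← hj, ← hφ]
  rfl

/-- The frame at a `k`-point of a standard smooth algebra. -/
theorem exists_pointFrame {k : Type u} [Field k] {D : Type u} [CommRing D] [Algebra k D] (n : ℕ)
    [Algebra.IsStandardSmoothOfRelativeDimension n k D] (ε : D →ₐ[k] k) :
    ∃ F : PointFrame k D n, F.ε = ε := by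
  have : Nontrivial D := ε.toRingHom.domain_nontrivial
  have : Algebra.IsStandardSmooth k D :=
    Algebra.IsStandardSmoothOfRelativeDimension.isStandardSmooth n
  have hr := Algebra.IsStandardSmoothOfRelativeDimension.rank_kaehlerDifferential (R := k) (S := D) n
  have hf : Module.finrank D (Ω[D⁄k]) = n := by
    rw [Module.finrank, hr]; simp
  exact ⟨PointFrame.ofKaehler (Module.finBasisOfFinrankEq D (Ω[D⁄k]) hf) ε, rfl⟩

end

/-! ### Lifting families supported at one point. -/

noncomputable section

theorem pullback_lift_map_left {W U X T S : Scheme.{u}} {a : W ⟶ U} {b : W ⟶ T} {u : U ⟶ S}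
    {t : T ⟶ S} (h : a ≫ u = b ≫ t) {f : X ⟶ S} {i : U ⟶ X}
    {c : W ⟶ X} (hc : a ≫ i = c) (h' : c ≫ f = b ≫ t) (e₁ e₂) :
    pullback.lift a b h ≫ pullback.map u t f t i (𝟙 T) (𝟙 S) e₁ e₂ = pullback.lift c b h' := by
  apply pullback.hom_ext
  · rw [Category.assoc, pullback.map, pullback.lift_fst, pullback.lift_fst,
      pullback.lift_fst_assoc, hc]
  · rw [Category.assoc, pullback.map, pullback.lift_snd, pullback.lift_snd,
      pullback.lift_snd_assoc, Category.comp_id]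

namespace SmallExtension

variable {k : Type u} [Field k] {R' R : Type u} [CommRing R'] [CommRing R]
  [Algebra k R'] [Algebra k R] (E : SmallExtension k R' R)

theorem mul_self_e : E.e * E.e = 0 := E.mul_e _ (by simp [E.π_e])

/-- Generation modulo the square-zero ideal (e) lifts: the remainder `e * w` is treated by
approximating `w` once more. -/
theorem adjoin_eq_top_of_lift {C C' : Type*} [CommRing C] [CommRing C'] [Algebra R C] [Algebra R' C']
    (p : C' →+* C) (hp : ∀ r, p (algebraMap R' C' r) = algebraMap R C (E.π r))
    (hker : ∀ z, p z = 0 → ∃ w, z = algebraMap R' C' E.e * w) (s : Set C')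
    (hs : Algebra.adjoin R (p '' s) = ⊤) : Algebra.adjoin R' s = ⊤ := by
  have key : ∀ c : C, ∃ z ∈ Algebra.adjoin R' s, p z = c := by
    intro c
    have hc : c ∈ Algebra.adjoin R (p '' s) := hs ▸ trivial
    induction hc using Algebra.adjoin_induction with
    | mem x hx =>
      obtain ⟨z, hz, rfl⟩ := hx
      exact ⟨z, Algebra.subset_adjoin hz, rfl⟩
    | algebraMap r =>
      obtain ⟨r', rfl⟩ := E.surjective r
      exact ⟨algebraMap R' C' r', Subalgebra.algebraMap_mem _ _, hp r'⟩
    | add x y _ _ hx hy =>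
      obtain ⟨a, ha, rfl⟩ := hx
      obtain ⟨b, hb, rfl⟩ := hy
      exact ⟨a + b, add_mem ha hb, map_add _ _ _⟩
    | mul x y _ _ hx hy =>
      obtain ⟨a, ha, rfl⟩ := hx
      obtain ⟨b, hb, rfl⟩ := hy
      exact ⟨a * b, mul_mem ha hb, map_mul _ _ _⟩
  have hd : ∀ z, ∃ a ∈ Algebra.adjoin R' s, ∃ w, z = a + algebraMap R' C' E.e * w := by
    intro z
    obtain ⟨a, ha, haz⟩ := key (p z)
    obtain ⟨w, hw⟩ := hker (z - a) (by rw [map_sub, haz, sub_self])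
    exact ⟨a, ha, w, by rw [← hw]; ring⟩
  have hee : algebraMap R' C' E.e * algebraMap R' C' E.e = 0 := by
    rw [← map_mul, E.mul_self_e, map_zero]
  rw [eq_top_iff]
  rintro z -
  obtain ⟨a, ha, w, rfl⟩ := hd z
  obtain ⟨b, hb, v, rfl⟩ := hd w
  rw [mul_add, ← mul_assoc, hee, zero_mul, add_zero]
  exact add_mem ha (mul_mem (Subalgebra.algebraMap_mem _ _) hb)

/-- The two ingredients meet here: the algebra lifts by the matrix argument, since two generators
suffice in a smooth surface, and then the map from `D` lifts by formal smoothness, the kernel of `p`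
being square-zero. -/
theorem exists_lift_chart [IsAlgClosed k] [CharZero k] {C D : Type u} [CommRing C] [CommRing D]
    [Algebra k C] [Algebra R C] [IsScalarTower k R C] [Module.Free R C] [Module.Finite R C]
    [Module.Finite k C] [IsLocalRing C] [Algebra k D]
    [Algebra.IsStandardSmoothOfRelativeDimension 2 k D]
    (g : D →ₐ[k] C) (hg : Algebra.adjoin R (Set.range g) = ⊤) :
    ∃ (C' : Type u) (_ : CommRing C') (_ : Algebra k C') (_ : Algebra R' C')
      (_ : IsScalarTower k R' C') (p : C' →ₐ[k] C) (g' : D →ₐ[k] C'),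
      Module.Free R' C' ∧ Module.Finite R' C' ∧ Function.Surjective p ∧
      (∀ r, p (algebraMap R' C' r) = algebraMap R C (E.π r)) ∧
      (∀ z, p z = 0 → ∃ w, z = algebraMap R' C' E.e * w) ∧
      (∀ d, p (g' d) = g d) ∧ Algebra.adjoin R' (Set.range g') = ⊤ := by
  obtain ⟨ε, -, hε⟩ := exists_augmentation k C
  obtain ⟨F, hF⟩ := exists_pointFrame (D := D) 2 (ε.comp g)
  obtain ⟨x, y, hxy⟩ := exists_adjoin_pair_eq_top (R := R) F g ε (fun d => by rw [hF]; rfl) hε hg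
  obtain ⟨C', _, _, p, hfree, hfin, hsurj, hp, hker⟩ := E.exists_lift_algebra hxy
  let _ : Algebra k C' := ((algebraMap R' C').comp (algebraMap k R')).toAlgebra
  have : IsScalarTower k R' C' := .of_algebraMap_eq fun _ => rfl
  let p' : C' →ₐ[k] C := { p with
    commutes' := fun a => by
      change p (algebraMap R' C' (algebraMap k R' a)) = _
      rw [hp, AlgHom.commutes, ← IsScalarTower.algebraMap_apply] }
  have hnil : IsNilpotent (RingHom.ker (p' : C' →+* C)) := by
    refine ⟨2, ?_⟩
    rw [pow_two, Ideal.zero_eq_bot, eq_bot_iff, Ideal.mul_le]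
    intro a ha b hb
    obtain ⟨v, rfl⟩ := hker a ha
    obtain ⟨w, rfl⟩ := hker b hb
    rw [Ideal.mem_bot, mul_mul_mul_comm, ← map_mul, E.mul_self_e, map_zero, zero_mul]
  have : Algebra.IsStandardSmooth k D :=
    Algebra.IsStandardSmoothOfRelativeDimension.isStandardSmooth 2
  let g' : D →ₐ[k] C' := Algebra.FormallySmooth.liftOfSurjective g p' hsurj hnil
  have hg' : ∀ d, p' (g' d) = g d := Algebra.FormallySmooth.liftOfSurjective_apply g p' hsurj hnil
  refine ⟨C', _, _, _, inferInstance, p', g', hfree, hfin, hsurj, hp, hker, hg', ?_⟩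
  refine E.adjoin_eq_top_of_lift p hp hker _ ?_
  rw [← hg, ← Set.range_comp]
  congr 2
  ext d
  exact hg' d

/-- Abbreviation for the structure morphism of the spectrum of an algebra. -/
abbrev _root_.specHom (R C : Type u) [CommRing R] [CommRing C] [Algebra R C] :
    Spec (.of C) ⟶ Spec (.of R) :=
  Spec.map (CommRingCat.ofHom (algebraMap R C))

/-- The lift is constructed inside a chart of `X`, where it is closed. The open immersion of the
chart preserves only surjectivity on stalks; closedness in all of `X` is recovered after the local
pieces are assembled. -/
theorem exists_lift_family_of_isLocalRing [IsAlgClosed k] [CharZero k] {X : Scheme.{u}}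
    (f : X ⟶ Spec (.of k)) [SmoothOfRelativeDimension 2 f] {C : Type u} [CommRing C]
    [Algebra k C] [Algebra R C] [IsScalarTower k R C] [Module.Free R C] [Module.Finite R C]
    [Module.Finite k C] [IsLocalRing C] (q : Spec (.of C) ⟶ X)
    (hq : q ≫ f = specHom R C ≫ specHom k R)
    (hcl : IsClosedImmersion (pullback.lift q (specHom R C) hq)) :
    ∃ (C' : Type u) (_ : CommRing C') (_ : Algebra k C') (_ : Algebra R' C')
      (_ : IsScalarTower k R' C') (p : C' →ₐ[k] C) (q' : Spec (.of C') ⟶ X)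
      (hq' : q' ≫ f = specHom R' C' ≫ specHom k R'),
      Module.Free R' C' ∧ Module.Finite R' C' ∧ Function.Surjective p ∧
      (∀ r, p (algebraMap R' C' r) = algebraMap R C (E.π r)) ∧
      (∀ z, p z = 0 → ∃ w, z = algebraMap R' C' E.e * w) ∧
      Spec.map (CommRingCat.ofHom p.toRingHom) ≫ q' = q ∧
      SurjectiveOnStalks (pullback.lift q' (specHom R' C') hq') := by
  obtain ⟨D, _, _, i, g, hi, hif, hD, hgq⟩ := exists_chart_factorization f 2 q
    (by rw [hq, ← Spec.map_comp, ← CommRingCat.ofHom_comp, ← IsScalarTower.algebraMap_eq])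
  let j (S : Type u) [CommRing S] [Algebra k S] :
      pullback (specHom k D) (specHom k S) ⟶ pullback f (specHom k S) :=
    pullback.map _ _ _ _ i (𝟙 _) (𝟙 _) (by simpa using hif.symm) (by simp)
  have hj (S : Type u) [CommRing S] [Algebra k S] : IsOpenImmersion (j S) := by
    dsimp only [j]; infer_instance
  have hcl' : IsClosedImmersion (pullback.lift _ _ (chart_comm (R := R) g)) := by
    have : IsClosedImmersion (pullback.lift _ _ (chart_comm (R := R) g) ≫ j R) := by
      convert hcl
      exact pullback_lift_map_left _ hgq _ _ _
    exact .of_comp _ (j R)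
  rw [isClosedImmersion_chart_iff] at hcl'
  obtain ⟨C', _, _, _, _, p, g', hfree, hfin, hsurj, hp, hker, hg', hadj⟩ :=
    E.exists_lift_chart g hcl'
  have hc := (isClosedImmersion_chart_iff (R := R') g').2 hadj
  have hq' : (Spec.map (CommRingCat.ofHom g'.toRingHom) ≫ i) ≫ f =
      specHom R' C' ≫ specHom k R' := by
    rw [Category.assoc, hif]
    exact chart_comm (R := R') g'
  refine ⟨C', _, _, _, ‹_›, p, Spec.map (CommRingCat.ofHom g'.toRingHom) ≫ i, hq', hfree, hfin,
    hsurj, hp, hker, ?_, ?_⟩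
  · rw [← hgq, ← Category.assoc, ← Spec.map_comp, ← CommRingCat.ofHom_comp]
    congr 3
    ext d
    exact hg' d
  · have : pullback.lift _ _ (chart_comm (R := R') g') ≫ j R' = pullback.lift _ _ hq' :=
      pullback_lift_map_left _ rfl _ _ _
    rw [← this]
    infer_instance


end SmallExtension

end

/-! ### Assembling local lifts over a finite product of local rings. -/

noncomputable section

section Pi

variable {ι : Type u} [Finite ι] {C : Type u} [CommRing C] {F : ι → Type u} [∀ j, CommRing (F j)]
  (φ : ∀ j, C →+* F j)

/-- The spectrum of a finite product is the coproduct of the spectra. -/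
def sigmaIsoSpec (hφ : Function.Bijective (RingHom.pi φ)) : (∐ fun j => Spec (.of (F j))) ≅ Spec (.of C) :=
  asIso (sigmaSpec fun j => .of (F j)) ≪≫
    Scheme.Spec.mapIso (RingEquiv.ofBijective _ hφ).toCommRingCatIso.op

theorem ι_sigmaIsoSpec (hφ : Function.Bijective (RingHom.pi φ)) (j : ι) :
    Sigma.ι (fun j => Spec (.of (F j))) j ≫ (sigmaIsoSpec φ hφ).hom =
    Spec.map (CommRingCat.ofHom (φ j)) := by
  rw [sigmaIsoSpec, Iso.trans_hom, asIso_hom, ι_sigmaSpec_assoc]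
  exact (Spec.map_comp _ _).symm

theorem Spec_hom_ext_pi (hφ : Function.Bijective (RingHom.pi φ)) {X : Scheme.{u}} {a b : Spec (.of C) ⟶ X}
    (hab : ∀ j, Spec.map (CommRingCat.ofHom (φ j)) ≫ a = Spec.map (CommRingCat.ofHom (φ j)) ≫ b) :
    a = b := by
  rw [← cancel_epi (sigmaIsoSpec φ hφ).hom]
  apply Sigma.hom_ext
  intro j
  rw [← Category.assoc, ← Category.assoc, ι_sigmaIsoSpec]
  exact hab j

theorem exists_Spec_desc_pi (hφ : Function.Bijective (RingHom.pi φ)) {X : Scheme.{u}}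
    (q : ∀ j, Spec (.of (F j)) ⟶ X) :
    ∃ a : Spec (.of C) ⟶ X, ∀ j, Spec.map (CommRingCat.ofHom (φ j)) ≫ a = q j := by
  refine ⟨(sigmaIsoSpec φ hφ).inv ≫ Sigma.desc q, fun j => ?_⟩
  rw [← ι_sigmaIsoSpec φ hφ, Category.assoc, Iso.hom_inv_id_assoc, Sigma.ι_desc]

theorem surjectiveOnStalks_of_pi (hφ : Function.Bijective (RingHom.pi φ)) {X : Scheme.{u}}
    (a : Spec (.of C) ⟶ X)
    (ha : ∀ j, SurjectiveOnStalks (Spec.map (CommRingCat.ofHom (φ j)) ≫ a)) :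
    SurjectiveOnStalks a := by
  have h : (sigmaIsoSpec φ hφ).hom ≫ a =
      Sigma.desc fun j => Spec.map (CommRingCat.ofHom (φ j)) ≫ a := by
    apply Sigma.hom_ext
    intro j
    rw [← Category.assoc, ι_sigmaIsoSpec, Sigma.ι_desc]
  have h' : SurjectiveOnStalks ((sigmaIsoSpec φ hφ).hom ≫ a) := by
    rw [h]
    exact IsZariskiLocalAtSource.sigmaDesc ha
  rw [← Iso.inv_hom_id_assoc (sigmaIsoSpec φ hφ) a]
  infer_instance

end Pi

theorem pullback_lift_map_right {W X T T' S : Scheme.{u}} {f : X ⟶ S} {t : T ⟶ S}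
    {a : W ⟶ X} {b : W ⟶ T} (h : a ≫ f = b ≫ t) {t' : T' ⟶ S} {i : T ⟶ T'}
    {c : W ⟶ T'} (hc : b ≫ i = c) (h' : a ≫ f = c ≫ t') (e₁ e₂) :
    pullback.lift a b h ≫ pullback.map f t f t' (𝟙 X) i (𝟙 S) e₁ e₂ = pullback.lift a c h' := by
  apply pullback.hom_ext
  · rw [Category.assoc, pullback.map, pullback.lift_fst, pullback.lift_fst,
      pullback.lift_fst_assoc, Category.comp_id]
  · rw [Category.assoc, pullback.map, pullback.lift_snd, pullback.lift_snd,
      pullback.lift_snd_assoc, hc]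

namespace SmallExtension

variable {k : Type u} [Field k] {R' R : Type u} [CommRing R'] [CommRing R]
  [Algebra k R'] [Algebra k R] (E : SmallExtension k R' R)

/-- The kernel of `p` is generated by `e`, so `C` is the base change of `C'` to `R`; the pushout
property is read off from the quotient. -/
theorem isPullback_specHom {C C' : Type u} [CommRing C] [CommRing C']
    [Algebra R C] [Algebra R' C'] (p : C' →+* C) (hsurj : Function.Surjective p)
    (hp : ∀ r, p (algebraMap R' C' r) = algebraMap R C (E.π r))
    (hker : ∀ z, p z = 0 → ∃ w, z = algebraMap R' C' E.e * w) :
    IsPullback (Spec.map (CommRingCat.ofHom p)) (specHom R C) (specHom R' C')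
      (Spec.map (CommRingCat.ofHom E.π.toRingHom)) := by
  apply isPullback_SpecMap_of_isPushout
  have hw : CommRingCat.ofHom (algebraMap R' C') ≫ CommRingCat.ofHom p =
      CommRingCat.ofHom E.π.toRingHom ≫ CommRingCat.ofHom (algebraMap R C) := by
    ext r; exact hp r
  refine ⟨⟨hw⟩, ⟨PushoutCocone.IsColimit.mk _ (fun s => CommRingCat.ofHom
    (p.liftOfSurjective hsurj ⟨s.inl.hom, ?_⟩)) ?_ ?_ ?_⟩⟩
  · intro z hz
    obtain ⟨w, rfl⟩ := hker z hz
    have h1 : s.inl.hom (algebraMap R' C' E.e) = s.inr.hom (E.π E.e) := congr($(s.condition) E.e)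
    rw [RingHom.mem_ker, map_mul, h1, E.π_e, map_zero, zero_mul]
  · intro s
    ext z
    exact RingHom.liftOfRightInverse_comp_apply _ _ (Function.rightInverse_surjInv hsurj) _ z
  · intro s
    ext r
    obtain ⟨r', rfl⟩ := E.surjective r
    have h1 : s.inl.hom (algebraMap R' C' r') = s.inr.hom (E.π r') := congr($(s.condition) r')
    refine Eq.trans ?_ h1
    change (p.liftOfSurjective hsurj _) (algebraMap R C (E.π r')) = _
    rw [← hp]
    exact RingHom.liftOfRightInverse_comp_apply _ _ (Function.rightInverse_surjInv hsurj) _ _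
  · intro s m h1 _
    ext c
    obtain ⟨z, rfl⟩ := hsurj c
    refine Eq.trans ?_ (RingHom.liftOfRightInverse_comp_apply _ _ (Function.rightInverse_surjInv hsurj) _ z).symm
    exact congr($h1 z)

/-- The kernel consists of elements of square zero, which lie in every prime. -/
theorem surjective_SpecMap {C' C : Type u} [CommRing C] [CommRing C'] [Algebra R' C'] (p : C' →+* C)
    (hsurj : Function.Surjective p)
    (hker : ∀ z, p z = 0 → ∃ w, z = algebraMap R' C' E.e * w) :
    Function.Surjective (Spec.map (CommRingCat.ofHom p)) := by
  intro P
  have h : P ∈ PrimeSpectrum.zeroLocus (RingHom.ker p : Set C') := by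
    intro z hz
    obtain ⟨w, rfl⟩ := hker z hz
    refine P.isPrime.mem_of_pow_mem 2 ?_
    rw [mul_pow, ← map_pow, pow_two, E.mul_self_e, map_zero, zero_mul]
    exact zero_mem _
  rw [← range_comap_of_surjective _ p hsurj] at h
  exact h

/-- Finite flat families of closed subschemes of a smooth surface lift along small extensions. -/
theorem exists_lift_family [IsAlgClosed k] [CharZero k] [IsLocalRing R] [Module.Finite k R]
    {X : Scheme.{u}} (f : X ⟶ Spec (.of k)) [SmoothOfRelativeDimension 2 f] [IsSeparated f]
    {C : Type u} [CommRing C] [Algebra k C] [Algebra R C] [IsScalarTower k R C] [Module.Flat R C]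
    [Module.Finite R C] (q : Spec (.of C) ⟶ X)
    (hq : q ≫ f = specHom R C ≫ specHom k R)
    (hcl : IsClosedImmersion (pullback.lift q (specHom R C) hq)) :
    ∃ (C' : Type u) (_ : CommRing C') (_ : Algebra R' C')
      (p : C' →+* C) (q' : Spec (.of C') ⟶ X)
      (hq' : q' ≫ f = specHom R' C' ≫ specHom k R'),
      Module.Free R' C' ∧ Module.Finite R' C' ∧
      IsPullback (Spec.map (CommRingCat.ofHom p)) (specHom R C) (specHom R' C')
        (Spec.map (CommRingCat.ofHom E.π.toRingHom)) ∧
      Spec.map (CommRingCat.ofHom p) ≫ q' = q ∧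
      IsClosedImmersion (pullback.lift q' (specHom R' C') hq') := by
  have : Module.Finite k C := .trans R C
  have : IsArtinianRing C := IsArtinianRing.of_finite k C
  -- `C` is Artinian, hence the product of its localizations, each of which is also a quotient of
  -- `C`. Each factor is free over the local ring `R`, being finite and flat.
  let F (j : PrimeSpectrum C) := Localization j.asIdeal.primeCompl
  let φ (j : PrimeSpectrum C) : C →ₐ[R] F j := IsScalarTower.toAlgHom R C (F j)
  have hφ : Function.Bijective (RingHom.pi fun j => (φ j).toRingHom) :=
    PrimeSpectrum.toPiLocalization_bijective
  have hφs (j) : Function.Surjective (φ j) :=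
    IsArtinianRing.localization_surjective j.asIdeal.primeCompl (F j)
  have hfl (j) : Module.Flat R (F j) := .trans R C (F j)
  have hfi (j) : Module.Finite R (F j) := .of_surjective (φ j).toLinearMap (hφs j)
  have hfik (j) : Module.Finite k (F j) := .trans R (F j)
  have hfr (j) : Module.Free R (F j) := Module.free_of_flat_of_isLocalRing
  have hloc (j) : IsLocalRing (F j) := Localization.AtPrime.isLocalRing j.asIdeal
  let π (j) : Spec (.of (F j)) ⟶ Spec (.of C) := Spec.map (CommRingCat.ofHom (φ j).toRingHom)
  have hπ (j) : IsClosedImmersion (π j) := isClosedImmersion_SpecMap_iff.2 (hφs j)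
  have hπR (j) : π j ≫ specHom R C = specHom R (F j) := by
    rw [← Spec.map_comp, ← CommRingCat.ofHom_comp]
    rfl
  have hqj (j) : (π j ≫ q) ≫ f = specHom R (F j) ≫ specHom k R := by
    rw [Category.assoc, hq, ← hπR, Category.assoc]
  have hclj (j) : IsClosedImmersion (pullback.lift _ _ (hqj j)) := by
    have : pullback.lift _ _ (hqj j) = π j ≫ pullback.lift q (specHom R C) hq := by
      apply pullback.hom_ext
      · rw [Category.assoc, pullback.lift_fst, pullback.lift_fst]
      · rw [Category.assoc, pullback.lift_snd, pullback.lift_snd, hπR]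
    rw [this]
    infer_instance
  choose F' i₁ i₂ i₃ i₄ pj qj hqj' hfree hfin hsurj hp hker hpq hst using
    fun j => E.exists_lift_family_of_isLocalRing f (π j ≫ q) (hqj j) (hclj j)
  let C' := ∀ j, F' j
  let φ' (j) : C' →+* F' j := Pi.evalRingHom _ j
  have hφ' : Function.Bijective (RingHom.pi φ') := Function.bijective_id
  let e : C ≃+* ∀ j, F j := RingEquiv.ofBijective _ hφ
  let P : C' →+* ∀ j, F j := RingHom.pi fun j => (pj j).toRingHom.comp (φ' j)
  let p : C' →+* C := e.symm.toRingHom.comp P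
  have hpφ (j) (z : C') : φ j (p z) = pj j (z j) := congr_fun (e.apply_symm_apply (P z)) j
  have hp0 (z : C') : p z = 0 ↔ ∀ j, pj j (z j) = 0 := by
    rw [show p z = e.symm (P z) from rfl, map_eq_zero_iff _ e.symm.injective, funext_iff]
    rfl
  have hps : Function.Surjective p := by
    refine e.symm.surjective.comp fun c => ?_
    choose z hz using fun j => hsurj j (c j)
    exact ⟨z, funext hz⟩
  have hpR (r) : p (algebraMap R' C' r) = algebraMap R C (E.π r) := by
    rw [show p (algebraMap R' C' r) = e.symm (P (algebraMap R' C' r)) from rfl,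
      RingEquiv.symm_apply_eq]
    funext j
    exact (hp j r).trans ((φ j).commutes _).symm
  have hpk (z) (hz : p z = 0) : ∃ w, z = algebraMap R' C' E.e * w := by
    choose w hw using fun j => hker j (z j) ((hp0 z).1 hz j)
    exact ⟨w, funext hw⟩
  obtain ⟨q', hq'⟩ := exists_Spec_desc_pi φ' hφ' qj
  have hφR (j) : Spec.map (CommRingCat.ofHom (φ' j)) ≫ specHom R' C' = specHom R' (F' j) := by
    rw [← Spec.map_comp, ← CommRingCat.ofHom_comp]
    rfl
  have hqf : q' ≫ f = specHom R' C' ≫ specHom k R' := by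
    apply Spec_hom_ext_pi φ' hφ'
    intro j
    rw [← Category.assoc, hq', hqj', ← Category.assoc, hφR]
  have hpq' : Spec.map (CommRingCat.ofHom p) ≫ q' = q := by
    apply Spec_hom_ext_pi _ hφ
    intro j
    rw [← hpq, ← hq', ← Category.assoc, ← Category.assoc, ← Spec.map_comp, ← Spec.map_comp,
      ← CommRingCat.ofHom_comp, ← CommRingCat.ofHom_comp]
    congr 3
    ext z
    exact hpφ j z
  have hpull := E.isPullback_specHom p hps hpR hpk
  refine ⟨C', inferInstance, inferInstance, p, q', hqf, inferInstance, inferInstance, hpull,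
    hpq', ?_⟩
  have hfin' : IsFinite (specHom R' C') :=
    (IsFinite.SpecMap_iff _).2 (RingHom.finite_algebraMap.2 inferInstance)
  have hst' : SurjectiveOnStalks (pullback.lift _ _ hqf) := by
    apply surjectiveOnStalks_of_pi φ' hφ'
    intro j
    convert hst j
    apply pullback.hom_ext
    · rw [Category.assoc, pullback.lift_fst, pullback.lift_fst, hq']
    · rw [Category.assoc, pullback.lift_snd, pullback.lift_snd, hφR]
  -- Finiteness follows by cancelling the separated projection to the base. For a monomorphism,
  -- surjectivity on stalks leaves injectivity on points, which is unaffected by the nilpotent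
  -- thickening and so holds because it holds for the original family.
  rw [IsClosedImmersion.iff_isFinite_and_mono]
  refine ⟨?_, SurjectiveOnStalks.mono_of_injective ?_⟩
  · have : IsFinite (pullback.lift _ _ hqf ≫ pullback.snd f (specHom k R')) := by
      rwa [pullback.lift_snd]
    exact .of_comp _ (pullback.snd f (specHom k R'))
  · have hQE : specHom k R ≫ 𝟙 _ =
        Spec.map (CommRingCat.ofHom E.π.toRingHom) ≫ specHom k R' := by
      rw [Category.comp_id, ← Spec.map_comp, ← CommRingCat.ofHom_comp]
      exact congr(Spec.map (CommRingCat.ofHom $(E.π.comp_algebraMap.symm)))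
    let Q : pullback f (specHom k R) ⟶ pullback f (specHom k R') :=
      pullback.map f (specHom k R) f (specHom k R') (𝟙 _)
        (Spec.map (CommRingCat.ofHom E.π.toRingHom)) (𝟙 _) (by simp) hQE
    have hE : IsClosedImmersion (Spec.map (CommRingCat.ofHom E.π.toRingHom)) :=
      isClosedImmersion_SpecMap_iff.2 E.surjective
    have : MorphismProperty.IsStableUnderComposition (@IsClosedImmersion.{u}) :=
      { comp_mem := fun _ _ _ _ => IsClosedImmersion.comp _ _ }
    have hQ : IsClosedImmersion Q :=
      MorphismProperty.pullbackMap (P := @IsClosedImmersion.{u}) inferInstance hE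
        (Category.id_comp f).symm (by rw [← hQE, Category.comp_id])
    have hc : Spec.map (CommRingCat.ofHom p) ≫ pullback.lift _ _ hqf =
        pullback.lift _ _ hq ≫ Q := by
      have h := pullback_lift_map_right hq (c := Spec.map (CommRingCat.ofHom p) ≫ specHom R' C')
        hpull.w.symm (by rw [hpull.w, hq, Category.assoc, ← hQE, Category.comp_id]) (by simp) hQE
      rw [h]
      apply pullback.hom_ext
      · rw [Category.assoc, pullback.lift_fst, pullback.lift_fst, hpq']
      · rw [Category.assoc, pullback.lift_snd, pullback.lift_snd]
    have hinj : Function.Injective (pullback.lift _ _ hq ≫ Q) :=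
      (pullback.lift _ _ hq ≫ Q).isClosedEmbedding.injective
    rw [← hc] at hinj
    intro x y hxy
    obtain ⟨x, rfl⟩ := E.surjective_SpecMap p hps hpk x
    obtain ⟨y, rfl⟩ := E.surjective_SpecMap p hps hpk y
    refine congrArg _ (hinj ?_)
    rw [Scheme.Hom.comp_apply, Scheme.Hom.comp_apply]
    exact hxy

end SmallExtension

end

/-! ### Unobstructedness of the Hilbert scheme. -/

noncomputable section

variable {k : Type u} [Field k]

theorem IsFamily.baseChange {X : Scheme.{u}} {f : X ⟶ Spec (.of k)} {n : ℕ} {T W T' W' : Scheme.{u}}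
    {t : T ⟶ Spec (.of k)} {q : W ⟶ X} {π : W ⟶ T} (hF : IsFamily f n t q π) {u : T' ⟶ T}
    {g : W' ⟶ W} {π' : W' ⟶ T'} (hp : IsPullback g π' π u) :
    IsFamily f n (u ≫ t) (g ≫ q) π' := by
  have := hF.isFinite
  have := hF.flat
  have := hF.locallyOfFinitePresentation
  have hc : (g ≫ q) ≫ f = π' ≫ u ≫ t := by
    rw [Category.assoc, hF.comm, ← Category.assoc, hp.w, Category.assoc]
  refine ⟨hc, ?_, MorphismProperty.of_isPullback (P := @IsFinite) hp hF.isFinite,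
    MorphismProperty.of_isPullback (P := @Flat) hp hF.flat,
    MorphismProperty.of_isPullback (P := @LocallyOfFinitePresentation) hp
      hF.locallyOfFinitePresentation, fun s => ?_⟩
  · let Q : pullback f (u ≫ t) ⟶ pullback f t :=
      pullback.lift (pullback.fst _ _) (pullback.snd _ _ ≫ u)
        (by rw [pullback.condition, Category.assoc])
    have h1 : IsPullback Q (pullback.snd f (u ≫ t)) (pullback.snd f t) u := by
      refine IsPullback.of_right ?_ (pullback.lift_snd _ _ _) (IsPullback.of_hasPullback f t)
      rw [pullback.lift_fst]
      exact IsPullback.of_hasPullback f (u ≫ t)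
    have h2 : IsPullback g (pullback.lift _ _ hc) (pullback.lift _ _ hF.comm) Q := by
      refine (IsPullback.of_right ?_ ?_ h1.flip).flip
      · rw [pullback.lift_snd, pullback.lift_snd]
        exact hp.flip
      · apply pullback.hom_ext
        · rw [Category.assoc, Category.assoc, pullback.lift_fst, pullback.lift_fst,
            pullback.lift_fst]
        · rw [Category.assoc, Category.assoc, pullback.lift_snd, pullback.lift_snd,
            pullback.lift_snd_assoc, hp.w]
    exact MorphismProperty.of_isPullback (P := @IsClosedImmersion) h2 hF.isClosedImmersion
  · rw [Scheme.Hom.finrank_of_isPullback _ _ _ _ hp, hF.rank]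

theorem exists_isPullback_specHom {Z H : Scheme.{u}} (π : Z ⟶ H) [IsAffineHom π] {R : Type u}
    [CommRing R] (u : Spec (.of R) ⟶ H) :
    ∃ (C : Type u) (_ : CommRing C) (_ : Algebra R C) (g : Spec (.of C) ⟶ Z),
      IsPullback g (specHom R C) π u := by
  have : IsAffine (pullback π u) := isAffine_of_isAffineHom (pullback.snd π u)
  let W := pullback π u
  obtain ⟨ψ, hψ⟩ := Spec.map_surjective (W.isoSpec.inv ≫ pullback.snd π u)
  let _ : Algebra R Γ(W, ⊤) := ψ.hom.toAlgebra
  refine ⟨Γ(W, ⊤), inferInstance, inferInstance, W.isoSpec.inv ≫ pullback.fst π u, ?_⟩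
  have : specHom R Γ(W, ⊤) = W.isoSpec.inv ≫ pullback.snd π u := hψ
  rw [this]
  exact IsPullback.of_iso (IsPullback.of_hasPullback π u) W.isoSpec (Iso.refl _) (Iso.refl _)
    (Iso.refl _) (by simp) (by simp) (by simp) (by simp)

theorem SmallExtension.surjective_SpecMap_π {R' R : Type u} [CommRing R'] [CommRing R]
    [Algebra k R'] [Algebra k R] (E : SmallExtension k R' R) :
    Function.Surjective (Spec.map (CommRingCat.ofHom E.π.toRingHom)) := by
  refine E.surjective_SpecMap E.π.toRingHom E.surjective fun z hz => ?_
  obtain ⟨c, rfl⟩ := E.exists_smul z hz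
  exact ⟨c • 1, by simp⟩

/-- Every point of the thickened base comes from the original base, so the rank can be read off
there. -/
theorem isFamily_specHom {X : Scheme.{u}} {f : X ⟶ Spec (.of k)} {n : ℕ} {R' R C C' : Type u}
    [CommRing R'] [CommRing R] [Algebra k R'] [CommRing C] [CommRing C'] [Algebra R C]
    [Algebra R' C'] [IsNoetherianRing R'] [Module.Finite R' C'] [Module.Flat R' C']
    {q' : Spec (.of C') ⟶ X} (hq' : q' ≫ f = specHom R' C' ≫ specHom k R')
    (hcl : IsClosedImmersion (pullback.lift q' (specHom R' C') hq'))
    {g : Spec (.of C) ⟶ Spec (.of C')} {u : Spec (.of R) ⟶ Spec (.of R')}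
    (hp : IsPullback g (specHom R C) (specHom R' C') u) (hu : Function.Surjective u)
    (hr : ∀ s, (specHom R C).finrank s = n) :
    IsFamily f n (specHom k R') q' (specHom R' C') := by
  have h1 : IsFinite (specHom R' C') :=
    (IsFinite.SpecMap_iff _).2 (RingHom.finite_algebraMap.2 inferInstance)
  have h2 : Flat (specHom R' C') := Flat.SpecMap_iff.2 (RingHom.flat_algebraMap_iff.2 inferInstance)
  refine ⟨hq', hcl, h1, h2, ?_, fun s => ?_⟩
  · have : Algebra.FinitePresentation R' C' :=
      Algebra.FinitePresentation.of_finiteType.1 inferInstance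
    exact (HasRingHomProperty.Spec_iff (P := @LocallyOfFinitePresentation)).2
      (RingHom.finitePresentation_algebraMap.2 inferInstance)
  · obtain ⟨s, rfl⟩ := hu s
    rw [← Scheme.Hom.finrank_of_isPullback _ _ _ _ hp, hr]

/-- A map to the chart is a family over the truncation; lifting the family lifts the map. This
replaces smoothness of H in everything that follows. -/
theorem IsHilbertScheme.liftsTrunc [IsAlgClosed k] [CharZero k] {X : Scheme.{u}}
    {f : X ⟶ Spec (.of k)} [SmoothOfRelativeDimension 2 f] [IsSeparated f] {n : ℕ}
    {H Z : Scheme.{u}} {h : H ⟶ Spec (.of k)} {q : Z ⟶ X} {π : Z ⟶ H}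
    (hH : IsHilbertScheme f n h q π) {A : Type u} [CommRing A] [Algebra k A]
    (i : Spec (.of A) ⟶ H) [IsOpenImmersion i] (hi : i ≫ h = specHom k A) (N : ℕ) :
    LiftsTrunc k A N := by
  intro S s h0 hS hS' hs φ
  let R := TruncAlg k S
  let R' := TruncAlg k (insert s S)
  let E : SmallExtension k R' R := SmallExtension.trunc k h0 hS hS' hs
  have hfin : IsFinite π := hH.isFamily.isFinite
  have hR : IsLocalRing R := TruncAlg.isLocalRing h0
  have hRf : Module.Finite k R := TruncAlg.finite hS
  have hRf' : Module.Finite k R' := TruncAlg.finite hS'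
  have hRn : IsNoetherianRing R' := IsNoetherianRing.of_finite k R'
  let u : Spec (.of R) ⟶ H := Spec.map (CommRingCat.ofHom φ.toRingHom) ≫ i
  have hu : u ≫ h = specHom k R := by
    rw [Category.assoc, hi, ← Spec.map_comp, ← CommRingCat.ofHom_comp]
    exact congr(Spec.map (CommRingCat.ofHom $(φ.comp_algebraMap)))
  obtain ⟨C, _, _, g, hg⟩ := exists_isPullback_specHom π u
  let _ : Algebra k C := ((algebraMap R C).comp (algebraMap k R)).toAlgebra
  have : IsScalarTower k R C := .of_algebraMap_eq fun _ => rfl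
  have hF := hH.isFamily.baseChange hg
  rw [hu] at hF
  have : Module.Finite R C := RingHom.finite_algebraMap.1 ((IsFinite.SpecMap_iff _).1 hF.isFinite)
  have : Module.Flat R C := RingHom.flat_algebraMap_iff.1 (Flat.SpecMap_iff.1 hF.flat)
  obtain ⟨C', _, _, p, q', hq', _, _, hpull, hpq, hcl⟩ :=
    E.exists_lift_family f (g ≫ q) hF.comm hF.isClosedImmersion
  have hF' : IsFamily f n (specHom k R') q' (specHom R' C') :=
    isFamily_specHom hq' hcl hpull E.surjective_SpecMap_π hF.rank
  have hft (R : Type u) [CommRing R] [Algebra k R] [Module.Finite k R] :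
      LocallyOfFiniteType (specHom k R) :=
    (HasRingHomProperty.Spec_iff (P := @LocallyOfFiniteType)).2
      (RingHom.finiteType_algebraMap.2 inferInstance)
  obtain ⟨v, ⟨hv, g', hgq', hg'⟩, -⟩ := hH.existsUnique _ _ _ (hft R') hF'
  have hEk : Spec.map (CommRingCat.ofHom E.π.toRingHom) ≫ specHom k R' = specHom k R := by
    rw [← Spec.map_comp, ← CommRingCat.ofHom_comp]
    exact congr(Spec.map (CommRingCat.ofHom $(E.π.comp_algebraMap)))
  -- Both morphisms classify the same family over `R`, so uniqueness in the universal property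
  -- identifies them.
  have hEv : Spec.map (CommRingCat.ofHom E.π.toRingHom) ≫ v = u := by
    refine (hH.existsUnique _ _ _ (hft R) hF).unique ⟨?_, _, ?_, hpull.paste_horiz hg'⟩
      ⟨hu, g, rfl, hg⟩
    · rw [Category.assoc, hv, hEk]
    · rw [Category.assoc, hgq', hpq]
  -- The thickening has the same points, so the lifted morphism stays in the chart.
  have hrange : Set.range v ⊆ Set.range i := by
    rintro _ ⟨x, rfl⟩
    obtain ⟨x, rfl⟩ := E.surjective_SpecMap_π x
    rw [← Scheme.Hom.comp_apply, hEv]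
    exact ⟨_, (Scheme.Hom.comp_apply _ _ _).symm⟩
  obtain ⟨ψ, hψ⟩ := Spec.map_surjective (IsOpenImmersion.lift i v hrange)
  have hψi : Spec.map ψ ≫ i = v := by rw [hψ]; exact IsOpenImmersion.lift_fac _ _ _
  have hψk : CommRingCat.ofHom (algebraMap k A) ≫ ψ = CommRingCat.ofHom (algebraMap k R') := by
    apply Spec.map_injective
    rw [Spec.map_comp]
    refine Eq.trans ?_ hv
    rw [← hψi, Category.assoc, hi]
  let ψ' : A →ₐ[k] R' := { ψ.hom with commutes' := fun a => congr($hψk a) }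
  refine ⟨ψ', ?_⟩
  have : ψ ≫ CommRingCat.ofHom E.π.toRingHom = CommRingCat.ofHom φ.toRingHom := by
    apply Spec.map_injective
    rw [← cancel_mono i, Spec.map_comp, Category.assoc, hψi, hEv]
  ext a
  exact congr($this a)

end

/-! ### The socle bound for quotients of a smooth surface algebra. -/

noncomputable section

theorem TruncAlg.card_degLT_succ (N t : ℕ) : (degLT N (t + 1)).card = (t + N).choose N := by
  rw [degLT, Finset.card_biUnion, ← Nat.sum_range_multichoose]
  · refine Finset.sum_congr rfl fun d _ => ?_
    rw [Finset.card_finsuppAntidiag_nat_eq_multichoose, Finset.card_univ, Fintype.card_fin]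
  · intro a _ b _ hab
    rw [Function.onFun, Finset.disjoint_left]
    intro s hs hs'
    rw [Finset.mem_finsuppAntidiag] at hs hs'
    exact hab (hs.1.symm.trans hs'.1)

theorem TruncAlg.card_degLT_two (t : ℕ) : (degLT 2 t).card = t * (t + 1) / 2 := by
  cases t with
  | zero => simp [degLT]
  | succ t => rw [card_degLT_succ, Nat.choose_two_right]; congr 1; rw [Nat.add_sub_assoc one_le_two]; ring

section Socle

variable {k : Type*} [Field k] {A : Type*} [CommRing A] [Algebra k A]

/-- The socle of `A` with respect to an augmentation: the elements killed by the
augmentation ideal. -/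
def augSocle (ε : A →ₐ[k] k) : Ideal A where
  carrier := {a | ∀ b, ε b = 0 → b * a = 0}
  add_mem' ha hb c hc := by rw [mul_add, ha c hc, hb c hc, add_zero]
  zero_mem' c _ := mul_zero c
  smul_mem' r a ha c hc := by rw [smul_eq_mul, mul_left_comm, ha c hc, mul_zero]

theorem mul_eq_smul_of_mem_augSocle {ε : A →ₐ[k] k} {a : A} (ha : a ∈ augSocle ε) (b : A) :
    b * a = ε b • a := by
  have h := ha (b - algebraMap k A (ε b)) (by simp)
  rw [sub_mul, sub_eq_zero] at h
  rw [h, Algebra.smul_def]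

/-- The socle is killed by any element of the augmentation ideal, so its dimension is at most
the colength of that element. -/
theorem finrank_augSocle_le [Module.Finite k A] (ε : A →ₐ[k] k) {l : A} (hl : ε l = 0) :
    Module.finrank k (augSocle ε) ≤ Module.finrank k (A ⧸ Ideal.span {l}) := by
  let μ : A →ₗ[k] A := LinearMap.mulLeft k l
  have h1 : (augSocle ε).restrictScalars k ≤ LinearMap.ker μ := fun a ha => ha l hl
  have h2 : (Ideal.span {l}).restrictScalars k = LinearMap.range μ := by
    ext a
    rw [Submodule.restrictScalars_mem, Ideal.mem_span_singleton', LinearMap.mem_range]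
    simp [μ, mul_comm]
  have h3 := LinearMap.finrank_range_add_finrank_ker μ
  have h4 := Submodule.finrank_quotient_add_finrank ((Ideal.span {l}).restrictScalars k)
  have h5 := Submodule.finrank_mono h1
  have h6 : Module.finrank k (A ⧸ (Ideal.span {l}).restrictScalars k) =
      Module.finrank k (A ⧸ Ideal.span {l}) := rfl
  have h7 : Module.finrank k ((augSocle ε).restrictScalars k) = Module.finrank k (augSocle ε) := rfl
  rw [h2] at h4 h6
  omega

end Socle

/-- The dimension of the socle can be computed over the ground field. -/
theorem socleDim_eq_finrank {k : Type u} [Field k] {R A : Type u} [CommRing R] [IsLocalRing R]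
    [CommRing A] [Algebra k A] [Module.Finite k A] (φ : R →+* A) (hφ : Function.Surjective φ)
    (ε : A →ₐ[k] k) : socleDim φ = Module.finrank k (augSocle ε) := by
  let _ : Algebra R A := φ.toAlgebra
  let εR : R →+* k := ε.toRingHom.comp φ
  have hεR : Function.Surjective εR :=
    (show Function.Surjective ε from fun c => ⟨algebraMap k A c, by simp⟩).comp hφ
  have hmax : RingHom.ker εR = IsLocalRing.maximalIdeal R :=
    IsLocalRing.eq_maximalIdeal (RingHom.ker_isMaximal_of_surjective _ hεR)
  have hm : ∀ r, r ∈ IsLocalRing.maximalIdeal R ↔ ε (φ r) = 0 := fun r => by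
    rw [← hmax]; rfl
  let ev : (IsLocalRing.ResidueField R →ₗ[R] A) →ₗ[R] augSocle ε :=
    { toFun := fun f => ⟨f 1, fun b hb => by
        obtain ⟨r, rfl⟩ := hφ b
        have h1 : r • (1 : IsLocalRing.ResidueField R) = 0 := by
          rw [Algebra.smul_def, mul_one]
          exact (IsLocalRing.residue_eq_zero_iff r).2 ((hm r).2 hb)
        have h2 : r • f 1 = 0 := by rw [← map_smul, h1, map_zero]
        rwa [Algebra.smul_def] at h2⟩
      map_add' := fun f g => rfl
      map_smul' := fun r f => rfl }
  have hev : Function.Bijective ev := by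
    constructor
    · intro f g hfg
      ext x
      obtain ⟨r, rfl⟩ := IsLocalRing.residue_surjective x
      have h1 : IsLocalRing.residue R r = r • (1 : IsLocalRing.ResidueField R) := by
        rw [Algebra.smul_def, mul_one]; rfl
      rw [h1, map_smul, map_smul]
      exact congr(r • ($hfg : A))
    · rintro ⟨a, ha⟩
      refine ⟨Submodule.liftQ (IsLocalRing.maximalIdeal R) (LinearMap.toSpanSingleton R A a) ?_, ?_⟩
      · intro r hr
        rw [LinearMap.mem_ker, LinearMap.toSpanSingleton_apply, Algebra.smul_def]
        exact ha _ ((hm r).1 hr)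
      · apply Subtype.ext
        change (Submodule.liftQ (IsLocalRing.maximalIdeal R) (LinearMap.toSpanSingleton R A a) _)
          (Submodule.Quotient.mk 1) = a
        rw [Submodule.liftQ_apply, LinearMap.toSpanSingleton_apply, one_smul]
  have h1 : socleDim φ = Module.length R (augSocle ε) :=
    (LinearEquiv.ofBijective ev hev).length_eq
  rw [h1, ← Module.length_eq_finrank]
  let _ : Algebra R k := εR.toAlgebra
  have : IsScalarTower R k (augSocle ε) := ⟨fun r c m => by
    apply Subtype.ext
    change (εR r * c) • (m : A) = φ r * (c • (m : A))
    rw [mul_smul_comm, mul_eq_smul_of_mem_augSocle m.2, smul_smul, mul_comm]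
    rfl⟩
  exact Module.length_eq_of_surjective hεR

theorem MvPolynomial.IsHomogeneous.eval_mul_const {σ R : Type*} [Fintype σ] [CommRing R]
    {P : MvPolynomial σ R} {r : ℕ} (hP : P.IsHomogeneous r) (c : σ → R) (z : R) :
    eval (fun i => c i * z) P = z ^ r * eval c P := by
  rw [eval_eq', eval_eq', Finset.mul_sum]
  refine Finset.sum_congr rfl fun d hd => ?_
  have h : ∑ i, d i = r := by
    rw [← Finsupp.degree_eq_sum, Finsupp.degree_eq_weight_one]
    exact hP (mem_support_iff.1 hd)
  simp_rw [mul_pow]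
  rw [Finset.prod_mul_distrib, Finset.prod_pow_eq_pow_sum, h]
  ring

/-- Generators of 𝔭 modulo 𝔭² give leading forms: every element of 𝔭^r is a form of degree r in
them, up to 𝔭^(r+1). -/
theorem Ideal.pow_le_pow_sup_pow_succ {D : Type*} [CommRing D] {p J : Ideal D} (hJ : J ≤ p)
    (h : p ≤ J ⊔ p ^ 2) (r : ℕ) : p ^ r ≤ J ^ r ⊔ p ^ (r + 1) := by
  induction r with
  | zero => simp
  | succ r ih =>
    rw [pow_succ p r]
    refine (Ideal.mul_mono ih h).trans ?_
    rw [Ideal.sup_mul, Ideal.mul_sup, Ideal.mul_sup, ← pow_succ]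
    refine sup_le (sup_le le_sup_left (le_sup_of_le_right ?_))
      (sup_le (le_sup_of_le_right ?_) (le_sup_of_le_right ?_))
    · exact (Ideal.mul_mono_left (Ideal.pow_right_mono hJ r)).trans (pow_add p r 2).ge
    · exact (Ideal.mul_mono_right hJ).trans (pow_succ p (r + 1)).ge
    · exact (pow_add p (r + 1) 2).ge.trans (Ideal.pow_le_pow_right (by omega))

/-- If the augmentation ideal of `B` is generated by an element `z` with `z ^ r = 0`, then
`dim B ≤ r`. -/
theorem finrank_le_of_pow_eq_zero {k B : Type*} [Field k] [CommRing B] [Algebra k B] {z : B} {r : ℕ}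
    (hB : ∀ b : B, ∃ (c : k) (b' : B), b = algebraMap k B c + z * b') (hz : z ^ r = 0) :
    Module.finrank k B ≤ r := by
  have key : ∀ m i : ℕ, i + m = r → ∀ b : B,
      z ^ i * b ∈ Submodule.span k (Set.range fun j : Fin r => z ^ (j : ℕ)) := by
    intro m
    induction m with
    | zero =>
      rintro i rfl b
      rw [add_zero] at hz
      rw [hz, zero_mul]
      exact zero_mem _
    | succ m ih =>
      intro i hi b
      obtain ⟨c, b', rfl⟩ := hB b
      rw [mul_add, ← mul_assoc, ← pow_succ, mul_comm, ← Algebra.smul_def]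
      exact add_mem (Submodule.smul_mem _ _ (Submodule.subset_span ⟨⟨i, by omega⟩, rfl⟩))
        (ih (i + 1) (by omega) b')
  have htop : Submodule.span k (Set.range fun j : Fin r => z ^ (j : ℕ)) = ⊤ := by
    rw [eq_top_iff]
    intro b _
    simpa using key r 0 (zero_add r) b
  have := finrank_range_le_card (R := k) (fun j : Fin r => z ^ (j : ℕ))
  rwa [Set.finrank, htop, finrank_top, Fintype.card_fin] at this

/-- The witness r is the order of the ideal `RingHom.ker g` at the point. An element of exact order
r bounds the socle after cutting by a general line, and the truncation at degree r bounds r itself.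
-/
theorem exists_finrank_augSocle_le {k A D : Type*} [Field k] [Infinite k] [CommRing A] [CommRing D]
    [Algebra k A] [Algebra k D] [Module.Finite k A] (g : D →ₐ[k] A) (hg : Function.Surjective g)
    (ε : A →ₐ[k] k) (hε : IsNilpotent (RingHom.ker ε)) (F : PointFrame k D 2)
    (hF : F.ε = ε.comp g) (hD : LiftsTrunc k D 2) :
    ∃ r : ℕ, r * (r + 1) / 2 ≤ Module.finrank k A ∧ Module.finrank k (augSocle ε) ≤ r := by
  set p := RingHom.ker F.ε with hp
  have hεg : ∀ d, F.ε d = ε (g d) := fun d => by rw [hF]; rfl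
  have hcard : ∀ t, RingHom.ker g ≤ p ^ t → t * (t + 1) / 2 ≤ Module.finrank k A := by
    intro t ht
    rcases t.eq_zero_or_pos with rfl | htpos
    · simp
    obtain ⟨ψ, hψ, hψε⟩ := exists_surjective_truncAlg hD F.ε F.δ F.leibniz F.surjective
      (TruncAlg.degLT 2 t) (TruncAlg.isLowerSet_degLT 2 t) (TruncAlg.zero_mem_degLT htpos)
    have hker : RingHom.ker g ≤ RingHom.ker ψ := by
      intro d hd
      have h1 : ψ d ∈ Ideal.map ψ (p ^ t) := Ideal.mem_map_of_mem _ (ht hd)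
      rw [Ideal.map_pow] at h1
      have h2 : Ideal.map ψ p ≤ RingHom.ker (TruncAlg.aug (k := k)
          (TruncAlg.zero_mem_degLT (N := 2) htpos)) := by
        rw [Ideal.map_le_iff_le_comap]
        intro d hd
        rw [Ideal.mem_comap, RingHom.mem_ker, hψε]
        exact hd
      have h3 := Ideal.pow_right_mono h2 t h1
      rw [TruncAlg.ker_aug_pow_degLT htpos] at h3
      exact h3
    have h := LinearMap.finrank_le_finrank_of_surjective
      (f := (AlgHom.liftOfSurjective g hg ψ hker).toLinearMap) (fun z => by
        obtain ⟨d, rfl⟩ := hψ z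
        exact ⟨g d, AlgHom.liftOfSurjective_apply g hg ψ hker d⟩)
    rwa [TruncAlg.finrank (TruncAlg.isLowerSet_degLT 2 t), TruncAlg.card_degLT_two] at h
  -- The order is finite: order t forces t(t+1)/2 ≤ dim A, which fails for t = 2 dim A + 1.
  have hex : ∃ t, ¬ RingHom.ker g ≤ p ^ (t + 1) := by
    by_contra! h
    have h1 := hcard _ (h (2 * Module.finrank k A))
    have h2 : 2 * Module.finrank k A + 1 ≤
        (2 * Module.finrank k A + 1) * (2 * Module.finrank k A + 1 + 1) / 2 := by
      rw [Nat.le_div_iff_mul_le two_pos]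
      exact Nat.mul_le_mul_left _ (by omega)
    omega
  classical
  -- The minimal `r` failing for the exponent `r + 1` is the largest exponent for which the
  -- inclusion holds.
  let r := Nat.find hex
  have hr : ¬ RingHom.ker g ≤ p ^ (r + 1) := Nat.find_spec hex
  have hr1 : 1 ≤ r := by
    by_contra h0
    have h0 : r = 0 := by omega
    rw [h0] at hr
    refine hr fun d hd => ?_
    rw [zero_add, pow_one, hp, RingHom.mem_ker, hεg, (RingHom.mem_ker).1 hd, map_zero]
  have hr' : RingHom.ker g ≤ p ^ r := by
    have := Nat.find_min hex (m := r - 1) (by omega)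
    rwa [not_not, Nat.sub_add_cancel hr1] at this
  refine ⟨r, hcard r hr', ?_⟩
  obtain ⟨y, hy, hyp⟩ := F.exists_generators
  obtain ⟨f, hf, hfr⟩ := SetLike.not_le_iff_exists.1 hr
  have hyp' : Ideal.span (Set.range y) ≤ p := by
    rw [Ideal.span_le]; rintro _ ⟨i, rfl⟩; exact hy i
  obtain ⟨f₁, hf₁, f₂, hf₂, hf₁₂⟩ :=
    Submodule.mem_sup.1 (Ideal.pow_le_pow_sup_pow_succ hyp' hyp r (hr' hf))
  obtain ⟨P, hP, rfl⟩ := (Ideal.mem_span_pow_iff_exists_isHomogeneous _ _).1 hf₁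
  -- The coefficients of `P` lie in `D`, not in `k`; were they all in 𝔭, `f` would have order
  -- greater than `r`.
  have hP0 : MvPolynomial.map F.ε.toRingHom P ≠ 0 := by
    intro h0
    refine hfr (hf₁₂ ▸ add_mem ?_ hf₂)
    rw [MvPolynomial.eval_eq']
    refine sum_mem fun d hd => ?_
    have h1 : P.coeff d ∈ p := by
      have := congr(MvPolynomial.coeff d $h0)
      rwa [MvPolynomial.coeff_map, MvPolynomial.coeff_zero] at this
    have h : ∑ i, d i = r := by
      rw [← Finsupp.degree_eq_sum, Finsupp.degree_eq_weight_one]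
      exact hP (MvPolynomial.mem_support_iff.1 hd)
    rw [add_comm r, pow_add, pow_one, ← h, ← Finset.prod_pow_eq_pow_sum]
    exact Ideal.mul_mem_mul h1 (Ideal.prod_mem_prod fun i _ => Ideal.pow_mem_pow (hy i) _)
  -- A direction in which the leading form does not vanish; it exists since `k` is infinite. It is
  -- nonzero because `r ≥ 1`.
  obtain ⟨c, hc⟩ : ∃ c : Fin 2 → k, MvPolynomial.eval c (MvPolynomial.map F.ε.toRingHom P) ≠ 0 := by
    by_contra! h
    exact hP0 (MvPolynomial.funext fun c => by rw [h, map_zero])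
  obtain ⟨α, hα⟩ : ∃ α : Fin 2 → k, α 0 * c 0 + α 1 * c 1 = 1 := by
    by_cases h0 : c 0 = 0
    · have h1 : c 1 ≠ 0 := by
        intro h1
        have hc0 : c = fun i => c i * 0 := by
          ext i; fin_cases i <;> simp [h0, h1]
        rw [hc0, (hP.map _).eval_mul_const, zero_pow (by omega), zero_mul] at hc
        exact hc rfl
      exact ⟨![0, (c 1)⁻¹], by simp [h1]⟩
    · exact ⟨![(c 0)⁻¹, 0], by simp [h0]⟩
  let κ : k → D := algebraMap k D
  -- Linear change of coordinates: `l` vanishes in the direction `c`, and `z` takes the value 1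
  -- there, so modulo `l` the pair `y` becomes `c` times `z`.
  let l : D := κ (c 1) * y 0 - κ (c 0) * y 1
  let z : D := κ (α 0) * y 0 + κ (α 1) * y 1
  have hα' : κ (α 0) * κ (c 0) + κ (α 1) * κ (c 1) = 1 := by
    simp only [κ]
    rw [← map_mul, ← map_mul, ← map_add, hα, map_one]
  have hy0 : y 0 = κ (c 0) * z + κ (α 1) * l := by
    simp only [z, l]; linear_combination (-y 0) * hα'
  have hy1 : y 1 = κ (c 1) * z - κ (α 0) * l := by
    simp only [z, l]; linear_combination (-y 1) * hα'
  have hl : ε (g l) = 0 := by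
    rw [← hεg]; simp [l, hy]
  have hzp : z ∈ p := add_mem (Ideal.mul_mem_left _ _ (hy 0)) (Ideal.mul_mem_left _ _ (hy 1))
  refine (finrank_augSocle_le ε hl).trans ?_
  let θ : D →ₐ[k] A ⧸ Ideal.span {g l} := (Ideal.Quotient.mkₐ k _).comp g
  have hθ : Function.Surjective θ := (Ideal.Quotient.mkₐ_surjective k _).comp hg
  have hθl : θ l = 0 := Ideal.Quotient.eq_zero_iff_mem.2 (Ideal.mem_span_singleton_self _)
  have hθy0 : θ (y 0) = θ (κ (c 0)) * θ z := by
    have h := congr(θ $hy0)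
    rwa [map_add θ, map_mul θ, map_mul θ, hθl, mul_zero, add_zero] at h
  have hθy1 : θ (y 1) = θ (κ (c 1)) * θ z := by
    have h := congr(θ $hy1)
    rwa [map_sub θ, map_mul θ, map_mul θ, hθl, mul_zero, sub_zero] at h
  have hpmap : p = (RingHom.ker ε).comap g := by
    ext d
    rw [hp, RingHom.mem_ker, hεg, Ideal.mem_comap, RingHom.mem_ker]
  have hnil : IsNilpotent (p.map θ) := by
    obtain ⟨m, hm⟩ := hε
    refine ⟨m, ?_⟩
    have : p.map θ = ((RingHom.ker ε).map (Ideal.Quotient.mkₐ k (Ideal.span {g l}))) := by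
      have h1 : p.map g = RingHom.ker ε := by
        rw [hpmap]; exact Ideal.map_comap_of_surjective g hg _
      rw [← h1]
      exact (Ideal.map_map (f := (g : D →+* A)) (Ideal.Quotient.mk (Ideal.span {g l}))).symm
    rw [this, ← Ideal.map_pow, hm]
    exact Ideal.map_bot
  have hz1 : p.map θ ≤ Ideal.span {θ z} := by
    refine Ideal.le_of_le_sup_sq_of_isNilpotent hnil ((Ideal.map_mono hyp).trans ?_)
    rw [Ideal.map_sup, Ideal.map_pow]
    refine sup_le_sup_right ?_ _
    rw [Ideal.map_span, Ideal.span_le]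
    rintro _ ⟨_, ⟨i, rfl⟩, rfl⟩
    fin_cases i
    · change θ (y 0) ∈ _
      rw [hθy0]
      exact Ideal.mul_mem_left _ _ (Ideal.mem_span_singleton_self _)
    · change θ (y 1) ∈ _
      rw [hθy1]
      exact Ideal.mul_mem_left _ _ (Ideal.mem_span_singleton_self _)
  have hdec : ∀ d, F.ε d = 0 → ∃ b, θ d = θ z * b := by
    intro d hd
    obtain ⟨b, hb⟩ := Ideal.mem_span_singleton.1 (hz1 (Ideal.mem_map_of_mem θ hd))
    exact ⟨b, hb⟩
  obtain ⟨m, hm⟩ : IsNilpotent (θ z) := by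
    obtain ⟨m, hm⟩ := hnil
    refine ⟨m, ?_⟩
    have := Ideal.pow_mem_pow (Ideal.mem_map_of_mem θ hzp) m
    rwa [hm] at this
  have hPz : θ (MvPolynomial.eval y P) =
      θ z ^ r * θ (MvPolynomial.eval (fun i => κ (c i)) P) := by
    have h1 : ∀ v : Fin 2 → D, θ (MvPolynomial.eval v P) =
        MvPolynomial.eval (fun i => θ (v i)) (MvPolynomial.map θ.toRingHom P) := by
      intro v
      rw [MvPolynomial.eval_map]
      exact MvPolynomial.hom_eval₂ _ _ _ _
    rw [h1, h1, ← (hP.map _).eval_mul_const]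
    congr 2
    ext i
    fin_cases i
    · exact hθy0
    · exact hθy1
  set w := MvPolynomial.eval (fun i => κ (c i)) P with hw
  have hεw : F.ε w ≠ 0 := by
    have : F.ε w = MvPolynomial.eval c (MvPolynomial.map F.ε.toRingHom P) := by
      rw [MvPolynomial.eval_map, hw]
      refine (MvPolynomial.hom_eval₂ _ _ F.ε.toRingHom _).trans ?_
      congr 1
      ext i
      exact F.ε.commutes _
    rwa [this]
  have hwu : IsUnit (θ w) := by
    obtain ⟨b, hb⟩ := hdec (w - algebraMap k D (F.ε w)) (by simp)
    rw [map_sub θ, AlgHom.commutes, sub_eq_iff_eq_add] at hb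
    rw [hb, add_comm]
    refine IsNilpotent.isUnit_add_left_of_commute ?_ ((IsUnit.mk0 _ hεw).map (algebraMap k _))
      (Commute.all _ _)
    exact ⟨m, by rw [mul_pow, hm, zero_mul]⟩
  have hθf₂ : ∃ b, θ f₂ = θ z ^ (r + 1) * b := by
    have h1 := Ideal.mem_map_of_mem θ hf₂
    rw [Ideal.map_pow] at h1
    have h2 := Ideal.pow_right_mono hz1 (r + 1) h1
    rw [Ideal.span_singleton_pow] at h2
    obtain ⟨b, hb⟩ := Ideal.mem_span_singleton.1 h2
    exact ⟨b, hb⟩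
  -- Modulo `l` the relation `f` reads z^r·(w + z·b) = 0, where `w` is a unit by the choice of `c`
  -- and `z` is nilpotent.
  have hzr : θ z ^ r = 0 := by
    obtain ⟨b, hb⟩ := hθf₂
    have h1 : θ z ^ r * (θ w + θ z * b) = 0 := by
      have h2 : θ (MvPolynomial.eval y P + f₂) = 0 := by
        rw [hf₁₂]
        change Ideal.Quotient.mkₐ k _ (g f) = 0
        rw [(RingHom.mem_ker).1 hf, map_zero]
      rw [map_add, hPz, hb] at h2
      rw [← h2]; ring
    have hu : IsUnit (θ w + θ z * b) :=
      IsNilpotent.isUnit_add_left_of_commute ⟨m, by rw [mul_pow, hm, zero_mul]⟩ hwu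
        (Commute.all _ _)
    exact (hu.mul_left_eq_zero).1 h1
  refine finrank_le_of_pow_eq_zero (z := θ z) (fun b => ?_) hzr
  obtain ⟨d, rfl⟩ := hθ b
  obtain ⟨b, hb⟩ := hdec (d - algebraMap k D (F.ε d)) (by simp)
  exact ⟨F.ε d, b, by rw [← hb, map_sub θ, AlgHom.commutes]; ring⟩

end

/-! ### The socle bound on a surface, and the staircase examples. -/

noncomputable section

/-- Completing the square: r(r+1) ≤ 2n is equivalent to (2r+1)² ≤ 1 + 8n. -/
theorem le_floor_of_mul_le {r n : ℕ} (h : r * (r + 1) / 2 ≤ n) :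
    r ≤ ⌊(Real.sqrt (1 + 8 * (n : ℝ)) - 1) / 2⌋₊ := by
  apply Nat.le_floor
  have h2 : r * (r + 1) ≤ 2 * n := by
    have := Nat.div_mul_cancel (Nat.even_mul_succ_self r).two_dvd
    omega
  have h3 : (r : ℝ) * (r + 1) ≤ 2 * n := by exact_mod_cast h2
  have h4 : 2 * (r : ℝ) + 1 ≤ Real.sqrt (1 + 8 * n) := by
    apply Real.le_sqrt_of_sq_le
    nlinarith
  linarith

theorem floor_mul_le (n : ℕ) : ⌊(Real.sqrt (1 + 8 * (n : ℝ)) - 1) / 2⌋₊ *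
    (⌊(Real.sqrt (1 + 8 * (n : ℝ)) - 1) / 2⌋₊ + 1) / 2 ≤ n := by
  set b := ⌊(Real.sqrt (1 + 8 * (n : ℝ)) - 1) / 2⌋₊ with hb
  have h1 : 1 ≤ Real.sqrt (1 + 8 * n) := by
    rw [Real.one_le_sqrt]
    have : (0 : ℝ) ≤ n := n.cast_nonneg
    linarith
  have h2 : (b : ℝ) ≤ (Real.sqrt (1 + 8 * n) - 1) / 2 := Nat.floor_le (by linarith)
  have h3 : (2 * (b : ℝ) + 1) ^ 2 ≤ 1 + 8 * n := by
    refine (pow_le_pow_left₀ (by positivity) (show _ ≤ Real.sqrt (1 + 8 * n) by linarith) 2).trans ?_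
    rw [Real.sq_sqrt (by positivity)]
  have h4 : (b : ℝ) * (b + 1) ≤ 2 * n := by nlinarith
  have h5 : b * (b + 1) ≤ 2 * n := by exact_mod_cast h4
  omega

variable {k : Type u} [Field k]

theorem fromSpecStalk_comp {ξ : Scheme.{u}} (s : ξ ⟶ Spec (.of k)) (p : ξ) :
    ξ.fromSpecStalk p ≫ s = Spec.map (((Scheme.ΓSpecIso (.of k)).inv ≫ s.appTop) ≫
      ξ.presheaf.germ ⊤ p trivial) := by
  rw [Spec.map_comp, Spec.map_comp, ← Scheme.fromSpecStalk_toSpecΓ, Category.assoc,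
    ← Scheme.toSpecΓ_naturality_assoc, toSpecΓ_SpecMap_ΓSpecIso_inv, Category.comp_id]

/-- Localizations of Artinian rings are quotients. -/
theorem germ_surjective {ξ : Scheme.{u}} [IsAffine ξ] [IsArtinianRing Γ(ξ, ⊤)] (p : ξ) :
    Function.Surjective (ξ.presheaf.germ ⊤ p trivial) := by
  let _ : Algebra Γ(ξ, ⊤) (ξ.presheaf.stalk p) := (ξ.presheaf.germ ⊤ p trivial).hom.toAlgebra
  have := (isAffineOpen_top ξ).isLocalization_stalk ⟨p, trivial⟩
  exact IsArtinianRing.localization_surjective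
    ((isAffineOpen_top ξ).primeIdealOf ⟨p, trivial⟩).asIdeal.primeCompl (ξ.presheaf.stalk p)

/-- The bound on the dimension of the socle of a finite closed subscheme of a smooth surface. -/
theorem socleDimAt_le [IsAlgClosed k] {X : Scheme.{u}}
    (f : X ⟶ Spec (.of k)) [SmoothOfRelativeDimension 2 f] {n : ℕ} (hn : 1 ≤ n) {ξ : Scheme.{u}}
    (i : ξ ⟶ X) (hi : IsClosedSubschemeOfLength f n i) (p : ξ) :
    socleDimAt i p ≤ (⌊(Real.sqrt (1 + 8 * (n : ℝ)) - 1) / 2⌋₊ : ℕ∞) := by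
  obtain ⟨hcl, hfin, hlen⟩ := hi
  let C := Γ(ξ, ⊤)
  let A := ξ.presheaf.stalk p
  let _ : Algebra k C := ((Scheme.ΓSpecIso (.of k)).inv ≫ (i ≫ f).appTop).hom.toAlgebra
  let _ : Algebra k A := (((Scheme.ΓSpecIso (.of k)).inv ≫ (i ≫ f).appTop) ≫
      ξ.presheaf.germ ⊤ p trivial).hom.toAlgebra
  have hlen : Module.finrank k C = n := hlen
  -- `Module.finrank` takes the default value 0 on infinite-dimensional spaces, so a positive value
  -- gives finiteness.
  have : Module.Finite k C := Module.finite_of_finrank_pos (by omega)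
  have : IsAffine ξ := isAffine_of_isAffineHom (i ≫ f)
  have hC : IsArtinianRing C := IsArtinianRing.of_finite k C
  let π : C →ₐ[k] A := { (ξ.presheaf.germ ⊤ p trivial).hom with commutes' := fun _ => rfl }
  have hπ : Function.Surjective π := germ_surjective p
  have : Module.Finite k A := .of_surjective π.toLinearMap hπ
  have hAn : Module.finrank k A ≤ n :=
    hlen ▸ LinearMap.finrank_le_finrank_of_surjective (f := π.toLinearMap) hπ
  obtain ⟨ε, -, hε⟩ := exists_augmentation k A
  let q : Spec (.of A) ⟶ X := ξ.fromSpecStalk p ≫ i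
  have hq : q ≫ f = Spec.map (CommRingCat.ofHom (algebraMap k A)) := by
    rw [Category.assoc, fromSpecStalk_comp]
    rfl
  obtain ⟨D, _, _, j, g, hj, hjf, hD, hgq⟩ := exists_chart_factorization f 2 q hq
  have hqcl : IsClosedImmersion (Spec.map (CommRingCat.ofHom g.toRingHom) ≫ j) := by
    rw [hgq]
    have : IsClosedImmersion (ξ.fromSpecStalk p) := by
      rw [← (isAffineOpen_top ξ).fromSpecStalk_eq_fromSpecStalk (x := p) trivial]
      change IsClosedImmersion (Spec.map _ ≫ (isAffineOpen_top ξ).fromSpec)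
      rw [IsAffineOpen.fromSpec_top]
      have : IsClosedImmersion (Spec.map (ξ.presheaf.germ ⊤ p trivial)) :=
        isClosedImmersion_SpecMap_iff.2 hπ
      infer_instance
    dsimp only [q]
    infer_instance
  have hg : Function.Surjective g :=
    isClosedImmersion_SpecMap_iff.1
      (IsClosedImmersion.of_comp (Spec.map (CommRingCat.ofHom g.toRingHom)) j)
  obtain ⟨F, hF⟩ := exists_pointFrame (D := D) 2 (ε.comp g)
  have : Algebra.IsStandardSmooth k D :=
    Algebra.IsStandardSmoothOfRelativeDimension.isStandardSmooth 2
  obtain ⟨r, hr, hsr⟩ := exists_finrank_augSocle_le g hg ε hε F hF (.of_formallySmooth k D 2)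
  rw [socleDimAt, socleDim_eq_finrank _ (i.stalkMap_surjective p) ε]
  exact_mod_cast hsr.trans (le_floor_of_mul_le (hr.trans hAn))

/-- The exponents of the monomials under the staircase of `b` steps with the first step raised
by `e`. -/
def staircase (b e : ℕ) : Finset (Fin 2 →₀ ℕ) :=
  TruncAlg.degLT 2 b ∪ (Finset.Ico b (b + e)).image (Finsupp.single 1)

theorem mem_staircase {b e : ℕ} {s : Fin 2 →₀ ℕ} :
    s ∈ staircase b e ↔ s 0 + s 1 < b ∨ s 0 = 0 ∧ b ≤ s 1 ∧ s 1 < b + e := by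
  rw [staircase, Finset.mem_union, TruncAlg.mem_degLT, Finsupp.degree_eq_sum, Fin.sum_univ_two,
    Finset.mem_image]
  refine or_congr_right ⟨?_, fun ⟨h0, h1⟩ => ⟨s 1, Finset.mem_Ico.2 h1, ?_⟩⟩
  · rintro ⟨j, hj, rfl⟩
    simpa using hj
  · ext i
    fin_cases i <;> simp [h0]

theorem isLowerSet_staircase (b e : ℕ) : IsLowerSet (staircase b e : Set (Fin 2 →₀ ℕ)) := by
  intro s t hts hs
  rw [Finset.mem_coe, mem_staircase] at *
  have h0 := hts 0
  have h1 := hts 1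
  omega

theorem card_staircase (b e : ℕ) : (staircase b e).card = b * (b + 1) / 2 + e := by
  rw [staircase, Finset.card_union_of_disjoint, TruncAlg.card_degLT_two,
    Finset.card_image_of_injective _ (Finsupp.single_injective 1), Nat.card_Ico]
  · omega
  · rw [Finset.disjoint_left]
    rintro s hs hs'
    obtain ⟨j, hj, rfl⟩ := Finset.mem_image.1 hs'
    rw [TruncAlg.mem_degLT, Finsupp.degree_single] at hs
    have := (Finset.mem_Ico.1 hj).1
    omega

theorem TruncAlg.mono_mem_augSocle {σ : Type*} {S : Finset (σ →₀ ℕ)} (h0 : 0 ∈ S) {s : σ →₀ ℕ}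
    (hs : ∀ i, s + .single i 1 ∉ S) : mono k S s ∈ augSocle (aug (k := k) h0) := by
  intro a ha
  have h1 : a ∈ Ideal.span (Set.range fun i => mono k S (.single i 1)) := by
    rw [← ker_aug h0]; exact ha
  clear ha
  induction h1 using Submodule.span_induction with
  | mem x hx =>
    obtain ⟨i, rfl⟩ := hx
    rw [← mono_add, mono_eq_zero]
    rw [add_comm]; exact hs i
  | zero => exact zero_mul _
  | add x y _ _ hx hy => rw [add_mul, hx, hy, add_zero]
  | smul c x _ hx => rw [smul_eq_mul, mul_assoc, hx, mul_zero]

/-- The socle of the staircase algebra has one element in each of the `b` corners. -/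
theorem le_finrank_augSocle_staircase {b e : ℕ} (h0 : 0 ∈ staircase b e) :
    b ≤ Module.finrank k (augSocle (TruncAlg.aug (k := k) h0)) := by
  -- The corners are the exponents (j, b - 1 - j) on the last antidiagonal, except that the one for
  -- j = 0 sits at the top of the column lengthened by `e`.
  let s (j : Fin b) : Fin 2 →₀ ℕ := Finsupp.single 0 (j : ℕ) +
    Finsupp.single 1 (if (j : ℕ) = 0 then b + e - 1 else b - 1 - j)
  have hs0 (j) : s j 0 = j := by simp [s]
  have hs1 (j) : s j 1 = if (j : ℕ) = 0 then b + e - 1 else b - 1 - j := by simp [s]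
  have hs (j) : s j ∈ staircase b e := by
    rw [mem_staircase, hs0, hs1]
    have := j.2
    split_ifs <;> omega
  have hs' (j i) : s j + .single i 1 ∉ staircase b e := by
    rw [mem_staircase, Finsupp.add_apply (s j), Finsupp.add_apply (s j), hs0, hs1]
    have := j.2
    fin_cases i <;> simp <;> split_ifs <;> omega
  let v (j : Fin b) : augSocle (TruncAlg.aug (k := k) h0) :=
    ⟨TruncAlg.mono k _ (s j), TruncAlg.mono_mem_augSocle h0 (hs' j)⟩
  have hS := isLowerSet_staircase b e
  have hv : LinearIndependent k v := by
    refine LinearIndependent.of_comp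
      ((augSocle (TruncAlg.aug (k := k) h0)).subtype.restrictScalars k) ?_
    refine (TruncAlg.mono_linearIndependent hS).comp (fun j => ⟨s j, hs j⟩) fun i j hij => ?_
    have h1 := congr(($hij : Fin 2 →₀ ℕ) 0)
    simp only [hs0] at h1
    exact Fin.ext h1
  have := TruncAlg.finite (k := k) hS
  have h := hv.fintype_card_le_finrank
  rwa [Fintype.card_fin] at h

theorem finrank_Γ_Spec {T : Type u} [CommRing T] [Algebra k T] {s : Spec (.of T) ⟶ Spec (.of k)}
    (hs : s = specHom k T) :
    letI : Algebra k Γ(Spec (.of T), ⊤) :=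
      ((Scheme.ΓSpecIso (.of k)).inv ≫ s.appTop).hom.toAlgebra
    Module.finrank k Γ(Spec (.of T), ⊤) = Module.finrank k T := by
  subst hs
  let _ : Algebra k Γ(Spec (.of T), ⊤) :=
      ((Scheme.ΓSpecIso (.of k)).inv ≫ (specHom k T).appTop).hom.toAlgebra
  let e : T ≃+* Γ(Spec (.of T), ⊤) := (Scheme.ΓSpecIso (.of T)).symm.commRingCatIsoToRingEquiv
  have he : ∀ c : k, e (algebraMap k T c) = algebraMap k Γ(Spec (.of T), ⊤) c := fun c =>
    congr($(Scheme.ΓSpecIso_inv_naturality (CommRingCat.ofHom (algebraMap k T))) c)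
  exact (AlgEquiv.ofRingEquiv he).toLinearEquiv.finrank_eq.symm

theorem exists_algHom_of_finiteType (k D : Type*) [Field k] [IsAlgClosed k] [CommRing D]
    [Nontrivial D] [Algebra k D] [Algebra.FiniteType k D] : Nonempty (D →ₐ[k] k) := by
  obtain ⟨m, hm⟩ := Ideal.exists_maximal D
  let _ : Field (D ⧸ m) := Ideal.Quotient.field m
  have : Module.Finite k (D ⧸ m) := finite_of_finite_type_of_isJacobsonRing k (D ⧸ m)
  have hb : Function.Bijective (algebraMap k (D ⧸ m)) :=
    IsAlgClosed.algebraMap_bijective_of_isIntegral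
  exact ⟨((AlgEquiv.ofBijective (Algebra.ofId k (D ⧸ m)) hb).symm : D ⧸ m →ₐ[k] k).comp
    (Ideal.Quotient.mkₐ k m)⟩

/-- The staircase algebra is a quotient of the coordinate ring of any smooth chart, by
`exists_surjective_truncAlg` at a rational point given by the Nullstellensatz. -/
theorem exists_le_socleDimAt [IsAlgClosed k] {X : Scheme.{u}} [Nonempty X]
    (f : X ⟶ Spec (.of k)) [SmoothOfRelativeDimension 2 f] [IsSeparated f] {b e : ℕ} (hb : 1 ≤ b) :
    ∃ (ξ : Scheme.{u}) (i : ξ ⟶ X), IsClosedSubschemeOfLength f (b * (b + 1) / 2 + e) i ∧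
      ∃ p : ξ, (b : ℕ∞) ≤ socleDimAt i p := by
  obtain ⟨x⟩ := ‹Nonempty X›
  obtain ⟨D, _, _, j, hj, ⟨y, -⟩, hjf, hD⟩ := exists_smooth_chart f 2 x
  have : Nontrivial D := y.nontrivial
  have : Algebra.IsStandardSmooth k D :=
    Algebra.IsStandardSmoothOfRelativeDimension.isStandardSmooth 2
  obtain ⟨ε⟩ := exists_algHom_of_finiteType k D
  obtain ⟨F, hF⟩ := exists_pointFrame (D := D) 2 ε
  have hS := isLowerSet_staircase b e
  have h0 : 0 ∈ staircase b e := mem_staircase.2 (.inl (by simpa using Nat.lt_of_lt_of_le one_pos hb))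
  obtain ⟨φ, hφ, -⟩ := exists_surjective_truncAlg (.of_formallySmooth k D 2) F.ε F.δ F.leibniz
    F.surjective _ hS h0
  let T := TruncAlg k (staircase b e)
  have hloc : IsLocalRing T := TruncAlg.isLocalRing h0
  have hfin : Module.Finite k T := TruncAlg.finite hS
  let s : Spec (.of T) ⟶ Spec (.of D) := Spec.map (CommRingCat.ofHom φ.toRingHom)
  have hscl : IsClosedImmersion s := isClosedImmersion_SpecMap_iff.2 hφ
  have hsf : (s ≫ j) ≫ f = specHom k T := by
    rw [Category.assoc, hjf, ← Spec.map_comp, ← CommRingCat.ofHom_comp]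
    exact congr(Spec.map (CommRingCat.ofHom $(φ.comp_algebraMap)))
  have hsfin : IsFinite ((s ≫ j) ≫ f) := by
    rw [hsf]
    exact (IsFinite.SpecMap_iff _).2 (RingHom.finite_algebraMap.2 hfin)
  -- A closed subscheme of a chart need not be closed in `X`; here it is, being finite over `k` with
  -- `X` separated.
  have hsj : IsClosedImmersion (s ≫ j) :=
    (IsClosedImmersion.iff_isFinite_and_mono _).2 ⟨.of_comp _ f, inferInstance⟩
  refine ⟨Spec (.of T), s ≫ j, ⟨hsj, hsfin, ?_⟩, IsLocalRing.closedPoint T, ?_⟩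
  · refine (finrank_Γ_Spec hsf).trans ?_
    rw [TruncAlg.finrank hS, card_staircase]
  · let A := (Spec (.of T)).presheaf.stalk (IsLocalRing.closedPoint T)
    let e₀ : T ≃+* A := (stalkClosedPointIso (.of T)).symm.commRingCatIsoToRingEquiv
    let _ : Algebra k A := (e₀.toRingHom.comp (algebraMap k T)).toAlgebra
    let e' : T ≃ₐ[k] A := AlgEquiv.ofRingEquiv (f := e₀) fun _ => rfl
    have : Module.Finite k A := .equiv e'.toLinearEquiv
    let ε' : A →ₐ[k] k := (TruncAlg.aug h0).comp e'.symm.toAlgHom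
    refine le_of_le_of_eq ?_
      (socleDim_eq_finrank _ ((s ≫ j).stalkMap_surjective (IsLocalRing.closedPoint T)) ε').symm
    norm_cast
    refine (le_finrank_augSocle_staircase (k := k) h0).trans ?_
    have hmem : ∀ a : T, a ∈ augSocle (TruncAlg.aug (k := k) h0) → e' a ∈ augSocle ε' := by
      intro a ha c hc
      obtain ⟨c, rfl⟩ := e'.surjective c
      rw [← map_mul, ha c (by simpa [ε'] using hc), map_zero]
    exact LinearMap.finrank_le_finrank_of_injective
      (f := (e'.toLinearEquiv.toLinearMap.restrict
        (p := (augSocle (TruncAlg.aug (k := k) h0)).restrictScalars k)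
        (q := (augSocle ε').restrictScalars k) hmem))
      (fun a b hab => Subtype.ext (e'.injective (congrArg Subtype.val hab)))

end

/-! ### Counting monomials: eventually polynomial functions. -/

noncomputable section

open TruncAlg Filter

/-- A sequence of natural numbers given by a polynomial from some point on. -/
def IsEventuallyPolynomial (h : ℕ → ℕ) : Prop :=
  ∃ P : Polynomial ℝ, ∀ᶠ t in atTop, (h t : ℝ) = P.eval (t : ℝ)

theorem IsEventuallyPolynomial.of_add_eq {a b c d : ℕ → ℕ} (ha : IsEventuallyPolynomial a)
    (hb : IsEventuallyPolynomial b) (hc : IsEventuallyPolynomial c)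
    (h : ∀ t, a t + b t = c t + d t) : IsEventuallyPolynomial d := by
  obtain ⟨P, hP⟩ := ha
  obtain ⟨Q, hQ⟩ := hb
  obtain ⟨R, hR⟩ := hc
  refine ⟨P + Q - R, ?_⟩
  filter_upwards [hP, hQ, hR] with t h1 h2 h3
  have := congr((↑($(h t)) : ℝ))
  push_cast at this
  rw [Polynomial.eval_sub, Polynomial.eval_add, ← h1, ← h2, ← h3, this, add_sub_cancel_left]

theorem IsEventuallyPolynomial.zero : IsEventuallyPolynomial fun _ => 0 :=
  ⟨0, by simp⟩

theorem isEventuallyPolynomial_card_degLT_sub (N c : ℕ) :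
    IsEventuallyPolynomial fun t => (degLT N (t - c)).card := by
  refine ⟨Polynomial.C ((N.factorial : ℝ)⁻¹) * (descPochhammer ℝ N).comp
    (Polynomial.X + Polynomial.C ((N : ℝ) - 1 - c)), ?_⟩
  -- Below this range `t - c` is truncated to 0 and the polynomial need not give the count.
  filter_upwards [eventually_ge_atTop (c + 1)] with t ht
  obtain ⟨r, rfl⟩ := Nat.exists_eq_add_of_le ht
  have : c + 1 + r - c = r + 1 := by omega
  rw [this, card_degLT_succ, Nat.cast_choose_eq_descPochhammer_div ℝ, div_eq_inv_mul]
  simp only [Polynomial.eval_mul, Polynomial.eval_C, Polynomial.eval_comp, Polynomial.eval_add,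
    Polynomial.eval_X]
  congr 2
  push_cast; ring

theorem card_filter_le_degLT {N : ℕ} (g : Fin N →₀ ℕ) (t : ℕ) :
    ((degLT N t).filter (g ≤ ·)).card = (degLT N (t - g.degree)).card := by
  symm
  refine Finset.card_bij (fun s _ => g + s) (fun s hs => ?_) (fun a _ b _ h => add_left_cancel h)
    fun s hs => ?_
  · rw [mem_degLT] at hs
    rw [Finset.mem_filter, mem_degLT, map_add]
    exact ⟨by omega, le_self_add⟩
  · rw [Finset.mem_filter, mem_degLT] at hs
    obtain ⟨r, rfl⟩ := exists_add_of_le hs.2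
    refine ⟨r, ?_, rfl⟩
    rw [mem_degLT]
    have := hs.1
    rw [map_add] at this
    omega

-- Inclusion–exclusion on the generators: exponents above both `g` and `g'` are those above `g ⊔
-- g'`. The intersection is thus governed by at most `G.card` generators, so the induction is on the
-- number of generators and not on the set.
open Classical in
theorem isEventuallyPolynomial_card_filter_exists_le {N : ℕ} (G : Finset (Fin N →₀ ℕ)) :
    IsEventuallyPolynomial fun t => ((degLT N t).filter fun s => ∃ g ∈ G, g ≤ s).card := by
  induction hn : G.card using Nat.strong_induction_on generalizing G with
  | _ n ih =>
    induction G using Finset.induction_on with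
    | empty => simpa using IsEventuallyPolynomial.zero
    | insert g G hg _ =>
      rw [Finset.card_insert_of_notMem hg] at hn
      have h1 := ih G.card (by omega) G rfl
      have h2 := ih _ (by have := Finset.card_image_le (s := G) (f := (g ⊔ ·)); omega)
        (G.image (g ⊔ ·)) rfl
      have h3 := isEventuallyPolynomial_card_degLT_sub N g.degree
      refine h3.of_add_eq h1 h2 fun t => ?_
      rw [← card_filter_le_degLT, ← Finset.card_union_add_card_inter, add_comm]
      congr 2
      · ext s
        simp only [Finset.mem_inter, Finset.mem_filter, Finset.mem_image]
        constructor
        · rintro ⟨⟨hs, h⟩, -, g', hg', h'⟩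
          exact ⟨hs, _, ⟨g', hg', rfl⟩, sup_le h h'⟩
        · rintro ⟨hs, _, ⟨g', hg', rfl⟩, h'⟩
          exact ⟨⟨hs, le_sup_left.trans h'⟩, hs, g', hg', le_sup_right.trans h'⟩
      · ext s
        simp only [Finset.mem_union, Finset.mem_filter, Finset.mem_insert, exists_eq_or_imp]
        tauto

-- Dickson's lemma: the minimal elements form an antichain in a well-quasi-order, hence a finite
-- set.
open Classical in
theorem IsUpperSet.exists_finset_mem_iff {N : ℕ} {U : Set (Fin N →₀ ℕ)} (hU : IsUpperSet U) :
    ∃ G : Finset (Fin N →₀ ℕ), ∀ s, s ∈ U ↔ ∃ g ∈ G, g ≤ s := by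
  have hfin : {s | Minimal (· ∈ U) s}.Finite :=
    (setOfPred_minimal_antichain _).finite_of_partiallyWellOrderedOn
      (Set.isPWO_of_wellQuasiOrderedLE _)
  refine ⟨hfin.toFinset, fun s => ⟨fun hs => ?_, ?_⟩⟩
  · obtain ⟨g, hg, hmin⟩ := exists_minimal_le_of_wellFoundedLT (· ∈ U) s hs
    exact ⟨g, by simpa using hmin, hg⟩
  · rintro ⟨g, hg, h⟩
    have : Minimal (· ∈ U) g := by simpa using hg
    exact hU h this.prop

open Classical in
theorem IsLowerSet.isEventuallyPolynomial_card {N : ℕ} {L : Set (Fin N →₀ ℕ)}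
    (hL : IsLowerSet L) :
    IsEventuallyPolynomial fun t => ((degLT N t).filter (· ∈ L)).card := by
  obtain ⟨G, hG⟩ := hL.compl.exists_finset_mem_iff
  refine (isEventuallyPolynomial_card_degLT_sub N 0).of_add_eq .zero
    (isEventuallyPolynomial_card_filter_exists_le G) fun t => ?_
  simp only [← hG, Set.mem_compl_iff]
  rw [add_comm ((Finset.filter _ _).card), Finset.card_filter_add_card_filter_not]
  simp

/-- If `0 ≤ h ≤ n * #{|s| < t}` in `N ≤ d` variables and `h` is eventually polynomial, then
`d! h(t) / t ^ d` converges to a limit that is at most `n`. -/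
theorem IsEventuallyPolynomial.exists_tendsto {h : ℕ → ℕ} (hh : IsEventuallyPolynomial h)
    {n N d : ℕ} (hN : N ≤ d) (hle : ∀ t, h t ≤ n * (degLT N t).card) :
    ∃ μ : ℝ, Tendsto (fun t : ℕ => (d.factorial : ℝ) * (h t : ℝ) / (t : ℝ) ^ d) atTop (nhds μ) ∧
      μ ≤ n := by
  -- The binomial coefficient only grows when `N` is replaced by `d`, and d! times it is at most (t
  -- + d)^d.
  have hle' : ∀ᶠ t : ℕ in atTop, (d.factorial : ℝ) * (h t : ℝ) / (t : ℝ) ^ d ≤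
      n * ((1 + (d : ℝ) / t) ^ d) := by
    filter_upwards [eventually_ge_atTop 1] with t ht
    have h1 : (d.factorial) * h t ≤ n * (t + d) ^ d := by
      obtain ⟨r, rfl⟩ := Nat.exists_eq_add_of_le' ht
      have h2 : (r + N).choose N ≤ (r + d).choose d := by
        rw [← Nat.choose_symm_add, ← Nat.choose_symm_add]
        exact Nat.choose_le_choose _ (by omega)
      calc d.factorial * h (r + 1) ≤ d.factorial * (n * (r + d).choose d) := by
            gcongr
            refine (hle _).trans ?_
            rw [card_degLT_succ]; gcongr
        _ = n * (r + d).descFactorial d := by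
            rw [Nat.descFactorial_eq_factorial_mul_choose]; ring
        _ ≤ n * (r + 1 + d) ^ d := by
            gcongr
            exact (Nat.descFactorial_le_pow _ _).trans (by gcongr; omega)
    have ht' : (0 : ℝ) < t := by exact_mod_cast ht
    rw [div_le_iff₀ (by positivity), mul_assoc, ← mul_pow]
    have h3 : (1 + (d : ℝ) / t) * t = t + d := by field_simp
    rw [h3]
    exact_mod_cast h1
  have hlim : Tendsto (fun t : ℕ => (n : ℝ) * ((1 + (d : ℝ) / t) ^ d)) atTop (nhds n) := by
    have := ((tendsto_const_div_atTop_nhds_zero_nat (d : ℝ)).const_add 1).pow d |>.const_mul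
      (n : ℝ)
    simpa using this
  obtain ⟨P, hP⟩ := hh
  have hdegX : (Polynomial.X ^ d : Polynomial ℝ).degree = d := Polynomial.degree_X_pow d
  have hX0 : (Polynomial.X ^ d : Polynomial ℝ) ≠ 0 := pow_ne_zero _ Polynomial.X_ne_zero
  suffices H : ∃ μ : ℝ, Tendsto (fun x : ℝ => P.eval x / (Polynomial.X ^ d : Polynomial ℝ).eval x)
      atTop (nhds μ) by
    obtain ⟨μ, hμ⟩ := H
    have hT : Tendsto (fun t : ℕ => (d.factorial : ℝ) * (h t : ℝ) / (t : ℝ) ^ d) atTop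
        (nhds (d.factorial * μ)) := by
      refine ((hμ.comp tendsto_natCast_atTop_atTop).const_mul (d.factorial : ℝ)).congr' ?_
      filter_upwards [hP] with t ht
      simp [ht, mul_div_assoc]
    exact ⟨_, hT, le_of_tendsto_of_tendsto hT hlim hle'⟩
  rcases lt_trichotomy P.degree (Polynomial.X ^ d : Polynomial ℝ).degree with hlt | heq | hgt
  · exact ⟨0, P.div_tendsto_atTop_zero_of_degree_lt _ hlt⟩
  · exact ⟨_, P.div_tendsto_atTop_leadingCoeff_div_of_degree_eq _ heq⟩
  -- A polynomial of degree greater than `d` would make the ratio unbounded, against the bound.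
  · exfalso
    have h1 := (P.abs_div_tendsto_atTop_atTop_of_degree_gt _ hgt hX0).comp
      (tendsto_natCast_atTop_atTop (R := ℝ))
    have h2 : ∀ᶠ t : ℕ in atTop, n * ((1 + (d : ℝ) / t) ^ d) < n + 1 :=
      hlim.eventually_lt_const (by linarith)
    obtain ⟨t, h3, h4, h5, h6⟩ := ((h1.eventually_ge_atTop ((n : ℝ) + 1)).and
      (hle'.and (h2.and hP))).exists
    simp only [Function.comp, Polynomial.eval_pow, Polynomial.eval_X, ← h6] at h3
    have h7 : (0 : ℝ) ≤ h t / (t : ℝ) ^ d := by positivity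
    rw [abs_of_nonneg h7] at h3
    rw [mul_div_assoc] at h4
    have h8 : (1 : ℝ) ≤ d.factorial := by exact_mod_cast d.factorial_pos
    nlinarith

end

/-! ### Hilbert–Samuel functions through standard monomials. -/

noncomputable section

open TruncAlg Filter

section

variable {k B : Type*} [Field k] [CommRing B] [Algebra k B] {N : ℕ}

/-- The monomial with exponents `s` in the elements `y`. -/
def monomialEval (y : Fin N → B) (s : Fin N →₀ ℕ) : B := ∏ i, y i ^ s i

theorem monomialEval_add (y : Fin N → B) (s t : Fin N →₀ ℕ) :
    monomialEval y (s + t) = monomialEval y s * monomialEval y t := by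
  simp [monomialEval, pow_add, Finset.prod_mul_distrib]

theorem monomialEval_mem_pow {y : Fin N → B} {Q : Ideal B} (hy : ∀ i, y i ∈ Q)
    (s : Fin N →₀ ℕ) : monomialEval y s ∈ Q ^ s.degree := by
  rw [Finsupp.degree_eq_sum, ← Finset.prod_pow_eq_pow_sum]
  exact Ideal.prod_mem_prod fun i _ => Ideal.pow_mem_pow (hy i) _

/-- If `Q` is generated by `y` up to `Q ^ 2` and `B = span v + Q`, then `Q ^ r` is spanned by the
`v j * y ^ s` with `|s| = r` up to `Q ^ (r + 1)`. -/
theorem Ideal.pow_le_span_sup_pow_succ {ι : Type*} {y : Fin N → B} {Q : Ideal B}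
    (hy : ∀ i, y i ∈ Q) (hQ : Q ≤ Ideal.span (Set.range y) ⊔ Q ^ 2) {v : ι → B}
    (hv : Submodule.span k (Set.range v) ⊔ Q.restrictScalars k = ⊤) (r : ℕ) :
    (Q ^ r).restrictScalars k ≤
      Submodule.span k {b | ∃ j s, s.degree = r ∧ b = v j * monomialEval y s} ⊔
        (Q ^ (r + 1)).restrictScalars k := by
  intro b hb
  have hJ : Ideal.span (Set.range y) ≤ Q := Ideal.span_le.2 (by rintro _ ⟨i, rfl⟩; exact hy i)
  obtain ⟨b₁, hb₁, b₂, hb₂, rfl⟩ := Submodule.mem_sup.1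
    (Ideal.pow_le_pow_sup_pow_succ hJ hQ r hb)
  refine add_mem ?_ (Submodule.mem_sup_right hb₂)
  obtain ⟨P, hP, rfl⟩ := (Ideal.mem_span_pow_iff_exists_isHomogeneous _ _).1 hb₁
  rw [MvPolynomial.eval_eq']
  refine _root_.sum_mem fun s hs => ?_
  have hs' : s.degree = r := by
    by_contra hne
    exact MvPolynomial.mem_support_iff.1 hs (hP.coeff_eq_zero hne)
  obtain ⟨c, hc, q, hq, hcq⟩ := Submodule.mem_sup.1
    (show P.coeff s ∈ Submodule.span k (Set.range v) ⊔ Q.restrictScalars k from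
      hv ▸ Submodule.mem_top)
  rw [← hcq, add_mul]
  clear hcq
  refine add_mem (Submodule.mem_sup_left ?_) (Submodule.mem_sup_right ?_)
  · change c * monomialEval y s ∈ _
    induction hc using Submodule.span_induction with
    | mem x hx => obtain ⟨j, rfl⟩ := hx; exact Submodule.subset_span ⟨j, s, hs', rfl⟩
    | zero => rw [zero_mul]; exact zero_mem _
    | add a b _ _ ha hb => rw [add_mul]; exact add_mem ha hb
    | smul a b _ hb => rw [smul_mul_assoc]; exact Submodule.smul_mem _ _ hb
  · change q * monomialEval y s ∈ Q ^ (r + 1)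
    rw [pow_succ', ← hs']
    exact Ideal.mul_mem_mul hq (monomialEval_mem_pow hy s)

theorem Ideal.pow_le_span_sup_pow {ι : Type*} {y : Fin N → B} {Q : Ideal B}
    (hy : ∀ i, y i ∈ Q) (hQ : Q ≤ Ideal.span (Set.range y) ⊔ Q ^ 2) {v : ι → B}
    (hv : Submodule.span k (Set.range v) ⊔ Q.restrictScalars k = ⊤) (r t : ℕ) :
    (Q ^ r).restrictScalars k ≤
      Submodule.span k {b | ∃ j s, r ≤ s.degree ∧ s.degree < t ∧ b = v j * monomialEval y s} ⊔
        (Q ^ t).restrictScalars k := by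
  induction t with
  | zero => simp
  | succ t ih =>
    rcases lt_or_ge t r with h | h
    · exact le_sup_of_le_right (Ideal.pow_le_pow_right h)
    · refine ih.trans (sup_le (le_sup_of_le_left (Submodule.span_mono ?_))
        ((Ideal.pow_le_span_sup_pow_succ hy hQ hv t).trans
          (sup_le_sup_right (Submodule.span_mono ?_) _)))
      · rintro b ⟨j, s, h1, h2, rfl⟩
        exact ⟨j, s, h1, h2.trans (Nat.lt_succ_self t), rfl⟩
      · rintro b ⟨j, s, h1, rfl⟩
        exact ⟨j, s, h1 ▸ h, h1 ▸ Nat.lt_succ_self t, rfl⟩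

/-- The upper bound used twice: for the rank-n family, and for comparing truncated polynomial rings
with systems of parameters. -/
theorem Ideal.finrank_quotient_pow_le {n : ℕ} {y : Fin N → B} {Q : Ideal B}
    (hy : ∀ i, y i ∈ Q) (hQ : Q ≤ Ideal.span (Set.range y) ⊔ Q ^ 2) {v : Fin n → B}
    (hv : Submodule.span k (Set.range v) ⊔ Q.restrictScalars k = ⊤) (t : ℕ) :
    Module.Finite k (B ⧸ Q ^ t) ∧
      Module.finrank k (B ⧸ Q ^ t) ≤ n * (degLT N t).card := by
  let w : Fin n × degLT N t → B ⧸ Q ^ t :=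
    fun x => Ideal.Quotient.mk _ (v x.1 * monomialEval y x.2)
  have hw : Submodule.span k (Set.range w) = ⊤ := by
    refine eq_top_iff.2 fun b _ => ?_
    obtain ⟨b, rfl⟩ := Ideal.Quotient.mk_surjective b
    obtain ⟨a, ha, c, hc, rfl⟩ := Submodule.mem_sup.1
      (Ideal.pow_le_span_sup_pow hy hQ hv 0 t (x := b) (by simp))
    rw [map_add, Ideal.Quotient.eq_zero_iff_mem.2 hc, add_zero]
    have := Submodule.mem_map_of_mem (f := (Ideal.Quotient.mkₐ k (Q ^ t)).toLinearMap) ha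
    rw [Submodule.map_span] at this
    refine Submodule.span_mono ?_ this
    rintro _ ⟨_, ⟨j, s, -, hs, rfl⟩, rfl⟩
    exact ⟨(j, ⟨s, mem_degLT.2 hs⟩), rfl⟩
  refine ⟨⟨hw ▸ Submodule.fg_span (Set.finite_range w)⟩, ?_⟩
  have := finrank_range_le_card (R := k) w
  rw [Set.finrank, hw, finrank_top] at this
  simpa using this

open Classical in
/-- The monomials in `y` that are not congruent, modulo a power of `m`, to a combination of larger
monomials in the degree-lexicographic order. -/
def standardMonomials (k : Type*) [Field k] [Algebra k B] (y : Fin N → B) (m : Ideal B) :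
    Set (Fin N →₀ ℕ) :=
  {s | monomialEval y s ∉ Submodule.span k (monomialEval y '' {s' | toDegLex s < toDegLex s'}) ⊔
    (m ^ (s.degree + 1)).restrictScalars k}

/-- A relation expressing a monomial by larger ones can be multiplied by any monomial, since the
order is compatible with addition. -/
theorem isLowerSet_standardMonomials {y : Fin N → B} {m : Ideal B} (hy : ∀ i, y i ∈ m) :
    IsLowerSet (standardMonomials k y m) := by
  intro a b hba ha hb
  obtain ⟨c, rfl⟩ := exists_add_of_le hba
  refine ha ?_
  rw [monomialEval_add]
  obtain ⟨x, hx, z, hz, hxz⟩ := Submodule.mem_sup.1 hb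
  rw [← hxz, add_mul]
  refine add_mem (Submodule.mem_sup_left ?_) (Submodule.mem_sup_right ?_)
  · clear hxz
    induction hx using Submodule.span_induction with
    | mem x hx =>
      obtain ⟨s, hs, rfl⟩ := hx
      refine Submodule.subset_span ⟨s + c, ?_, monomialEval_add y s c⟩
      exact add_lt_add_left (α := DegLex (Fin N →₀ ℕ)) hs (toDegLex c)
    | zero => rw [zero_mul]; exact zero_mem _
    | add a b _ _ ha hb => rw [add_mul]; exact add_mem ha hb
    | smul a b _ hb => rw [smul_mul_assoc]; exact Submodule.smul_mem _ _ hb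
  · change z * monomialEval y c ∈ m ^ ((b + c).degree + 1)
    rw [map_add, add_right_comm, pow_add]
    exact Ideal.mul_mem_mul hz (monomialEval_mem_pow hy c)

-- The standard monomials of degree < t form a basis of B/m^t. Since the order refines the degree,
-- m^(deg s + 1) is itself spanned by larger monomials modulo m^t.
open Classical in
theorem finrank_quotient_pow_eq_card_standardMonomials {y : Fin N → B} {m : Ideal B}
    (hm : m = Ideal.span (Set.range y)) (hk : ∀ b : B, ∃ c : k, b - algebraMap k B c ∈ m)
    (t : ℕ) :
    Module.finrank k (B ⧸ m ^ t) =
      ((degLT N t).filter (· ∈ standardMonomials k y m)).card := by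
  have hy : ∀ i, y i ∈ m := fun i => hm ▸ Ideal.subset_span ⟨i, rfl⟩
  have hv : Submodule.span k (Set.range fun _ : Unit => (1 : B)) ⊔ m.restrictScalars k = ⊤ := by
    refine eq_top_iff.2 fun b _ => ?_
    obtain ⟨c, hc⟩ := hk b
    rw [← add_sub_cancel (algebraMap k B c) b, Algebra.algebraMap_eq_smul_one]
    rw [Algebra.algebraMap_eq_smul_one] at hc
    exact Submodule.add_mem_sup (Submodule.smul_mem _ _ (Submodule.subset_span ⟨(), rfl⟩)) hc
  have hpow := Ideal.pow_le_span_sup_pow hy (le_sup_of_le_left hm.le) hv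
  simp only [one_mul, exists_const] at hpow
  have hstd (s : Fin N →₀ ℕ) (hs : s.degree < t) (x : B)
      (hx : x ∈ Submodule.span k (monomialEval y '' {s' | toDegLex s < toDegLex s'}) ⊔
        (m ^ (s.degree + 1)).restrictScalars k) :
      x ∈ Submodule.span k
        (monomialEval y '' {s' | toDegLex s < toDegLex s' ∧ s'.degree < t}) ⊔
        (m ^ t).restrictScalars k := by
    refine (sup_le ?_ ?_ : _ ≤ Submodule.span k
        (monomialEval y '' {s' | toDegLex s < toDegLex s' ∧ s'.degree < t}) ⊔
        (m ^ t).restrictScalars k) hx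
    · rw [Submodule.span_le]
      rintro _ ⟨s', hs', rfl⟩
      by_cases h : s'.degree < t
      · exact Submodule.mem_sup_left (Submodule.subset_span ⟨s', ⟨hs', h⟩, rfl⟩)
      · exact Submodule.mem_sup_right
          (Ideal.pow_le_pow_right (not_lt.1 h) (monomialEval_mem_pow hy s'))
    · refine (hpow _ t).trans (sup_le_sup_right (Submodule.span_mono ?_) _)
      rintro _ ⟨s', h1, h2, rfl⟩
      exact ⟨s', ⟨Finsupp.DegLex.lt_iff.2 (.inl h1), h2⟩, rfl⟩
  let S := (degLT N t).filter (· ∈ standardMonomials k y m)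
  let w : S → B ⧸ m ^ t := fun s => Ideal.Quotient.mk _ (monomialEval y s)
  have hspan : ⊤ ≤ Submodule.span k (Set.range w) := by
    have key (s : DegLex (Fin N →₀ ℕ)) : (ofDegLex s).degree < t →
        Ideal.Quotient.mk (m ^ t) (monomialEval y (ofDegLex s)) ∈
          Submodule.span k (Set.range w) := by
      intro hs
      have hfin : {s : DegLex (Fin N →₀ ℕ) | (ofDegLex s).degree < t}.Finite :=
        (degLT N t).finite_toSet.subset fun s hs => mem_degLT.2 hs
      -- Rewriting a nonstandard monomial produces larger ones; only finitely many have degree < t,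
      -- so this terminates.
      have hwf : WellFounded fun a b : {s : DegLex (Fin N →₀ ℕ) // (ofDegLex s).degree < t} =>
          b < a := by
        have : Finite {s : DegLex (Fin N →₀ ℕ) // (ofDegLex s).degree < t} := hfin
        exact wellFounded_gt
      have := hwf.induction (C := fun s => Ideal.Quotient.mk (m ^ t)
        (monomialEval y (ofDegLex s.1)) ∈ Submodule.span k (Set.range w)) ⟨s, hs⟩
      refine this ?_
      rintro ⟨s, hs⟩ ih
      by_cases h : ofDegLex s ∈ standardMonomials k y m
      · exact Submodule.subset_span ⟨⟨ofDegLex s, Finset.mem_filter.2 ⟨mem_degLT.2 hs, h⟩⟩, rfl⟩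
      · obtain ⟨a, ha, b, hb, hab⟩ := Submodule.mem_sup.1 (hstd _ hs _ (not_not.1 h))
        change Ideal.Quotient.mk (m ^ t) (monomialEval y (ofDegLex s)) ∈ _
        rw [← hab, map_add, Ideal.Quotient.eq_zero_iff_mem.2 hb, add_zero]
        have := Submodule.mem_map_of_mem (f := (Ideal.Quotient.mkₐ k (m ^ t)).toLinearMap) ha
        rw [Submodule.map_span] at this
        refine Submodule.span_le.2 ?_ this
        rintro _ ⟨_, ⟨s', hs', rfl⟩, rfl⟩
        exact ih ⟨toDegLex s', hs'.2⟩ hs'.1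
    intro b _
    obtain ⟨b, rfl⟩ := Ideal.Quotient.mk_surjective b
    obtain ⟨a, ha, c, hc, rfl⟩ := Submodule.mem_sup.1 (hpow 0 t (x := b) (by simp))
    rw [map_add, Ideal.Quotient.eq_zero_iff_mem.2 hc, add_zero]
    have := Submodule.mem_map_of_mem (f := (Ideal.Quotient.mkₐ k (m ^ t)).toLinearMap) ha
    rw [Submodule.map_span] at this
    refine Submodule.span_le.2 ?_ this
    rintro _ ⟨_, ⟨s, -, hs, rfl⟩, rfl⟩
    exact key (toDegLex s) hs
  have hli : LinearIndependent k w := by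
    rw [Fintype.linearIndependent_iff]
    intro c hc
    by_contra! hne
    let T := Finset.univ.filter fun s : S => c s ≠ 0
    -- In a linear relation, the smallest exponent that occurs would be expressed by larger ones and
    -- hence not be standard.
    obtain ⟨s, hsT, hmin⟩ := T.exists_min_image (fun s => toDegLex s.1)
      (hne.imp fun s hs => by simpa [T] using hs)
    have hs0 : c s ≠ 0 := by simpa [T] using hsT
    have hs := Finset.mem_filter.1 s.2
    refine hs.2 ?_
    have hmem : ∑ s : S, c s • monomialEval y s.1 ∈ m ^ t := by
      rw [← Ideal.Quotient.eq_zero_iff_mem, ← hc, map_sum]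
      rfl
    rw [← Finset.add_sum_erase _ _ (Finset.mem_univ s)] at hmem
    have h1 : c s • monomialEval y s.1 ∈
        Submodule.span k (monomialEval y '' {s' | toDegLex s.1 < toDegLex s'}) ⊔
        (m ^ (s.1.degree + 1)).restrictScalars k := by
      rw [← add_sub_cancel_right (c s • monomialEval y s.1)
        (∑ x ∈ Finset.univ.erase s, c x • monomialEval y x.1)]
      refine sub_mem (Submodule.mem_sup_right
        (Ideal.pow_le_pow_right (mem_degLT.1 hs.1) hmem)) (Submodule.mem_sup_left ?_)
      refine sum_mem fun x hx => ?_
      by_cases hx0 : c x = 0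
      · rw [hx0, zero_smul]; exact zero_mem _
      · refine Submodule.smul_mem _ _ (Submodule.subset_span ⟨x, ?_, rfl⟩)
        refine lt_of_le_of_ne (hmin x (by simpa [T] using hx0)) fun h => ?_
        exact (Finset.mem_erase.1 hx).1 (Subtype.ext (toDegLex_injective h).symm)
    have := Submodule.smul_mem _ (c s)⁻¹ h1
    rwa [inv_smul_smul₀ hs0] at this
  rw [Module.finrank_eq_card_basis (Module.Basis.mk hli hspan), Fintype.card_coe]

theorem isEventuallyPolynomial_finrank_quotient_pow [IsNoetherianRing B] {m : Ideal B}
    (hk : ∀ b : B, ∃ c : k, b - algebraMap k B c ∈ m) :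
    IsEventuallyPolynomial fun t => Module.finrank k (B ⧸ m ^ t) := by
  classical
  obtain ⟨M, y, hy⟩ := Submodule.fg_iff_exists_fin_generating_family.1 (IsNoetherian.noetherian m)
  simp only [finrank_quotient_pow_eq_card_standardMonomials hy.symm hk]
  exact (isLowerSet_standardMonomials fun i =>
    hy ▸ Submodule.subset_span ⟨i, rfl⟩).isEventuallyPolynomial_card

end

end

/-! ### Height of a rational point, and the multiplicity bound. -/

noncomputable section

open TruncAlg Filter

section

variable {k : Type*} [Field k] {A : Type*} [CommRing A] [Algebra k A]

theorem finite_cotangent_ker [IsNoetherianRing A] (ε : A →ₐ[k] k) :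
    Module.Finite k (RingHom.ker ε).Cotangent := by
  obtain ⟨s, hs⟩ := Module.finite_def.1
    (Module.Finite.of_surjective _ (RingHom.ker ε).toCotangent_surjective)
  refine ⟨⟨s, eq_top_iff.2 fun x _ => ?_⟩⟩
  have hx : x ∈ Submodule.span A (s : Set (RingHom.ker ε).Cotangent) := hs ▸ Submodule.mem_top
  induction hx using Submodule.span_induction with
  | mem x hx => exact Submodule.subset_span hx
  | zero => exact zero_mem _
  | add a b _ _ ha hb => exact add_mem (ha trivial) (hb trivial)
  | smul a b _ hb =>
    rw [PointFrame.smul_cotangent]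
    exact Submodule.smul_mem _ _ (hb trivial)

/-- The growth of the truncated polynomial rings onto which `A` surjects bounds the height of a
rational point from below. -/
theorem finrank_cotangent_le_height [IsNoetherianRing A] (ε : A →ₐ[k] k)
    (hA : ∀ N, LiftsTrunc k A N) :
    (Module.finrank k (RingHom.ker ε).Cotangent : ℕ∞) ≤ (RingHom.ker ε).height := by
  have := finite_cotangent_ker ε
  have hprime : (RingHom.ker ε).IsPrime := RingHom.ker_isPrime _
  set p := RingHom.ker ε with hp
  set N := Module.finrank k p.Cotangent
  -- A system of parameters: 𝔭 is minimal over the ideal of `s`, with as many elements as the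
  -- height. After localization some power 𝔭^e lies in that ideal.
  obtain ⟨s, hs, hcard⟩ := p.exists_finset_card_eq_height_of_isNoetherianRing
  rw [← hcard, Nat.cast_le]
  let I : Ideal A := Ideal.span s
  let L := Localization.AtPrime p
  let J : Ideal A := (I.map (algebraMap A L)).comap (algebraMap A L)
  have hJ (a : A) (ha : a ∈ J) : ∃ u ∉ p, u * a ∈ I :=
    (IsLocalization.algebraMap_mem_map_algebraMap_iff p.primeCompl L I a).1 ha
  have hrad : p ≤ J.radical := by
    rw [← Ideal.comap_radical, Ideal.radical_eq_sInf, ← Ideal.map_le_iff_le_comap]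
    refine le_sInf fun P ⟨hIP, hP⟩ => Ideal.map_le_iff_le_comap.2 ?_
    refine hs.2 ⟨hP.comap _, Ideal.map_le_iff_le_comap.1 hIP⟩ ?_
    refine le_of_le_of_eq ?_ (IsLocalization.AtPrime.under_maximalIdeal L p)
    exact Ideal.comap_mono (IsLocalRing.le_maximalIdeal hP.ne_top)
  obtain ⟨e, he⟩ := Ideal.exists_pow_le_of_le_radical_of_fg hrad (IsNoetherian.noetherian p)
  have hfin : Module.Finite k (A ⧸ p ^ e) := by
    obtain ⟨M, y, hy⟩ := Submodule.fg_iff_exists_fin_generating_family.1 (IsNoetherian.noetherian p)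
    refine (Ideal.finrank_quotient_pow_le (k := k) (v := fun _ : Fin 1 => (1 : A)) (y := y)
      (fun i => hy ▸ Submodule.subset_span ⟨i, rfl⟩) (le_sup_of_le_left hy.ge) ?_ e).1
    refine eq_top_iff.2 fun b _ => ?_
    rw [← add_sub_cancel (algebraMap k A (ε b)) b, Algebra.algebraMap_eq_smul_one]
    refine Submodule.add_mem_sup (Submodule.smul_mem _ _ (Submodule.subset_span ⟨0, rfl⟩)) ?_
    change b - ε b • (1 : A) ∈ RingHom.ker ε
    rw [RingHom.mem_ker]
    simp
  let v : Fin (Module.finrank k (A ⧸ p ^ e)) → A :=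
    fun j => Function.surjInv Ideal.Quotient.mk_surjective (Module.finBasis k (A ⧸ p ^ e) j)
  have hv : Submodule.span k (Set.range v) ⊔ (p ^ e).restrictScalars k = ⊤ := by
    refine eq_top_iff.2 fun b _ => ?_
    rw [← add_sub_cancel (∑ j, (Module.finBasis k (A ⧸ p ^ e)).repr (Ideal.Quotient.mk _ b) j • v j) b]
    refine Submodule.add_mem_sup (sum_mem fun j _ => Submodule.smul_mem _ _
      (Submodule.subset_span ⟨j, rfl⟩)) ?_
    change _ ∈ p ^ e
    rw [← Ideal.Quotient.eq_zero_iff_mem, map_sub, map_sum, sub_eq_zero]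
    conv_lhs => rw [← (Module.finBasis k (A ⧸ p ^ e)).sum_repr (Ideal.Quotient.mk _ b)]
    refine Finset.sum_congr rfl fun j _ => ?_
    conv_lhs => rw [← Function.surjInv_eq Ideal.Quotient.mk_surjective
      (Module.finBasis k (A ⧸ p ^ e) j)]
    rfl
  obtain ⟨y, hy⟩ : ∃ y : Fin s.card → A, Set.range y = s :=
    ⟨fun i => s.equivFin.symm i, by
      rw [Set.range_comp' Subtype.val, Equiv.range_eq_univ, Set.image_univ, Subtype.range_coe]⟩
  let F := PointFrame.ofCotangent ε
  -- The image of `s` generates an ideal Q of the truncation with Q^(t+1) = 0 and containing the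
  -- image of 𝔭^e, because elements outside 𝔭 become units. So the truncation is spanned by dim
  -- A/𝔭^e times the monomials in `s.card` variables.
  have key (t : ℕ) : (degLT N (t + 1)).card ≤
      Module.finrank k (A ⧸ p ^ e) * (degLT s.card (t + 1)).card := by
    have h0 : 0 ∈ degLT N (t + 1) := zero_mem_degLT t.succ_pos
    obtain ⟨φ, hφ, hφε⟩ := exists_surjective_truncAlg (hA N) F.ε F.δ F.leibniz F.surjective
      (degLT N (t + 1)) (isLowerSet_degLT _ _) h0
    have : IsLocalRing (TruncAlg k (degLT N (t + 1))) := isLocalRing h0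
    let Q : Ideal (TruncAlg k (degLT N (t + 1))) := Ideal.span (Set.range (φ ∘ y))
    have hQ : I.map φ = Q := by
      rw [Ideal.map_span, ← hy, ← Set.range_comp]
    have hpQ : (p ^ e).map φ ≤ Q := by
      rw [Ideal.map_le_iff_le_comap]
      intro a ha
      obtain ⟨u, hu, hua⟩ := hJ a (he ha)
      have h1 : φ u * φ a ∈ Q := by
        rw [← map_mul, ← hQ]; exact Ideal.mem_map_of_mem _ hua
      have h2 : IsUnit (φ u) := by
        by_contra h3
        have h4 : RingHom.ker (aug (k := k) h0) = IsLocalRing.maximalIdeal _ :=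
          IsLocalRing.eq_maximalIdeal
            (RingHom.ker_isMaximal_of_surjective _ (aug_surjective h0))
        have h5 : φ u ∈ RingHom.ker (aug (k := k) h0) :=
          h4 ▸ (IsLocalRing.mem_maximalIdeal _).2 h3
        rw [RingHom.mem_ker, hφε] at h5
        exact hu h5
      exact (Ideal.unit_mul_mem_iff_mem _ h2).1 h1
    have hQt : Q ^ (t + 1) = ⊥ := by
      refine le_bot_iff.1 ((Ideal.pow_right_mono (?_ : Q ≤ RingHom.ker (aug (k := k) h0)) _).trans
        (ker_aug_pow_degLT t.succ_pos).le)
      rw [Ideal.span_le]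
      rintro _ ⟨i, rfl⟩
      have : y i ∈ p := hs.1.2 (Ideal.subset_span (hy ▸ ⟨i, rfl⟩))
      rw [SetLike.mem_coe, RingHom.mem_ker, Function.comp, hφε]
      exact this
    have h1 := (Ideal.finrank_quotient_pow_le (k := k) (v := φ ∘ v) (y := φ ∘ y) (Q := Q)
      (fun i => Ideal.subset_span ⟨i, rfl⟩) le_sup_left (by
        refine eq_top_iff.2 fun b _ => ?_
        obtain ⟨a, rfl⟩ := hφ b
        obtain ⟨c, hc, d, hd, rfl⟩ := Submodule.mem_sup.1
          (show a ∈ Submodule.span k (Set.range v) ⊔ (p ^ e).restrictScalars k from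
            hv ▸ Submodule.mem_top)
        rw [map_add]
        refine Submodule.add_mem_sup ?_ (hpQ (Ideal.mem_map_of_mem _ hd))
        rw [Set.range_comp, ← AlgHom.toLinearMap_apply, ← AlgHom.coe_toLinearMap,
          ← Submodule.map_span]
        exact Submodule.mem_map_of_mem hc) (t + 1)).2
    rw [hQt, (AlgEquiv.quotientBot k _).toLinearEquiv.finrank_eq,
      finrank (isLowerSet_degLT N (t + 1))] at h1
    exact h1
  by_contra! hlt
  set c := Module.finrank k (A ⧸ p ^ e)
  have h1 := key (c * (s.card + 1))
  rw [card_degLT_succ, card_degLT_succ] at h1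
  -- With more than h = `s.card` variables, the count at this t is at least (t+h+1)/(h+1) > c times
  -- the count in h variables, contradicting `key`.
  set t := c * (s.card + 1) with ht
  have h2 : (t + s.card + 1).choose (s.card + 1) ≤ (t + N).choose N := by
    rw [add_assoc, ← Nat.choose_symm_add, ← Nat.choose_symm_add]
    exact Nat.choose_le_choose _ (by omega)
  have h3 := Nat.add_one_mul_choose_eq (t + s.card) s.card
  have h4 : 0 < (t + s.card).choose s.card := Nat.choose_pos (by omega)
  have h5 : (t + s.card + 1) * (t + s.card).choose s.card ≤
      t * (t + s.card).choose s.card := by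
    rw [h3]
    calc _ ≤ c * (t + s.card).choose s.card * (s.card + 1) := by gcongr; exact h2.trans h1
      _ = t * (t + s.card).choose s.card := by rw [ht]; ring
  have := Nat.le_of_mul_le_mul_right h5 h4
  omega

end

/-- The residue field of `B` is `k`, so simple `B`-modules are one-dimensional. -/
theorem Module.length_eq_finrank_of_residueField {k B : Type*} [Field k] [CommRing B] [Algebra k B]
    [IsLocalRing B] (hk : ∀ b : B, ∃ c : k, b - algebraMap k B c ∈ IsLocalRing.maximalIdeal B)
    (M : Type*) [AddCommGroup M] [Module B M] [Module k M] [IsScalarTower k B M]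
    [Module.Finite k M] :
    Module.length B M = Module.finrank k M := by
  have hs : Function.Surjective (algebraMap (IsLocalRing.ResidueField k)
      (IsLocalRing.ResidueField B)) := by
    intro x
    obtain ⟨b, rfl⟩ := IsLocalRing.residue_surjective x
    obtain ⟨c, hc⟩ := hk b
    refine ⟨IsLocalRing.residue k c, ?_⟩
    rw [IsLocalRing.ResidueField.algebraMap_residue, eq_comm, ← sub_eq_zero, ← map_sub]
    exact (IsLocalRing.residue_eq_zero_iff _).2 hc
  rw [← Module.length_eq_finrank, IsLocalRing.length_restrictScalars k B M,
    Module.length_eq_of_surjective (M := IsLocalRing.ResidueField B) hs, Module.length_eq_one (IsLocalRing.ResidueField B) (IsLocalRing.ResidueField B), mul_one]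

section

variable {k : Type u} [Field k] {A C B : Type u} [CommRing A] [Algebra k A]
  [CommRing C] [Algebra k C] [Algebra A C] [IsScalarTower k A C]

-- The elements `v` lift a basis of the fibre C/𝔭C, which has dimension n because the rank is
-- constant.
open TensorProduct in
theorem exists_span_sup_map_eq_top (ε : A →ₐ[k] k) [Module.Finite A C] [Module.Flat A C] {n : ℕ}
    (hrank : ∀ p, Module.rankAtStalk (R := A) C p = n) :
    ∃ v : Fin n → C, Submodule.span k (Set.range v) ⊔
      ((RingHom.ker ε).map (algebraMap A C)).restrictScalars k = ⊤ := by
  set p := RingHom.ker ε with hp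
  have hmax : p.IsMaximal := RingHom.ker_isMaximal_of_surjective ε fun c =>
    ⟨algebraMap k A c, by simp⟩
  let _ : Field (A ⧸ p) := Ideal.Quotient.field p
  have hn : Module.finrank (A ⧸ p) ((A ⧸ p) ⊗[A] C) = n := by
    have := Module.rankAtStalk_baseChange (R := A) (M := C) (S := A ⧸ p) ⊥
    rw [hrank, Module.rankAtStalk_eq_finrank_of_free] at this
    simpa using this
  let b := Module.finBasisOfFinrankEq (A ⧸ p) ((A ⧸ p) ⊗[A] C) hn
  let e := TensorProduct.quotTensorEquivQuotSMul C p
  choose v hv using fun j => Submodule.mkQ_surjective _ (e (b j))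
  refine ⟨v, eq_top_iff.2 fun c _ => ?_⟩
  choose a ha using fun j => Ideal.Quotient.mk_surjective (b.repr (e.symm (Submodule.mkQ _ c)) j)
  have h1 : Submodule.mkQ (p • (⊤ : Submodule A C)) (∑ j, a j • v j) = Submodule.mkQ _ c := by
    simp only [map_sum, map_smul, hv]
    simp only [← map_smul, ← map_sum]
    rw [← LinearEquiv.eq_symm_apply]
    conv_rhs => rw [← b.sum_repr (e.symm (Submodule.mkQ _ c))]
    refine Finset.sum_congr rfl fun j _ => ?_
    rw [← ha j]
    rfl
  have h2 : c - ∑ j, a j • v j ∈ p.map (algebraMap A C) := by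
    have := (Submodule.Quotient.eq _).1 h1.symm
    rwa [Ideal.smul_top_eq_map] at this
  have h3 : ∑ j, (a j • v j - ε (a j) • v j) ∈ p.map (algebraMap A C) := by
    refine sum_mem fun j _ => ?_
    rw [← algebraMap_smul A (ε (a j)), ← sub_smul, Algebra.smul_def]
    refine Ideal.mul_mem_right _ _ (Ideal.mem_map_of_mem _ ?_)
    rw [hp, RingHom.mem_ker]
    simp
  have h4 : c = ∑ j, ε (a j) • v j +
      ((c - ∑ j, a j • v j) + ∑ j, (a j • v j - ε (a j) • v j)) := by
    rw [Finset.sum_sub_distrib]; ring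
  rw [h4]
  exact Submodule.add_mem_sup (sum_mem fun j _ => Submodule.smul_mem _ _
    (Submodule.subset_span ⟨j, rfl⟩)) (add_mem h2 h3)

/-- The Samuel multiplicity at a rational point of a finite flat scheme of rank `n` over a scheme
whose points lift to truncated polynomial rings is at most `n`. -/
theorem exists_hasSamuelMultiplicity_le [IsNoetherianRing A] (hA : ∀ N, LiftsTrunc k A N)
    [Module.Finite A C] [Module.Flat A C] {n : ℕ}
    (hrank : ∀ p, Module.rankAtStalk (R := A) C p = n) (δ : C →ₐ[k] k) (P : Ideal C)
    [hP : P.IsMaximal] (hδ : RingHom.ker δ = P)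
    [CommRing B] [Algebra C B] [IsLocalRing B] [IsLocalization.AtPrime B P] :
    ∃ μ : ℝ, HasSamuelMultiplicity B μ ∧ μ ≤ n := by
  let ε : A →ₐ[k] k := δ.comp (IsScalarTower.toAlgHom k A C)
  set p := RingHom.ker ε with hp
  have hcot := finite_cotangent_ker ε
  have hpprime : p.IsPrime := RingHom.ker_isPrime _
  have hCN : IsNoetherianRing C := IsNoetherianRing.of_finite A C
  have hBN : IsNoetherianRing B := IsLocalization.isNoetherianRing P.primeCompl B hCN
  have hlies : P.LiesOver p := ⟨by
    ext a
    rw [Ideal.mem_under, ← hδ]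
    rfl⟩
  let N := Module.finrank k p.Cotangent
  -- Flatness gives going down, so the height of `P` is at least that of `p`.
  have hle : (N : ℕ∞) ≤ P.height := (finrank_cotangent_le_height ε hA).trans (by
    rw [Ideal.height_eq_height_add_of_liesOver_of_hasGoingDown p P]
    exact le_self_add)
  have hdim : ringKrullDim B = P.height := IsLocalization.AtPrime.ringKrullDim_eq_height P B
  obtain ⟨d, hd⟩ : ∃ d : ℕ, P.height = d := (ENat.ne_top_iff_exists.1
    (Ideal.height_ne_top hP.ne_top)).imp fun _ h => h.symm
  rw [hd] at hdim hle
  have hNd : N ≤ d := by exact_mod_cast hle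
  let _ : Algebra k B := ((algebraMap C B).comp (algebraMap k C)).toAlgebra
  have hkC : ∀ c : C, ∃ a : k, c - algebraMap k C a ∈ P := fun c =>
    ⟨δ c, by rw [← hδ, RingHom.mem_ker]; simp⟩
  have : IsScalarTower k C B := .of_algebraMap_eq' rfl
  let equiv (t : ℕ) : (C ⧸ P ^ t) ≃ₗ[k] (B ⧸ IsLocalRing.maximalIdeal B ^ t) :=
    (IsLocalization.AtPrime.equivQuotMaximalIdealPow P B t).toLinearEquiv.restrictScalars k
  have hkB : ∀ b : B, ∃ a : k, b - algebraMap k B a ∈ IsLocalRing.maximalIdeal B := by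
    intro b
    obtain ⟨x, hx⟩ := (IsLocalization.AtPrime.equivQuotMaximalIdeal P B).surjective
      (Ideal.Quotient.mk _ b)
    obtain ⟨c, rfl⟩ := Ideal.Quotient.mk_surjective x
    obtain ⟨a, ha⟩ := hkC c
    refine ⟨a, ?_⟩
    rw [← Ideal.Quotient.eq_zero_iff_mem, map_sub, sub_eq_zero, ← hx, Ideal.Quotient.eq.2 ha]
    exact IsLocalization.AtPrime.equivQuotMaximalIdeal_apply_mk P B _
  obtain ⟨y, hy, hpy⟩ := (PointFrame.ofCotangent ε).exists_generators
  obtain ⟨v, hv⟩ := exists_span_sup_map_eq_top (C := C) ε hrank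
  let Q : Ideal C := p.map (algebraMap A C)
  have hQP : Q ≤ P := Ideal.map_le_iff_le_comap.2 hlies.over.le
  -- The bound is proved for the powers of Q = pC, and passes to those of `P` because Q ≤ P.
  have hbound (t : ℕ) : Module.Finite k (C ⧸ P ^ t) ∧
      Module.finrank k (C ⧸ P ^ t) ≤ n * (degLT N t).card := by
    obtain ⟨h1, h2⟩ := Ideal.finrank_quotient_pow_le (k := k) (Q := Q)
      (y := fun i => algebraMap A C (y i)) (v := v)
      (fun i => Ideal.mem_map_of_mem _ (hy i)) (by
        have := Ideal.map_mono (f := algebraMap A C) hpy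
        rw [Ideal.map_sup, Ideal.map_span, Ideal.map_pow, ← Set.range_comp] at this
        exact this) hv t
    let f : (C ⧸ Q ^ t) →ₗ[k] (C ⧸ P ^ t) :=
      (Ideal.Quotient.factorₐ k (Ideal.pow_right_mono hQP t)).toLinearMap
    have hf : Function.Surjective f := Ideal.Quotient.factor_surjective (Ideal.pow_right_mono hQP t)
    exact ⟨.of_surjective f hf, (LinearMap.finrank_le_finrank_of_surjective hf).trans h2⟩
  obtain ⟨μ, hμ, hμn⟩ := (isEventuallyPolynomial_finrank_quotient_pow hkC).exists_tendsto hNd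
    fun t => (hbound t).2
  refine ⟨μ, ⟨hBN, d, hdim, hμ.congr fun t => ?_⟩, hμn⟩
  have := (hbound t).1
  have : Module.Finite k (B ⧸ IsLocalRing.maximalIdeal B ^ t) := .equiv (equiv t)
  rw [Module.length_eq_finrank_of_residueField hkB, (equiv t).finrank_eq, ENat.toNat_natCast]

end

end

/-! ### Reduction to affine charts, and the theorem. -/

noncomputable section

/-- The Nullstellensatz: closed points over an algebraically closed field are rational. -/
theorem exists_algHom_ker_eq (k : Type*) {D : Type*} [Field k] [IsAlgClosed k] [CommRing D]
    [Algebra k D] [Algebra.FiniteType k D] (P : Ideal D) [P.IsMaximal] :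
    ∃ δ : D →ₐ[k] k, RingHom.ker δ = P := by
  let _ : Field (D ⧸ P) := Ideal.Quotient.field P
  obtain ⟨ε⟩ := exists_algHom_of_finiteType k (D ⧸ P)
  refine ⟨ε.comp (Ideal.Quotient.mkₐ k P), ?_⟩
  ext x
  rw [RingHom.mem_ker, AlgHom.comp_apply, map_eq_zero_iff ε (RingHom.injective ε.toRingHom)]
  exact Ideal.Quotient.eq_zero_iff_mem

variable {k : Type u} [Field k]

theorem IsQuasiProjective.isSeparated {X : Scheme.{u}} {f : X ⟶ Spec (.of k)}
    (hf : IsQuasiProjective f) : IsSeparated f := by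
  obtain ⟨N, j, hj, -⟩ := hf
  have h1 : Scheme.IsSeparated (projSpace k N) := inferInstance
  have h2 : f ≫ terminal.from _ = j ≫ terminal.from _ := Subsingleton.elim _ _
  have h3 : IsSeparated (terminal.from (projSpace k N)) := h1.isSeparated_terminal_from
  have h4 : IsSeparated (f ≫ terminal.from _) := h2 ▸ inferInstance
  exact .of_comp f (terminal.from _)

theorem exists_affine_chart {H : Scheme.{u}} (h : H ⟶ Spec (.of k)) [LocallyOfFiniteType h]
    (η : H) : ∃ (A : Type u) (_ : CommRing A) (_ : Algebra k A) (i : Spec (.of A) ⟶ H),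
      Algebra.FiniteType k A ∧ IsOpenImmersion i ∧ η ∈ Set.range i ∧ i ≫ h = specHom k A := by
  obtain ⟨A, i, hi, y, hy⟩ := Scheme.exists_Spec_apply_eq η
  obtain ⟨ψ, hψ⟩ := Spec.map_surjective (i ≫ h)
  let _ : Algebra k A := ψ.hom.toAlgebra
  refine ⟨A, inferInstance, inferInstance, i, ?_, hi, ⟨y, hy⟩, hψ.symm⟩
  have h1 : LocallyOfFiniteType (Spec.map ψ) := hψ ▸ inferInstance
  exact RingHom.finiteType_algebraMap.1
    ((HasRingHomProperty.Spec_iff (P := @LocallyOfFiniteType)).1 h1)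

theorem IsFamily.of_specHom {X : Scheme.{u}} {f : X ⟶ Spec (.of k)} {n : ℕ} {A C : Type u}
    [CommRing A] [CommRing C] [Algebra A C] {t : Spec (.of A) ⟶ Spec (.of k)}
    {q : Spec (.of C) ⟶ X} (hF : IsFamily f n t q (specHom A C)) :
    Module.Finite A C ∧ Module.Flat A C ∧ ∀ p, Module.rankAtStalk (R := A) C p = n := by
  have h1 : Module.Finite A C :=
    RingHom.finite_algebraMap.1 ((IsFinite.SpecMap_iff _).1 hF.isFinite)
  have h2 : Module.Flat A C := RingHom.flat_algebraMap_iff.1 (Flat.SpecMap_iff.1 hF.flat)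
  exact ⟨h1, h2, fun p => by rw [← Scheme.Hom.finrank_SpecMap_algebraMap]; exact hF.rank p⟩

theorem IsHilbertScheme.exists_hasSamuelMultiplicity_le [IsAlgClosed k] [CharZero k]
    {X : Scheme.{u}} {f : X ⟶ Spec (.of k)} [SmoothOfRelativeDimension 2 f] [IsSeparated f] {n : ℕ}
    {H Z : Scheme.{u}} {h : H ⟶ Spec (.of k)} {q : Z ⟶ X} {π : Z ⟶ H}
    (hH : IsHilbertScheme f n h q π) (ζ : Z) (hζ : IsClosed ({ζ} : Set Z)) :
    ∃ μ : ℝ, HasSamuelMultiplicity (Z.presheaf.stalk ζ) μ ∧ μ ≤ n := by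
  have := hH.locallyOfFiniteType
  have := hH.isFamily.isFinite
  obtain ⟨A, _, _, i, hA, hi, ⟨y, hy⟩, hih⟩ := exists_affine_chart h (π ζ)
  obtain ⟨C, _, _, g, hp⟩ := exists_isPullback_specHom π i
  have hg : IsOpenImmersion g := MorphismProperty.of_isPullback (P := @IsOpenImmersion) hp.flip hi
  obtain ⟨x, rfl⟩ : ∃ x, g x = ζ := by
    obtain ⟨w, hw, -⟩ := Scheme.Pullback.exists_preimage_pullback ζ y hy.symm
    refine ⟨hp.isoPullback.inv w, ?_⟩
    rw [← hw, ← hp.isoPullback_inv_fst]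
    rfl
  obtain ⟨_, _, hrank⟩ := (hH.isFamily.baseChange hp).of_specHom
  have hx : IsClosed ({x} : Set (Spec (.of C))) := by
    have : ({x} : Set (Spec (.of C))) = g ⁻¹' {g x} := by
      ext z
      exact (g.isOpenEmbedding.injective.eq_iff (a := z) (b := x)).symm
    rw [this]
    exact hζ.preimage g.continuous
  have hP : x.asIdeal.IsMaximal := (PrimeSpectrum.isClosed_singleton_iff_isMaximal x).1 hx
  let _ : Algebra k C := ((algebraMap A C).comp (algebraMap k A)).toAlgebra
  have : IsScalarTower k A C := .of_algebraMap_eq' rfl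
  have : Algebra.FiniteType k C := .trans (S := A) hA inferInstance
  have : IsNoetherianRing A := Algebra.FiniteType.isNoetherianRing k A
  obtain ⟨δ, hδ⟩ := exists_algHom_ker_eq k x.asIdeal
  let e : (Spec (.of C)).presheaf.stalk x ≃+* Z.presheaf.stalk (g x) :=
    (asIso (g.stalkMap x)).symm.commRingCatIsoToRingEquiv
  let S := (Spec (.of C)).presheaf.stalk x
  let _ : Algebra C S := StructureSheaf.stalkAlgebra C x
  have hS : IsLocalization.AtPrime S x.asIdeal := StructureSheaf.IsLocalization.to_stalk C x
  let _ : Algebra C (Z.presheaf.stalk (g x)) :=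
    (e.toRingHom.comp (algebraMap C S)).toAlgebra
  have hB : IsLocalization.AtPrime (Z.presheaf.stalk (g x)) x.asIdeal :=
    IsLocalization.isLocalization_of_algEquiv x.asIdeal.primeCompl
      (AlgEquiv.ofRingEquiv (f := e) fun _ => rfl : S ≃ₐ[C] Z.presheaf.stalk (g x))
  exact _root_.exists_hasSamuelMultiplicity_le (k := k) (hH.liftsTrunc i hih) hrank δ x.asIdeal hδ

theorem exists_socleDimAt_eq [IsAlgClosed k] {X : Scheme.{u}} [Nonempty X]
    (f : X ⟶ Spec (.of k)) [SmoothOfRelativeDimension 2 f] [IsSeparated f] {n : ℕ} (hn : 1 ≤ n) :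
    ∃ (ξ : Scheme.{u}) (i : ξ ⟶ X), IsClosedSubschemeOfLength f n i ∧
      ∃ p : ξ, socleDimAt i p = (⌊(Real.sqrt (1 + 8 * (n : ℝ)) - 1) / 2⌋₊ : ℕ∞) := by
  have hb : 1 ≤ ⌊(Real.sqrt (1 + 8 * (n : ℝ)) - 1) / 2⌋₊ := le_floor_of_mul_le (by simpa using hn)
  -- The surplus `e` of n over b(b+1)/2 goes into the first column of the staircase, which does not
  -- change the number of corners.
  obtain ⟨e, he⟩ := Nat.exists_eq_add_of_le (floor_mul_le n)
  obtain ⟨ξ, i, hi, p, hp⟩ := exists_le_socleDimAt f (e := e) hb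
  rw [← he] at hi
  exact ⟨ξ, i, hi, p, le_antisymm (socleDimAt_le f hn i hi p) hp⟩

theorem theorem2 {k : Type u} [Field k] [IsAlgClosed k] [CharZero k]
    {X : Scheme.{u}} [Nonempty X] (f : X ⟶ Spec (.of k))
    (hqp : IsQuasiProjective f) (hsm : SmoothOfRelativeDimension 2 f)
    (n : ℕ) (hn : 1 ≤ n) :
    -- the bound on the socle dimension
    (∀ {ξ : Scheme.{u}} (i : ξ ⟶ X), IsClosedSubschemeOfLength f n i →
      ∀ p : ξ, socleDimAt i p ≤ (⌊(Real.sqrt (1 + 8 * (n : ℝ)) - 1) / 2⌋₊ : ℕ∞)) ∧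
    -- the bound is attained
    (∃ (ξ : Scheme.{u}) (i : ξ ⟶ X), IsClosedSubschemeOfLength f n i ∧
      ∃ p : ξ, socleDimAt i p = (⌊(Real.sqrt (1 + 8 * (n : ℝ)) - 1) / 2⌋₊ : ℕ∞)) ∧
    -- the Samuel multiplicity at every closed point of the universal family is at most `n`
    (∀ {H Z : Scheme.{u}} (h : H ⟶ Spec (.of k)) (q : Z ⟶ X) (π : Z ⟶ H),
      IsHilbertScheme f n h q π → ∀ ζ : Z, IsClosed ({ζ} : Set Z) →
        ∃ μ : ℝ, HasSamuelMultiplicity (Z.presheaf.stalk ζ) μ ∧ μ ≤ n) := by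
  have hsep := hqp.isSeparated
  exact ⟨fun i hi p => socleDimAt_le f hn i hi p, exists_socleDimAt_eq f hn,
    fun _ _ _ hH ζ hζ => hH.exists_hasSamuelMultiplicity_le ζ hζ⟩

end
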